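/- **Theorem 2.6 (Representation stability for $\mathrm{FI}^m$).** Let $k$ be a field of characteristic $0$ and $m \ge 0$ an integer. Let $\mathrm{FI}$ be the category of finite sets and injections, $\mathrm{FI}^m$ its $m$-fold product, and let $V$ be a finitely generated $\mathrm{FI}^m$-module over $k$, i.e. a functor $V$ from $\mathrm{FI}^m$ to $k$-vector spaces for which there is a finite set of elements of the spaces $V_S$ that is contained in no proper submodule (subfunctor) of $V$. For $\mathbf d = (d_1,\dots,d_m) \in \mathbb N^m$ put $V_{\mathbf d} = V_{([d_1],\dots,[d_m])}$, a representation of $S_{\mathbf d} = S_{d_1}\times\cdots\times S_{d_m}$. We say that a property holds for all $\mathbf d \gg 0$ if there is $\mathbf N\in\mathbb N^m$ such that it holds for every $\mathbf d$ with $d_i \ge N_i$ for all $i$. Then: 1. There is a character polynomial $P$, i.e. a polynomial $P \in k[X^{(i)}_j : 1 \le i \le m,\ j \ge 1]$, such that for all $\mathbf d \gg 0$ the space $V_{\mathbf d}$ is finite-dimensional and its character satisfies $\chi_{V_{\mathbf d}}(\sigma) = P_{\mathbf d}(\sigma)$ for all $\sigma = (\sigma_1,\dots,\sigma_m) \in S_{\mathbf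 d}$, where $P_{\mathbf d}(\sigma)$ is the value of $P$ when $X^{(i)}_j$ is the number of $j$-cycles of $\sigma_i$ (fixed points being the $1$-cycles). 2. There is a polynomial $Q \in \mathbb Q[y_1,\dots,y_m]$ such that $\dim_k V_{\mathbf d} = Q(d_1,\dots,d_m)$ for all $\mathbf d \gg 0$. 3. For a list $\boldsymbol\lambda = (\lambda_1,\dots,\lambda_m)$ of partitions (of arbitrary sizes), and $\mathbf d$ with $d_i \ge |\lambda_i| + (\lambda_i)_1$ for all $i$, where $(\lambda_i)_1$ is the largest part of $\lambda_i$ ($0$ if $\lambda_i$ is empty), let $\boldsymbol\lambda[\mathbf d]$ be the list whose $i$-th entry is the partition $(d_i - |\lambda_i|, \lambda_i)$ of $d_i$. For a list $\boldsymbol\mu$ of partitions of $d_1,\dots,d_m$ let $\mathrm{Irr}(\boldsymbol\mu) = \mathrm{Irr}(\mu_1)\boxtimes\cdots\boxtimes\mathrm{Irr}(\mu_m)$, where $\mathrm{Irr}(\mu_i)$ is the irreducible representation (Specht module over $k$) of $S_{d_i}$ indexed by $\mu_i$. There are integers $c_{\boldsymbol\lambda} \ge 0$, independent of $\mathbf d$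 and nonzero for only finitely many $\boldsymbol\lambda$, such that for all $\mathbf d \gg 0$ the list $\boldsymbol\lambda[\mathbf d]$ is defined for every $\boldsymbol\lambda$ with $c_{\boldsymbol\lambda} \ne 0$, and $$V_{\mathbf d} \cong \bigoplus_{\boldsymbol\lambda} \mathrm{Irr}(\boldsymbol\lambda[\mathbf d])^{c_{\boldsymbol\lambda}}$$ as representations of $S_{\mathbf d}$. -/

import Mathlib

open CategoryTheory Filter
open scoped TensorProduct DirectSum

universe u v

noncomputable section

namespace RepStab

/-! ## The category `FI^m` and its modules -/

/-- Objects of `FI`: finite sets. -/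
structure FI : Type 1 where
  carrier : Type
  [finite : Finite carrier]

/-- Morphisms of `FI` are the injections. -/
instance : Category FI where
  Hom S T := S.carrier ↪ T.carrier
  id S := Function.Embedding.refl S.carrier
  comp f g := Function.Embedding.trans f g

/-- The product category `FI^m`: `m`-tuples of finite sets, with `m`-tuples of injections. -/
abbrev FIm (m : ℕ) : Type 1 := Fin m → FI

/-- An `FI^m`-module over `k` is a functor from `FI^m` to `k`-modules. -/
abbrev FImModule (k : Type u) [Field k] (m : ℕ) := FIm m ⥤ ModuleCat.{v} k

/-- The object `([d₁], …, [d_m])` of `FI^m`. -/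
def FIm.std {m : ℕ} (d : Fin m → ℕ) : FIm m := fun i => ⟨Fin (d i)⟩

/-- The group `S_d = S_{d₁} × ⋯ × S_{d_m}`. -/
abbrev SymProd {m : ℕ} (d : Fin m → ℕ) : Type := ∀ i, Equiv.Perm (Fin (d i))

/-- An element of `S_d` as an endomorphism of `([d₁], …, [d_m])` in `FI^m`. -/
def SymProd.toHom {m : ℕ} {d : Fin m → ℕ} (σ : SymProd d) : FIm.std d ⟶ FIm.std d :=
  fun i => (σ i).toEmbedding

section Modules

variable {k : Type u} [Field k] {m : ℕ}

/-- A family of subspaces `W_S ⊆ V_S` is a submodule of `V` if all morphisms of `FI^m`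
preserve it. -/
def IsSubmodule (V : FImModule.{u, v} k m) (W : ∀ S : FIm m, Submodule k (V.obj S)) : Prop :=
  ∀ (S T : FIm m) (f : S ⟶ T), ∀ x ∈ W S, (V.map f).hom x ∈ W T

/-- `V` is finitely generated: there is a finite set `G` of elements (each lying in some `V_S`)
such that the only submodule of `V` containing `G` is `V` itself. -/
def IsFinitelyGenerated (V : FImModule.{u, v} k m) : Prop :=
  ∃ G : Set (Σ S : FIm m, V.obj S), G.Finite ∧
    ∀ W : ∀ S : FIm m, Submodule k (V.obj S), IsSubmodule V W →
      (∀ x ∈ G, x.2 ∈ W x.1) → ∀ S, W S = ⊤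

/-- The vector space `V_d`. -/
abbrev deg (V : FImModule.{u, v} k m) (d : Fin m → ℕ) : Type v := V.obj (FIm.std d)

/-- The representation of `S_d` on `V_d`. -/
def degRep (V : FImModule.{u, v} k m) (d : Fin m → ℕ) : Representation k (SymProd d) (deg V d) where
  toFun σ := (V.map σ.toHom).hom
  map_one' := by
    have h : SymProd.toHom (1 : SymProd d) = 𝟙 (FIm.std d) := rfl
    rw [h, V.map_id]
    rfl
  map_mul' σ τ := by
    have h : SymProd.toHom (σ * τ) = SymProd.toHom τ ≫ SymProd.toHom σ := rfl
    rw [h, V.map_comp]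
    rfl

end Modules

/-! ## Character polynomials -/

/-- The number of `j`-cycles of a permutation (fixed points being the `1`-cycles). -/
def cycleCount {n : ℕ} (σ : Equiv.Perm (Fin n)) (j : ℕ+) : ℕ :=
  σ.partition.parts.count (j : ℕ)

/-- Character polynomials for `FI^m`: the variable `(i, j)` is the class function counting
the `j`-cycles of the `i`-th component. -/
abbrev CharPoly (k : Type u) [Field k] (m : ℕ) := MvPolynomial (Fin m × ℕ+) k

/-- The value `P_d(σ)` of a character polynomial at `σ ∈ S_d`. -/
def CharPoly.value {k : Type u} [Field k] {m : ℕ} (P : CharPoly k m) {d : Fin m → ℕ}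
    (σ : SymProd d) : k :=
  MvPolynomial.eval (fun p : Fin m × ℕ+ => (cycleCount (σ p.1) p.2 : k)) P

/-! ## Partitions, Specht modules and the irreducible representations of `S_d` -/

/-- Partitions of `n`, as Young diagrams with `n` boxes; row lengths are the parts. -/
abbrev PartitionOf (n : ℕ) := {μ : YoungDiagram // μ.card = n}

/-- The cells of the diagram obtained by adding a row of length `r` on top of `μ`. -/
def addRowCells (μ : YoungDiagram) (r : ℕ) : Finset (ℕ × ℕ) :=
  (Finset.range r).map (Function.Embedding.sectR 0 ℕ) ∪
    μ.cells.map ((addRightEmbedding 1).prodMap (Function.Embedding.refl ℕ))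

theorem mem_addRowCells {μ : YoungDiagram} {r : ℕ} {c : ℕ × ℕ} :
    c ∈ addRowCells μ r ↔ (c.1 = 0 ∧ c.2 < r) ∨ (∃ i, c.1 = i + 1 ∧ (i, c.2) ∈ μ) := by
  obtain ⟨a, b⟩ := c
  simp only [addRowCells, Finset.mem_union, Finset.mem_map, Finset.mem_range, Prod.exists,
    YoungDiagram.mem_cells]
  constructor
  · rintro (⟨j, hj, h⟩ | ⟨i, j, hij, h⟩)
    · obtain ⟨rfl, rfl⟩ := Prod.mk.inj h
      exact Or.inl ⟨rfl, hj⟩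
    · obtain ⟨rfl, rfl⟩ := Prod.mk.inj h
      exact Or.inr ⟨i, rfl, hij⟩
  · rintro (⟨h, hj⟩ | ⟨i, h, hij⟩)
    · exact Or.inl ⟨b, hj, Prod.ext h.symm rfl⟩
    · exact Or.inr ⟨i, b, hij, Prod.ext h.symm rfl⟩

theorem card_addRowCells (μ : YoungDiagram) (r : ℕ) :
    (addRowCells μ r).card = r + μ.card := by
  rw [addRowCells, Finset.card_union_of_disjoint, Finset.card_map, Finset.card_map,
    Finset.card_range]
  rw [Finset.disjoint_left]
  rintro ⟨a, b⟩ h1 h2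
  simp only [Finset.mem_map, Prod.exists] at h1 h2
  obtain ⟨j, -, h⟩ := h1
  obtain ⟨i, j', -, h'⟩ := h2
  have e1 : 0 = a := congrArg Prod.fst h
  have e2 : i + 1 = a := congrArg Prod.fst h'
  omega

/-- The padded partition `μ[n] = (n - |μ|, μ₁, μ₂, …)` of `n`, defined for `n ≥ |μ| + μ₁`. -/
def pad (μ : YoungDiagram) (n : ℕ) (h : μ.card + μ.rowLen 0 ≤ n) : PartitionOf n :=
  ⟨{ cells := addRowCells μ (n - μ.card)
     isLowerSet := by
      rintro ⟨a, b⟩ ⟨a', b'⟩ ⟨ha, hb⟩ hc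
      simp only [Finset.mem_coe, mem_addRowCells] at hc ⊢
      simp only at ha hb
      rcases hc with ⟨h1, h2⟩ | ⟨i, h1, h2⟩
      · exact Or.inl ⟨by omega, by omega⟩
      · rcases a' with _ | a'
        · left
          have h3 : (0, b) ∈ μ := μ.up_left_mem (Nat.zero_le i) le_rfl h2
          rw [YoungDiagram.mem_iff_lt_rowLen] at h3
          exact ⟨rfl, by omega⟩
        · exact Or.inr ⟨a', rfl, μ.up_left_mem (by omega) hb h2⟩ },
   by
    change (addRowCells μ (n - μ.card)).card = n
    rw [card_addRowCells]
    omega⟩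

/-- Tableaux of shape `μ`: bijective fillings of the cells of `μ` by `1, …, n`; `t x` is the cell
(row, column) which contains `x`. -/
abbrev Tableau {n : ℕ} (μ : PartitionOf n) := Fin n ≃ {c : ℕ × ℕ // c ∈ μ.1.cells}

variable (k : Type u) [Field k]

/-- The permutation representation of `S_n` on the space with basis the functions `Fin n → ℕ`.
A tabloid (a tableau up to reordering of its rows) is encoded as the function
sending each entry to the index of its row. -/
def rowRep (n : ℕ) : Representation k (Equiv.Perm (Fin n)) ((Fin n → ℕ) →₀ k) where
  toFun σ := Finsupp.lmapDomain k k (fun r => r ∘ σ.symm)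
  map_one' := by
    ext r
    simp [Finsupp.lmapDomain_apply, ← Equiv.Perm.inv_def]
  map_mul' σ τ := by
    ext r
    simp [Finsupp.lmapDomain_apply, Finsupp.mapDomain_single, Function.comp_assoc]
    rfl

/-- The polytabloid `e_t = ∑_q sgn(q) • q{t}`, summed over the permutations `q` which preserve
the columns of the tableau `t`. -/
def polytabloid {n : ℕ} {μ : PartitionOf n} (t : Tableau μ) : (Fin n → ℕ) →₀ k :=
  ∑ q : Equiv.Perm (Fin n) with ∀ x, (t (q x)).1.2 = (t x).1.2,
    Finsupp.single (fun x => (t (q.symm x)).1.1) (((Equiv.Perm.sign q : ℤˣ) : ℤ) : k)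

theorem rowRep_polytabloid {n : ℕ} {μ : PartitionOf n} (t : Tableau μ) (σ : Equiv.Perm (Fin n)) :
    rowRep k n σ (polytabloid k t) = polytabloid k (σ.symm.trans t) := by
  simp only [polytabloid, map_sum]
  refine Finset.sum_bij' (fun q _ => σ * q * σ⁻¹) (fun q _ => σ⁻¹ * q * σ) ?_ ?_ ?_ ?_ ?_
  · intro q hq
    simp only [Finset.mem_filter, Finset.mem_univ, true_and] at hq ⊢
    intro x
    simpa using hq (σ.symm x)
  · intro q hq
    simp only [Finset.mem_filter, Finset.mem_univ, true_and] at hq ⊢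
    intro x
    simpa using hq (σ x)
  · intro q _
    group
  · intro q _
    group
  · intro q _
    have h : Equiv.Perm.sign (σ * q * σ⁻¹) = Equiv.Perm.sign q := by
      rw [map_mul, map_mul, mul_right_comm, ← map_mul, mul_inv_cancel, map_one, one_mul]
    rw [h]
    change Finsupp.mapDomain _ (Finsupp.single _ _) = _
    rw [Finsupp.mapDomain_single]
    congr 1
    funext x
    have hx : (σ * q * σ⁻¹).symm x = σ (q.symm (σ.symm x)) := rfl
    simp only [Function.comp_apply, Equiv.trans_apply, hx, Equiv.symm_apply_apply]

/-- The Specht module of `μ`: the span of the polytabloids. -/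
def spechtModule {n : ℕ} (μ : PartitionOf n) : Submodule k ((Fin n → ℕ) →₀ k) :=
  Submodule.span k (Set.range fun t : Tableau μ => polytabloid k t)

/-- `Irr(μ)`: the representation of `S_n` on the Specht module of `μ`. -/
def specht {n : ℕ} (μ : PartitionOf n) :
    Representation k (Equiv.Perm (Fin n)) (spechtModule k μ) :=
  (rowRep k n).subrepresentation (spechtModule k μ) (by
    intro σ
    rw [spechtModule, Submodule.span_le]
    rintro _ ⟨t, rfl⟩
    rw [SetLike.mem_coe, Submodule.mem_comap, rowRep_polytabloid]
    exact Submodule.subset_span ⟨_, rfl⟩)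

/-- The space `⨂ᵢ Irr(μᵢ)`. -/
abbrev IrrSpace {m : ℕ} {d : Fin m → ℕ} (μ : ∀ i, PartitionOf (d i)) : Type u :=
  ⨂[k] i, spechtModule k (μ i)

/-- `Irr(μ₁, …, μ_m) = Irr(μ₁) ⊠ ⋯ ⊠ Irr(μ_m)`, the external tensor product. -/
def irr {m : ℕ} {d : Fin m → ℕ} (μ : ∀ i, PartitionOf (d i)) :
    Representation k (SymProd d) (IrrSpace k μ) where
  toFun σ := PiTensorProduct.map fun i => specht k (μ i) (σ i)
  map_one' := by
    simp only [Pi.one_apply, map_one]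
    exact PiTensorProduct.map_one
  map_mul' σ τ := by
    simp only [Pi.mul_apply, map_mul]
    exact PiTensorProduct.map_mul _ _

/-- `lam[d]` is defined, that is, `d_i ≥ |lam_i| + (lam_i)₁` for all `i`. -/
def CanPad {m : ℕ} (lam : Fin m → YoungDiagram) (d : Fin m → ℕ) : Prop :=
  ∀ i, (lam i).card + (lam i).rowLen 0 ≤ d i

/-- The list `lam[d] = (lam₁[d₁], …, lam_m[d_m])` of padded partitions. -/
def padList {m : ℕ} (lam : Fin m → YoungDiagram) (d : Fin m → ℕ) (h : CanPad lam d) (i : Fin m) :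
    PartitionOf (d i) :=
  pad (lam i) (d i) (h i)

/-- The representation `⨁_lam Irr(lam[d])^{c_lam}` of `S_d`; the sum runs over the finitely many
`lam` with `c_lam ≠ 0`, each taken `c_lam` times. -/
def stableSum {m : ℕ} (c : (Fin m → YoungDiagram) →₀ ℕ) (d : Fin m → ℕ)
    (h : ∀ lam ∈ c.support, CanPad lam d) :
    Representation k (SymProd d)
      (⨁ p : (Σ lam : {lam // lam ∈ c.support}, Fin (c lam.1)),
        IrrSpace k (padList p.1.1 d (h p.1.1 p.1.2))) :=
  Representation.directSum fun p : (Σ lam : {lam // lam ∈ c.support}, Fin (c lam.1)) =>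
    irr k (padList p.1.1 d (h p.1.1 p.1.2))

end RepStab

end

/-! In characteristic 0 the Young symmetrizers split the group algebra of `S_d` over `k` itself. The
multiplicity of Irr(μ) in a finite-dimensional representation is therefore the rank of a Young
symmetrizer of shape μ acting on it (`exists_equiv_pi_simpleModule`,
`nonempty_youngIdeal_equiv_irr`). This rank does not depend on the tableau, and is the same for (row
sum)(column sum) as for (column sum)(row sum). Stability of representations becomes stability of
ranks.

Let a bound the sizes of the sets that carry the generators of V. A column sum with fewer than d_i -
a columns in some component kills V_d: outside the image of an injection from a set of size at most
a, two points share a column, and their transposition fixes the vector but changes the sign of the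
column sum (`colSum_map_eq_zero`). So all constituents are λ[d] with |λ_i| ≤ a, and only finitely
many λ occur. For fixed λ, tableaux of the shapes λ[d] can be chosen coherently: the column group
does not grow with d, and the row groups are nested. Then V_d → V_d', followed by the row sum of d',
carries the image of (row sum)(column sum) on V_d onto a space containing the corresponding image on
V_d' (`finrank_range_le`). For large d these ranks are nonincreasing natural numbers, hence
eventually constant, with no appeal to Noetherianity. This is part 3.

For part 1, the λ-tabloids form a finitely generated module, to which part 3 applies. Its character
counts the tabloids fixed by σ, a coefficient of ∏_w (1 + p_w)^{X_w} with p_w (truncated) power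
sums, hence a polynomial in the cycle counts X_w. By dominance this module contains Irr(λ[d]), and
its other constituents have smaller depth; induction on the depth gives character polynomials for
Irr(λ[d]) (`exists_charPoly_padList`), hence for V. Part 2 evaluates at the identity and replaces
the coefficients by rational ones. -/

noncomputable section
namespace RepStab

/-! ## Row and column sums in the group algebra of `S_d` -/

section GroupAlgebra

variable {m : ℕ} {d : Fin m → ℕ}

/-- The elements of `S_d` preserving the level sets of `f`. -/
def stab (f : ∀ i, Fin (d i) → ℕ) : Finset (SymProd d) :=
  Finset.univ.filter fun g => ∀ i x, f i (g i x) = f i x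

theorem mem_stab {f : ∀ i, Fin (d i) → ℕ} {g : SymProd d} :
    g ∈ stab f ↔ ∀ i x, f i (g i x) = f i x := by
  simp [stab]

theorem one_mem_stab (f : ∀ i, Fin (d i) → ℕ) : (1 : SymProd d) ∈ stab f := by
  simp [mem_stab]

theorem mul_mem_stab {f : ∀ i, Fin (d i) → ℕ} {g h : SymProd d} (hg : g ∈ stab f)
    (hh : h ∈ stab f) : g * h ∈ stab f := by
  rw [mem_stab] at *
  intro i x
  rw [Pi.mul_apply, Equiv.Perm.mul_apply, hg, hh]

theorem inv_mem_stab {f : ∀ i, Fin (d i) → ℕ} {g : SymProd d} (hg : g ∈ stab f) :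
    g⁻¹ ∈ stab f := by
  rw [mem_stab] at *
  intro i x
  have := hg i ((g i)⁻¹ x)
  simpa using this.symm

/-- The sign character of `S_d`. -/
def sgn (g : SymProd d) : ℤˣ := ∏ i, Equiv.Perm.sign (g i)

theorem sgn_one : sgn (1 : SymProd d) = 1 := by simp [sgn]

theorem sgn_mul (g h : SymProd d) : sgn (g * h) = sgn g * sgn h := by
  simp [sgn, Finset.prod_mul_distrib]

theorem sgn_conj (g h : SymProd d) : sgn (h * g * h⁻¹) = sgn g := by
  rw [sgn_mul, sgn_mul, mul_right_comm, ← sgn_mul, mul_inv_cancel, sgn_one, one_mul]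

/-- A permutation of one component, as an element of `S_d`. -/
def inComponent (i : Fin m) (τ : Equiv.Perm (Fin (d i))) : SymProd d := Function.update 1 i τ

theorem sgn_inComponent (i : Fin m) (τ : Equiv.Perm (Fin (d i))) :
    sgn (inComponent i τ) = Equiv.Perm.sign τ := by
  rw [sgn, Finset.prod_eq_single i]
  · simp [inComponent]
  · intro j _ hj
    simp [inComponent, Function.update_of_ne hj]
  · simp

theorem swap_mem_stab {f : ∀ i, Fin (d i) → ℕ} {i : Fin m} {x y : Fin (d i)}
    (h : f i x = f i y) : inComponent i (Equiv.swap x y) ∈ stab f := by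
  rw [mem_stab]
  intro j z
  by_cases hj : j = i
  · subst hj
    simp only [inComponent, Function.update_self]
    by_cases hx : z = x
    · subst hx; simp [h]
    · by_cases hy : z = y
      · subst hy; simp [h]
      · rw [Equiv.swap_apply_of_ne_of_ne hx hy]
  · simp [inComponent, Function.update_of_ne hj]

variable (k : Type u) [Field k]

/-- The sum of the elements of `S_d` preserving the level sets of `f`. -/
def rowSum (f : ∀ i, Fin (d i) → ℕ) : MonoidAlgebra k (SymProd d) :=
  ∑ g ∈ stab f, MonoidAlgebra.of k _ g

/-- The signed sum of the elements of `S_d` preserving the level sets of `f`. -/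
def colSum (f : ∀ i, Fin (d i) → ℕ) : MonoidAlgebra k (SymProd d) :=
  ∑ g ∈ stab f, ((sgn g : ℤ) : k) • MonoidAlgebra.of k _ g

variable {k}

theorem of_mul_rowSum {f : ∀ i, Fin (d i) → ℕ} {h : SymProd d} (hh : h ∈ stab f) :
    MonoidAlgebra.of k _ h * rowSum k f = rowSum k f := by
  rw [rowSum, Finset.mul_sum]
  refine Finset.sum_bij' (fun g _ => h * g) (fun g _ => h⁻¹ * g) ?_ ?_ ?_ ?_ ?_
  · exact fun g hg => mul_mem_stab hh hg
  · exact fun g hg => mul_mem_stab (inv_mem_stab hh) hg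
  · simp
  · simp
  · simp [map_mul]

theorem rowSum_mul_of {f : ∀ i, Fin (d i) → ℕ} {h : SymProd d} (hh : h ∈ stab f) :
    rowSum k f * MonoidAlgebra.of k _ h = rowSum k f := by
  rw [rowSum, Finset.sum_mul]
  refine Finset.sum_bij' (fun g _ => g * h) (fun g _ => g * h⁻¹) ?_ ?_ ?_ ?_ ?_
  · exact fun g hg => mul_mem_stab hg hh
  · exact fun g hg => mul_mem_stab hg (inv_mem_stab hh)
  · simp
  · simp
  · simp [map_mul]

theorem sgn_mul_self (h : SymProd d) : ((sgn h : ℤ) : k) * ((sgn h : ℤ) : k) = 1 := by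
  rcases Int.units_eq_one_or (sgn h) with h | h <;> simp [h]

theorem of_mul_colSum {f : ∀ i, Fin (d i) → ℕ} {h : SymProd d} (hh : h ∈ stab f) :
    MonoidAlgebra.of k _ h * colSum k f = ((sgn h : ℤ) : k) • colSum k f := by
  rw [colSum, Finset.mul_sum, Finset.smul_sum]
  refine Finset.sum_bij' (fun g _ => h * g) (fun g _ => h⁻¹ * g) ?_ ?_ ?_ ?_ ?_
  · exact fun g hg => mul_mem_stab hh hg
  · exact fun g hg => mul_mem_stab (inv_mem_stab hh) hg
  · simp
  · simp
  · intro g _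
    rw [sgn_mul, mul_smul_comm, ← map_mul, smul_smul]
    push_cast
    rw [← mul_assoc, sgn_mul_self, one_mul]

theorem colSum_mul_of {f : ∀ i, Fin (d i) → ℕ} {h : SymProd d} (hh : h ∈ stab f) :
    colSum k f * MonoidAlgebra.of k _ h = ((sgn h : ℤ) : k) • colSum k f := by
  rw [colSum, Finset.sum_mul, Finset.smul_sum]
  refine Finset.sum_bij' (fun g _ => g * h) (fun g _ => g * h⁻¹) ?_ ?_ ?_ ?_ ?_
  · exact fun g hg => mul_mem_stab hg hh
  · exact fun g hg => mul_mem_stab hg (inv_mem_stab hh)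
  · simp
  · simp
  · intro g _
    rw [sgn_mul, smul_mul_assoc, ← map_mul, smul_smul]
    push_cast
    rw [mul_left_comm, sgn_mul_self, mul_one]

/-- The translate of a family of functions by an element of `S_d`. -/
def translate (g : SymProd d) (f : ∀ i, Fin (d i) → ℕ) : ∀ i, Fin (d i) → ℕ :=
  fun i x => f i ((g i).symm x)

theorem conj_mem_stab {f : ∀ i, Fin (d i) → ℕ} {g h : SymProd d} :
    g * h * g⁻¹ ∈ stab (translate g f) ↔ h ∈ stab f := by
  rw [mem_stab, mem_stab]
  refine forall_congr' fun i => ?_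
  rw [← (g i).forall_congr_right]
  refine forall_congr' fun x => ?_
  simp [translate]

theorem of_mul_rowSum_eq (g : SymProd d) (f : ∀ i, Fin (d i) → ℕ) :
    MonoidAlgebra.of k _ g * rowSum k f
      = rowSum k (translate g f) * MonoidAlgebra.of k _ g := by
  rw [rowSum, rowSum, Finset.mul_sum, Finset.sum_mul]
  refine Finset.sum_bij' (fun h _ => g * h * g⁻¹) (fun h _ => g⁻¹ * h * g) ?_ ?_ ?_ ?_ ?_
  · exact fun h hh => conj_mem_stab.mpr hh
  · intro h hh
    rw [← conj_mem_stab (g := g)]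
    simpa [mul_assoc] using hh
  · intros; group
  · intros; group
  · intros; simp only [← map_mul]; group

theorem of_mul_colSum_eq (g : SymProd d) (f : ∀ i, Fin (d i) → ℕ) :
    MonoidAlgebra.of k _ g * colSum k f
      = colSum k (translate g f) * MonoidAlgebra.of k _ g := by
  rw [colSum, colSum, Finset.mul_sum, Finset.sum_mul]
  refine Finset.sum_bij' (fun h _ => g * h * g⁻¹) (fun h _ => g⁻¹ * h * g) ?_ ?_ ?_ ?_ ?_
  · exact fun h hh => conj_mem_stab.mpr hh
  · intro h hh
    rw [← conj_mem_stab (g := g)]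
    simpa [mul_assoc] using hh
  · intros; group
  · intros; group
  · intro h _
    rw [sgn_conj, smul_mul_assoc, mul_smul_comm, ← map_mul, ← map_mul]
    simp

/-- The transposition of `x` and `y` lies in both stabilizers: the row sum absorbs it with sign +1
and the column sum with sign -1, so the product is its own negative. -/
theorem colSum_mul_rowSum_eq_zero [CharZero k] {f h : ∀ i, Fin (d i) → ℕ} {i : Fin m}
    {x y : Fin (d i)} (hxy : x ≠ y) (hf : f i x = f i y) (hh : h i x = h i y) :
    colSum k f * rowSum k h = 0 := by
  have h1 : colSum k f * rowSum k h = -(colSum k f * rowSum k h) := by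
    conv_lhs => rw [← of_mul_rowSum (swap_mem_stab hh), ← mul_assoc,
      colSum_mul_of (swap_mem_stab hf), sgn_inComponent, Equiv.Perm.sign_swap hxy]
    simp
  have h2 : (2 : k) • (colSum k f * rowSum k h) = 0 := by
    rw [two_smul]; nth_rewrite 1 [h1]; simp
  exact (smul_eq_zero.mp h2).resolve_left two_ne_zero

theorem rowSum_mul_colSum_eq_zero [CharZero k] {f h : ∀ i, Fin (d i) → ℕ} {i : Fin m}
    {x y : Fin (d i)} (hxy : x ≠ y) (hf : f i x = f i y) (hh : h i x = h i y) :
    rowSum k h * colSum k f = 0 := by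
  have h1 : rowSum k h * colSum k f = -(rowSum k h * colSum k f) := by
    conv_lhs => rw [← rowSum_mul_of (swap_mem_stab hh), mul_assoc,
      of_mul_colSum (swap_mem_stab hf), sgn_inComponent, Equiv.Perm.sign_swap hxy]
    simp
  have h2 : (2 : k) • (rowSum k h * colSum k f) = 0 := by
    rw [two_smul]; nth_rewrite 1 [h1]; simp
  exact (smul_eq_zero.mp h2).resolve_left two_ne_zero

/-- Two families of functions separate points if no two points of the same component have equal
values under both. -/
def Separates (f h : ∀ i, Fin (d i) → ℕ) : Prop :=
  ∀ i x y, f i x = f i y → h i x = h i y → x = y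

theorem separates_of_colSum_mul_rowSum_ne_zero [CharZero k] {f h : ∀ i, Fin (d i) → ℕ}
    {g : SymProd d} (hne : colSum k f * MonoidAlgebra.of k _ g * rowSum k h ≠ 0) :
    Separates f (translate g h) := by
  intro i x y hf hh
  by_contra hxy
  apply hne
  rw [mul_assoc, of_mul_rowSum_eq, ← mul_assoc, colSum_mul_rowSum_eq_zero hxy hf hh, zero_mul]

theorem separates_of_rowSum_mul_colSum_ne_zero [CharZero k] {f h : ∀ i, Fin (d i) → ℕ}
    {g : SymProd d} (hne : rowSum k h * MonoidAlgebra.of k _ g * colSum k f ≠ 0) :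
    Separates f (translate g⁻¹ h) := by
  intro i x y hf hh
  by_contra hxy
  apply hne
  have h1 := of_mul_rowSum_eq (k := k) g (translate g⁻¹ h)
  have h2 : translate g (translate g⁻¹ h) = h := by
    funext i x
    change h i ((g i)⁻¹.symm ((g i).symm x)) = h i x
    rw [← Equiv.Perm.inv_def, ← Equiv.Perm.inv_def, inv_inv, Equiv.Perm.inv_def,
      Equiv.apply_symm_apply]
  rw [h2] at h1
  rw [← h1, mul_assoc, rowSum_mul_colSum_eq_zero hxy hf hh, mul_zero]

theorem exists_of_mul_mul_ne_zero {a b x : MonoidAlgebra k (SymProd d)} (h : a * x * b ≠ 0) :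
    ∃ g, a * MonoidAlgebra.of k _ g * b ≠ 0 := by
  by_contra! hcon
  apply h
  induction x using MonoidAlgebra.induction_on with
  | of g => exact hcon _
  | add x y hx hy =>
    rw [mul_add, add_mul]
    have hx' : a * x * b = 0 := by by_contra h'; exact h' (hx h')
    have hy' : a * y * b = 0 := by by_contra h'; exact h' (hy h')
    rw [hx', hy', add_zero]
  | smul r x hx =>
    have hx' : a * x * b = 0 := by by_contra h'; exact h' (hx h')
    rw [mul_smul_comm, smul_mul_assoc, hx', smul_zero]

end GroupAlgebra


/-! ## Dominance -/

section Dominance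

variable {n : ℕ}

/-- The number of cells of `μ` in the first `j` rows. -/
def cellsAbove (μ : YoungDiagram) (j : ℕ) : ℕ := (μ.cells.filter fun c => c.1 < j).card

theorem cellsAbove_succ (μ : YoungDiagram) (j : ℕ) :
    cellsAbove μ (j + 1) = cellsAbove μ j + μ.rowLen j := by
  rw [YoungDiagram.rowLen_eq_card, cellsAbove, cellsAbove, ← Finset.card_union_of_disjoint]
  · congr 1
    ext c
    simp only [Finset.mem_filter, Finset.mem_union, YoungDiagram.mem_row_iff,
      YoungDiagram.mem_cells, Nat.lt_succ_iff_lt_or_eq, and_or_left]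
  · rw [Finset.disjoint_left]
    intro c h1 h2
    simp only [Finset.mem_filter, YoungDiagram.mem_row_iff] at h1 h2
    omega

theorem eq_of_rowLen_eq {μ ν : YoungDiagram} (h : ∀ j, μ.rowLen j = ν.rowLen j) : μ = ν := by
  ext ⟨a, b⟩
  rw [YoungDiagram.mem_cells, YoungDiagram.mem_cells, YoungDiagram.mem_iff_lt_rowLen,
    YoungDiagram.mem_iff_lt_rowLen, h]

theorem eq_of_cellsAbove_eq {μ ν : YoungDiagram} (h : ∀ j, cellsAbove μ j = cellsAbove ν j) :
    μ = ν := by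
  refine eq_of_rowLen_eq fun j => ?_
  have h1 := cellsAbove_succ μ j
  have h2 := cellsAbove_succ ν j
  rw [h, h] at h1
  omega

variable {μ : PartitionOf n}

theorem card_row_lt (t : Tableau μ) (j : ℕ) :
    (Finset.univ.filter fun x => (t x).1.1 < j).card = cellsAbove μ.1 j := by
  refine Finset.card_bij (fun x _ => (t x).1) ?_ ?_ ?_
  · intro x hx
    exact Finset.mem_filter.mpr ⟨(t x).2, (Finset.mem_filter.mp hx).2⟩
  · intro x _ y _ hxy
    exact t.injective (Subtype.ext hxy)
  · intro c hc
    obtain ⟨hc, hj⟩ := Finset.mem_filter.mp hc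
    exact ⟨t.symm ⟨c, hc⟩, by simpa using hj, by simp⟩

theorem row_lt_colLen (t : Tableau μ) (x : Fin n) : (t x).1.1 < μ.1.colLen (t x).1.2 :=
  YoungDiagram.mem_iff_lt_colLen.mp (t x).2

/-- If column `c` has at least `j` cells, injectivity of `h` on it allows at most `j` labels below
`j`, and exactly `j` of its cells lie in the first `j` rows. If it is shorter, all its cells lie in
those rows. -/
theorem card_column_lt_le (t : Tableau μ) {h : Fin n → ℕ}
    (sep : ∀ x y, (t x).1.2 = (t y).1.2 → h x = h y → x = y) (j c : ℕ) :
    ((Finset.univ.filter fun x => h x < j).filter fun x => (t x).1.2 = c).card ≤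
      ((Finset.univ.filter fun x => (t x).1.1 < j).filter fun x => (t x).1.2 = c).card := by
  rcases le_or_gt j (μ.1.colLen c) with hj | hj
  · calc _ ≤ (Finset.range j).card := by
          refine Finset.card_le_card_of_injOn h ?_ ?_
          · intro x hx
            simp only [Finset.coe_filter, Finset.mem_filter, Finset.mem_univ, true_and,
              Set.mem_ofPred_eq] at hx
            simpa using hx.1
          · intro x hx y hy hxy
            simp only [Finset.coe_filter, Finset.mem_filter, Finset.mem_univ, true_and,
              Set.mem_ofPred_eq] at hx hy
            exact sep x y (hx.2.trans hy.2.symm) hxy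
      _ ≤ _ := by
          have hmem : ∀ a, a < j → (a, c) ∈ μ.1.cells := fun a ha =>
            YoungDiagram.mem_iff_lt_colLen.mpr (ha.trans_le hj)
          refine Finset.card_le_card_of_surjOn (fun x => (t x).1.1) ?_
          intro a ha
          have ha' : a < j := by simpa using ha
          refine ⟨t.symm ⟨(a, c), hmem a ha'⟩, ?_, ?_⟩ <;> simp [ha']
  · refine Finset.card_le_card fun x hx => ?_
    simp only [Finset.mem_filter, Finset.mem_univ, true_and] at hx ⊢
    refine ⟨?_, hx.2⟩
    have := row_lt_colLen t x
    rw [hx.2] at this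
    omega

theorem card_eq_sum_columns (t : Tableau μ) (s : Finset (Fin n)) :
    s.card = ∑ c ∈ Finset.univ.image (fun x => (t x).1.2), (s.filter fun x => (t x).1.2 = c).card :=
  Finset.card_eq_sum_card_fiberwise fun x _ => by simp

/-- The dominance lemma, summed column by column. -/
theorem card_lt_le_cellsAbove (t : Tableau μ) {h : Fin n → ℕ}
    (sep : ∀ x y, (t x).1.2 = (t y).1.2 → h x = h y → x = y) (j : ℕ) :
    (Finset.univ.filter fun x => h x < j).card ≤ cellsAbove μ.1 j := by
  rw [← card_row_lt t, card_eq_sum_columns t, card_eq_sum_columns t (Finset.filter _ _)]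
  exact Finset.sum_le_sum fun c _ => card_column_lt_le t sep j c

/-- Equality of the totals forces equality in every column. Taking `j` to be the length of the
column of `x`, all points of that column have labels below its length. -/
theorem lt_colLen_of_card_eq (t : Tableau μ) {h : Fin n → ℕ}
    (sep : ∀ x y, (t x).1.2 = (t y).1.2 → h x = h y → x = y)
    (hcard : ∀ j, (Finset.univ.filter fun x => h x < j).card = cellsAbove μ.1 j) (x : Fin n) :
    h x < μ.1.colLen (t x).1.2 := by
  set c := (t x).1.2 with hc
  have h1 := hcard (μ.1.colLen c)
  rw [← card_row_lt t, card_eq_sum_columns t, card_eq_sum_columns t (Finset.filter _ _),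
    Finset.sum_eq_sum_iff_of_le fun c _ => card_column_lt_le t sep _ c] at h1
  have h2 := h1 c (Finset.mem_image_of_mem _ (Finset.mem_univ x))
  have h3 : ((Finset.univ.filter fun x => h x < μ.1.colLen c).filter fun x => (t x).1.2 = c) =
      ((Finset.univ.filter fun x => (t x).1.1 < μ.1.colLen c).filter
        fun x => (t x).1.2 = c) := by
    refine Finset.eq_of_subset_of_card_le (fun y hy => ?_) h2.ge
    simp only [Finset.mem_filter, Finset.mem_univ, true_and] at hy ⊢
    refine ⟨?_, hy.2⟩
    have := row_lt_colLen t y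
    rwa [hy.2] at this
  have h4 : x ∈ ((Finset.univ.filter fun x => (t x).1.1 < μ.1.colLen c).filter
        fun x => (t x).1.2 = c) := by
    simp only [Finset.mem_filter, Finset.mem_univ, true_and]
    exact ⟨row_lt_colLen t x, hc.symm⟩
  rw [← h3] at h4
  simp only [Finset.mem_filter, Finset.mem_univ, true_and] at h4
  exact h4.1

/-- A function with the same content as the rows of a tableau `t`, injective on the columns
of `t`, is obtained from the row function of `t` by a column permutation. -/
theorem exists_column_perm (t : Tableau μ) {h : Fin n → ℕ}
    (sep : ∀ x y, (t x).1.2 = (t y).1.2 → h x = h y → x = y)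
    (hcard : ∀ j, (Finset.univ.filter fun x => h x < j).card = cellsAbove μ.1 j) :
    ∃ q : Equiv.Perm (Fin n), (∀ x, (t (q x)).1.2 = (t x).1.2) ∧ ∀ x, (t (q x)).1.1 = h x := by
  have hmem : ∀ x, (h x, (t x).1.2) ∈ μ.1.cells := fun x =>
    YoungDiagram.mem_iff_lt_colLen.mpr (lt_colLen_of_card_eq t sep hcard x)
  -- Each point stays in its column and moves to the row prescribed by `h`.
  let q : Fin n → Fin n := fun x => t.symm ⟨(h x, (t x).1.2), hmem x⟩
  have hq : ∀ x, (t (q x)).1 = (h x, (t x).1.2) := fun x => by simp [q]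
  have hinj : Function.Injective q := by
    intro x y hxy
    have h1 := hq x
    rw [hxy, hq y] at h1
    exact sep x y (Prod.mk.inj h1).2.symm (Prod.mk.inj h1).1.symm
  have hbij : Function.Bijective q := ⟨hinj, Finite.surjective_of_injective hinj⟩
  exact ⟨Equiv.ofBijective q hbij, fun x => (Prod.ext_iff.mp (hq x)).2,
    fun x => (Prod.ext_iff.mp (hq x)).1⟩

end Dominance

/-! ## Young symmetrizers -/

section Young

variable {m : ℕ} {d : Fin m → ℕ}

/-- The row function of a list of tableaux. -/
def rows {μ : ∀ i, PartitionOf (d i)} (t : ∀ i, Tableau (μ i)) : ∀ i, Fin (d i) → ℕ :=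
  fun i x => (t i x).1.1

/-- The column function of a list of tableaux. -/
def cols {μ : ∀ i, PartitionOf (d i)} (t : ∀ i, Tableau (μ i)) : ∀ i, Fin (d i) → ℕ :=
  fun i x => (t i x).1.2

/-- The dominance order, componentwise. -/
def Dominated (μ ν : ∀ i, PartitionOf (d i)) : Prop :=
  ∀ i j, cellsAbove (μ i).1 j ≤ cellsAbove (ν i).1 j

theorem Dominated.antisymm {μ ν : ∀ i, PartitionOf (d i)} (h : Dominated μ ν)
    (h' : Dominated ν μ) : μ = ν :=
  funext fun i => Subtype.ext <| eq_of_cellsAbove_eq fun j => le_antisymm (h i j) (h' i j)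

theorem card_translate_lt (g : SymProd d) (f : ∀ i, Fin (d i) → ℕ) (i : Fin m) (j : ℕ) :
    (Finset.univ.filter fun x => translate g f i x < j).card =
      (Finset.univ.filter fun x => f i x < j).card := by
  refine Finset.card_equiv (g i).symm fun x => ?_
  rw [Finset.mem_filter_univ, Finset.mem_filter_univ, translate]

variable {μ ν : ∀ i, PartitionOf (d i)}

theorem dominated_of_separates {t : ∀ i, Tableau (μ i)} {s : ∀ i, Tableau (ν i)} {g : SymProd d}
    (h : Separates (cols t) (translate g (rows s))) : Dominated ν μ := by
  intro i j
  have h1 := card_lt_le_cellsAbove (t i) (h := translate g (rows s) i) (h i) j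
  rw [card_translate_lt] at h1
  rwa [← card_row_lt (s i)]

variable {k : Type u} [Field k]

theorem dominated_of_colSum_mul_rowSum_ne_zero [CharZero k] {t : ∀ i, Tableau (μ i)}
    {s : ∀ i, Tableau (ν i)} {x : MonoidAlgebra k (SymProd d)}
    (h : colSum k (cols t) * x * rowSum k (rows s) ≠ 0) : Dominated ν μ := by
  obtain ⟨g, hg⟩ := exists_of_mul_mul_ne_zero h
  exact dominated_of_separates (separates_of_colSum_mul_rowSum_ne_zero hg)

theorem dominated_of_rowSum_mul_colSum_ne_zero [CharZero k] {t : ∀ i, Tableau (μ i)}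
    {s : ∀ i, Tableau (ν i)} {x : MonoidAlgebra k (SymProd d)}
    (h : rowSum k (rows s) * x * colSum k (cols t) ≠ 0) : Dominated ν μ := by
  obtain ⟨g, hg⟩ := exists_of_mul_mul_ne_zero h
  exact dominated_of_separates (separates_of_rowSum_mul_colSum_ne_zero hg)

variable (k) in
/-- The Young symmetrizer of a list of tableaux. -/
def young (t : ∀ i, Tableau (μ i)) : MonoidAlgebra k (SymProd d) :=
  colSum k (cols t) * rowSum k (rows t)

/-- In C_t R_t x C_s R_s the outer factors C_t, R_s give dominance in one direction, and the inner
factors R_t, C_s give it in the other. A nonzero product thus forces equal shapes. -/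
theorem young_mul_mul_young_eq_zero [CharZero k] {t : ∀ i, Tableau (μ i)}
    {s : ∀ i, Tableau (ν i)} (hne : μ ≠ ν) (x : MonoidAlgebra k (SymProd d)) :
    young k t * x * young k s = 0 := by
  by_contra h
  apply hne
  have h1 : young k t * x * young k s =
      colSum k (cols t) * (rowSum k (rows t) * x * colSum k (cols s)) * rowSum k (rows s) := by
    simp only [young, mul_assoc]
  rw [h1] at h
  refine Dominated.antisymm ?_ (dominated_of_colSum_mul_rowSum_ne_zero h)
  apply dominated_of_rowSum_mul_colSum_ne_zero (k := k) (x := x) (t := s) (s := t)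
  intro h2
  rw [h2] at h
  simp at h

/-- This factors g = q⁻¹ (q g) into a column permutation and a row permutation. An element without
such a factorization contributes zero between a column sum and a row sum. -/
theorem exists_mem_stab_cols {t : ∀ i, Tableau (μ i)} {g : SymProd d}
    (sep : Separates (cols t) (translate g (rows t))) :
    ∃ q ∈ stab (cols t), q * g ∈ stab (rows t) := by
  have hq : ∀ i, ∃ q : Equiv.Perm (Fin (d i)), (∀ x, (t i (q x)).1.2 = (t i x).1.2) ∧
      ∀ x, (t i (q x)).1.1 = translate g (rows t) i x := fun i =>
    exists_column_perm (t i) (sep i) fun j => by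
      rw [card_translate_lt]; exact card_row_lt (t i) j
  choose q hq1 hq2 using hq
  refine ⟨q, mem_stab.mpr hq1, ?_⟩
  rw [mem_stab]
  intro i x
  have := hq2 i (g i x)
  simp only [translate, Equiv.symm_apply_apply] at this
  exact this

theorem exists_colSum_mul_of_mul_rowSum [CharZero k] (t : ∀ i, Tableau (μ i)) (g : SymProd d) :
    ∃ c : k, colSum k (cols t) * MonoidAlgebra.of k _ g * rowSum k (rows t) = c • young k t := by
  by_cases h : colSum k (cols t) * MonoidAlgebra.of k _ g * rowSum k (rows t) = 0
  · exact ⟨0, by rw [h, zero_smul]⟩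
  obtain ⟨q, hqc, hqr⟩ := exists_mem_stab_cols (separates_of_colSum_mul_rowSum_ne_zero h)
  refine ⟨((sgn q⁻¹ : ℤ) : k), ?_⟩
  have h1 : MonoidAlgebra.of k _ g = MonoidAlgebra.of k _ q⁻¹ * MonoidAlgebra.of k _ (q * g) := by
    rw [← map_mul, inv_mul_cancel_left]
  rw [h1, ← mul_assoc, mul_assoc, of_mul_rowSum hqr, colSum_mul_of (inv_mem_stab hqc),
    smul_mul_assoc, young]

theorem exists_rowSum_mul_of_mul_colSum [CharZero k] (t : ∀ i, Tableau (μ i)) (g : SymProd d) :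
    ∃ c : k, rowSum k (rows t) * MonoidAlgebra.of k _ g * colSum k (cols t) =
      c • (rowSum k (rows t) * colSum k (cols t)) := by
  by_cases h : rowSum k (rows t) * MonoidAlgebra.of k _ g * colSum k (cols t) = 0
  · exact ⟨0, by rw [h, zero_smul]⟩
  obtain ⟨q, hqc, hqr⟩ := exists_mem_stab_cols (separates_of_rowSum_mul_colSum_ne_zero h)
  refine ⟨((sgn q : ℤ) : k), ?_⟩
  have h1 : MonoidAlgebra.of k _ g =
      MonoidAlgebra.of k _ (q * g⁻¹)⁻¹ * MonoidAlgebra.of k _ q := by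
    rw [← map_mul]; congr 1; group
  rw [h1, ← mul_assoc, rowSum_mul_of (inv_mem_stab hqr), mul_assoc, of_mul_colSum hqc,
    mul_smul_comm]

theorem exists_rowSum_mul_mul_colSum [CharZero k] (t : ∀ i, Tableau (μ i))
    (x : MonoidAlgebra k (SymProd d)) :
    ∃ c : k, rowSum k (rows t) * x * colSum k (cols t) =
      c • (rowSum k (rows t) * colSum k (cols t)) := by
  induction x using MonoidAlgebra.induction_on with
  | of g => exact exists_rowSum_mul_of_mul_colSum t g
  | add x y hx hy =>
    obtain ⟨a, ha⟩ := hx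
    obtain ⟨b, hb⟩ := hy
    exact ⟨a + b, by rw [mul_add, add_mul, ha, hb, add_smul]⟩
  | smul r x hx =>
    obtain ⟨a, ha⟩ := hx
    exact ⟨r * a, by rw [mul_smul_comm, smul_mul_assoc, ha, smul_smul]⟩

theorem exists_colSum_mul_mul_rowSum [CharZero k] (t : ∀ i, Tableau (μ i))
    (x : MonoidAlgebra k (SymProd d)) :
    ∃ c : k, colSum k (cols t) * x * rowSum k (rows t) = c • young k t := by
  induction x using MonoidAlgebra.induction_on with
  | of g => exact exists_colSum_mul_of_mul_rowSum t g
  | add x y hx hy =>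
    obtain ⟨a, ha⟩ := hx
    obtain ⟨b, hb⟩ := hy
    exact ⟨a + b, by rw [mul_add, add_mul, ha, hb, add_smul]⟩
  | smul r x hx =>
    obtain ⟨a, ha⟩ := hx
    exact ⟨r * a, by rw [mul_smul_comm, smul_mul_assoc, ha, smul_smul]⟩

theorem exists_young_mul_mul_young [CharZero k] (t : ∀ i, Tableau (μ i))
    (x : MonoidAlgebra k (SymProd d)) : ∃ c : k, young k t * x * young k t = c • young k t := by
  obtain ⟨c, hc⟩ := exists_colSum_mul_mul_rowSum t (rowSum k (rows t) * x * colSum k (cols t))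
  exact ⟨c, by rw [← hc]; simp only [young, mul_assoc]⟩

theorem eq_one_of_mem_stab {t : ∀ i, Tableau (μ i)} {g : SymProd d} (h1 : g ∈ stab (cols t))
    (h2 : g ∈ stab (rows t)) : g = 1 := by
  rw [mem_stab] at h1 h2
  funext i
  ext x : 1
  exact (t i).injective (Subtype.ext (Prod.ext (h2 i x) (h1 i x)))

theorem coeff_of_apply {G : Type*} [Group G] [DecidableEq G] (g h : G) :
    (MonoidAlgebra.of k G g).coeff h = if g = h then 1 else 0 := by
  rw [MonoidAlgebra.of_apply, MonoidAlgebra.coeff_single, Finsupp.single_apply]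

/-- A product of a column and a row permutation is trivial only if both are, since a point is
determined by its row and column. -/
theorem coeff_young_one (t : ∀ i, Tableau (μ i)) : (young k t).coeff 1 = 1 := by
  classical
  rw [young, colSum, rowSum, Finset.sum_mul_sum, MonoidAlgebra.coeff_sum, Finsupp.finsetSum_apply,
    Finset.sum_eq_single 1]
  · rw [MonoidAlgebra.coeff_sum, Finsupp.finsetSum_apply, Finset.sum_eq_single 1]
    · simp [sgn_one]
    · intro r _ hr
      rw [smul_mul_assoc, ← map_mul, MonoidAlgebra.coeff_smul_apply, coeff_of_apply,
        if_neg (by simpa using hr), smul_zero]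
    · exact fun h => absurd (one_mem_stab _) h
  · intro q hq hq1
    rw [MonoidAlgebra.coeff_sum, Finsupp.finsetSum_apply]
    refine Finset.sum_eq_zero fun r hr => ?_
    rw [smul_mul_assoc, ← map_mul, MonoidAlgebra.coeff_smul_apply, coeff_of_apply, if_neg,
      smul_zero]
    intro h
    apply hq1
    refine eq_one_of_mem_stab hq ?_
    rw [eq_inv_of_mul_eq_one_left h]
    exact inv_mem_stab hr
  · exact fun h => absurd (one_mem_stab _) h

/-- The trace of left multiplication by `x` on the group algebra. -/
theorem trace_mulLeft {G : Type*} [Group G] [Fintype G] (x : MonoidAlgebra k G) :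
    LinearMap.trace k _ (LinearMap.mulLeft k x) = Fintype.card G * x.coeff 1 := by
  classical
  rw [LinearMap.trace_eq_matrix_trace k (MonoidAlgebra.basis G k), Matrix.trace]
  have h : ∀ g, (LinearMap.toMatrix (MonoidAlgebra.basis G k) (MonoidAlgebra.basis G k)
      (LinearMap.mulLeft k x)).diag g = x.coeff 1 := by
    intro g
    rw [Matrix.diag_apply, LinearMap.toMatrix_apply]
    have h1 : MonoidAlgebra.basis G k g = MonoidAlgebra.single g 1 := by
      exact MonoidAlgebra.basis_apply k g
    rw [h1, LinearMap.mulLeft_apply]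
    change (x * MonoidAlgebra.single g 1).coeff g = _
    simp
  rw [Finset.sum_congr rfl fun g _ => h g, Finset.sum_const, nsmul_eq_mul, Finset.card_univ]

/-- Left multiplication by a nilpotent element has trace zero, whereas the trace is |G| times the
coefficient at 1. -/
theorem not_isNilpotent_of_apply_one_ne_zero [CharZero k] {G : Type*} [Group G] [Fintype G]
    {x : MonoidAlgebra k G} (h : x.coeff 1 ≠ 0) : ¬ IsNilpotent x := by
  rintro ⟨n, hn⟩
  have h1 : IsNilpotent (LinearMap.mulLeft k x) := ⟨n, by
    rw [LinearMap.pow_mulLeft, hn, LinearMap.mulLeft_zero_eq_zero]⟩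
  have h2 := (LinearMap.isNilpotent_trace_of_isNilpotent h1).eq_zero
  rw [trace_mulLeft] at h2
  rcases mul_eq_zero.mp h2 with h2 | h2
  · exact Fintype.card_ne_zero (Nat.cast_eq_zero.mp h2)
  · exact h h2

theorem exists_young_mul_young [CharZero k] (t : ∀ i, Tableau (μ i)) :
    ∃ c : k, c ≠ 0 ∧ young k t * young k t = c • young k t := by
  obtain ⟨c, hc⟩ := exists_young_mul_mul_young (k := k) t 1
  rw [mul_one] at hc
  refine ⟨c, ?_, hc⟩
  rintro rfl
  refine not_isNilpotent_of_apply_one_ne_zero (x := young k t) ?_ ⟨2, ?_⟩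
  · rw [coeff_young_one]; exact one_ne_zero
  · rw [pow_two, hc, zero_smul]

/-- Both orders of the product are quasi-idempotent; computing the cube of the symmetrizer in two
ways shows that the scalars agree. This serves to compare the ranks of the two orders. -/
theorem exists_young_mul_young_rev [CharZero k] (t : ∀ i, Tableau (μ i)) :
    ∃ c : k, c ≠ 0 ∧ young k t * young k t = c • young k t ∧
      rowSum k (rows t) * colSum k (cols t) * (rowSum k (rows t) * colSum k (cols t)) =
        c • (rowSum k (rows t) * colSum k (cols t)) := by
  obtain ⟨c, hc0, hc⟩ := exists_young_mul_young (k := k) t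
  refine ⟨c, hc0, hc, ?_⟩
  obtain ⟨c', hc'⟩ := exists_rowSum_mul_mul_colSum (k := k) t (young k t)
  have h1 : rowSum k (rows t) * colSum k (cols t) * (rowSum k (rows t) * colSum k (cols t)) =
      c' • (rowSum k (rows t) * colSum k (cols t)) := by
    rw [← hc', young]; simp only [mul_assoc]
  rw [h1]
  have h2 : young k t * young k t * young k t = c' • (young k t * young k t) := by
    calc _ = colSum k (cols t) * (rowSum k (rows t) * colSum k (cols t) *
          (rowSum k (rows t) * colSum k (cols t))) * rowSum k (rows t) := by
          simp only [young, mul_assoc]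
      _ = _ := by rw [h1]; simp only [young, mul_assoc, mul_smul_comm, smul_mul_assoc]
  rw [hc, smul_mul_assoc, hc, smul_smul, smul_smul] at h2
  have h3 := congrArg (fun x => x.coeff 1) h2
  simp only [MonoidAlgebra.coeff_smul_apply, coeff_young_one, smul_eq_mul, mul_one] at h3
  rw [mul_right_cancel₀ hc0 h3]

end Young


/-! ## Simple modules over the group algebra of `S_d` -/

section Partitions

theorem card_cellsOfRowLens (w : List ℕ) : (YoungDiagram.cellsOfRowLens w).card = w.sum := by
  induction w with
  | nil => rfl
  | cons a w ih =>
    rw [YoungDiagram.cellsOfRowLens, Finset.card_union_of_disjoint, Finset.card_map, ih]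
    · simp
    · rw [Finset.disjoint_left]
      rintro ⟨i, j⟩ h1 h2
      simp only [Finset.mem_product, Finset.mem_singleton, Finset.mem_map] at h1 h2
      obtain ⟨c, -, hc⟩ := h2
      have h3 : c.1 + 1 = i := congrArg Prod.fst hc
      omega

/-- The Young diagram of a partition. -/
def ofPartition {n : ℕ} (p : Nat.Partition n) : PartitionOf n :=
  ⟨YoungDiagram.ofRowLens (p.parts.sort (· ≥ ·)) (Multiset.pairwise_sort _ _).sortedGE, by
    change (YoungDiagram.cellsOfRowLens _).card = n
    rw [card_cellsOfRowLens, ← Multiset.sum_coe, Multiset.sort_eq, p.parts_sum]⟩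

/-- Injectivity suffices for the count in `one_mem_span_centralYoung`: there are at least as many
shapes as cycle types. -/
theorem ofPartition_injective {n : ℕ} : Function.Injective (ofPartition (n := n)) := by
  intro p q h
  have h1 := congrArg YoungDiagram.rowLens (congrArg Subtype.val h)
  have hp : ∀ r : Nat.Partition n, (ofPartition r).1.rowLens = r.parts.sort (· ≥ ·) := fun r =>
    YoungDiagram.rowLens_ofRowLens_eq_self (hw := (Multiset.pairwise_sort _ _).sortedGE) fun x hx => r.parts_pos ((Multiset.mem_sort _).mp hx)
  rw [hp, hp] at h1
  ext1
  rw [← Multiset.sort_eq p.parts (· ≥ ·), h1, Multiset.sort_eq]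

/-- A tableau of shape `μ`. -/
def someTableau {n : ℕ} (μ : PartitionOf n) : Tableau μ :=
  (μ.1.cells.equivFinOfCardEq μ.2).symm

end Partitions

/-! ### Completeness: the central Young elements span the centre -/

section ClassFunctions

variable {m : ℕ} {d : Fin m → ℕ}

/-- The cycle type of an element of `S_d`. -/
def cycleTypes (g : SymProd d) (i : Fin m) : Nat.Partition (Fintype.card (Fin (d i))) :=
  (g i).partition

theorem exists_conj_of_cycleTypes_eq {g h : SymProd d} (hgh : cycleTypes g = cycleTypes h) :
    ∃ c : SymProd d, c * g * c⁻¹ = h := by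
  have h1 : ∀ i, ∃ c : Equiv.Perm (Fin (d i)), c * g i * c⁻¹ = h i := fun i =>
    isConj_iff.mp (Equiv.Perm.partition_eq_of_isConj.mpr (congrFun hgh i))
  choose c hc using h1
  exact ⟨c, funext hc⟩

variable (k : Type u) [Field k]

/-- The element of the group algebra given by a function of the cycle type. -/
def classSum : ((∀ i, Nat.Partition (Fintype.card (Fin (d i)))) → k) →ₗ[k]
    MonoidAlgebra k (SymProd d) :=
  ∑ g : SymProd d, (LinearMap.proj (cycleTypes g)).smulRight (MonoidAlgebra.of k _ g)

variable {k}

theorem coeff_classSum (φ : (∀ i, Nat.Partition (Fintype.card (Fin (d i)))) → k) (g : SymProd d) :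
    (classSum k φ).coeff g = φ (cycleTypes g) := by
  classical
  rw [classSum, LinearMap.sum_apply, MonoidAlgebra.coeff_sum, Finsupp.finsetSum_apply,
    Finset.sum_eq_single g]
  · simp
  · intro h _ hne
    simp [hne]
  · simp

/-- The coefficients of a central element are constant on conjugacy classes, and the cycle types
determine the class. -/
theorem mem_range_classSum {x : MonoidAlgebra k (SymProd d)}
    (hx : ∀ h, MonoidAlgebra.of k _ h * x = x * MonoidAlgebra.of k _ h) :
    ∃ φ, classSum k φ = x := by
  refine ⟨Function.extend cycleTypes (fun g => x.coeff g) 0, ?_⟩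
  apply MonoidAlgebra.coeff_injective
  ext g
  rw [coeff_classSum, Function.FactorsThrough.extend_apply]
  intro g h hgh
  obtain ⟨c, rfl⟩ := exists_conj_of_cycleTypes_eq hgh
  have h1 := congrArg (fun y => y.coeff (c * g)) (hx c)
  simpa using h1

variable (k) in
/-- The average of the conjugates of a Young symmetrizer. -/
def centralYoung (μ : ∀ i, PartitionOf (d i)) : MonoidAlgebra k (SymProd d) :=
  ∑ g, MonoidAlgebra.of k _ g * young k (fun i => someTableau (μ i)) * MonoidAlgebra.of k _ g⁻¹

theorem of_mul_centralYoung (μ : ∀ i, PartitionOf (d i)) (h : SymProd d) :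
    MonoidAlgebra.of k _ h * centralYoung k μ = centralYoung k μ * MonoidAlgebra.of k _ h := by
  rw [centralYoung, Finset.mul_sum, Finset.sum_mul]
  refine Fintype.sum_equiv (Equiv.mulLeft h) _ _ fun g => ?_
  rw [Equiv.coe_mulLeft, mul_inv_rev, map_mul, map_mul]
  simp only [mul_assoc]
  rw [← map_mul, inv_mul_cancel, map_one, mul_one]

theorem centralYoung_mul_centralYoung [CharZero k] {μ ν : ∀ i, PartitionOf (d i)} (h : μ ≠ ν) :
    centralYoung k μ * centralYoung k ν = 0 := by
  rw [centralYoung, centralYoung, Finset.sum_mul_sum]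
  refine Finset.sum_eq_zero fun g _ => Finset.sum_eq_zero fun g' _ => ?_
  have := young_mul_mul_young_eq_zero (k := k) (t := fun i => someTableau (μ i))
    (s := fun i => someTableau (ν i)) h (MonoidAlgebra.of k _ g⁻¹ * MonoidAlgebra.of k _ g')
  calc _ = MonoidAlgebra.of k _ g * (young k (fun i => someTableau (μ i)) *
      (MonoidAlgebra.of k _ g⁻¹ * MonoidAlgebra.of k _ g') * young k (fun i => someTableau (ν i))) *
        MonoidAlgebra.of k _ g'⁻¹ := by simp only [mul_assoc]
    _ = 0 := by rw [this, mul_zero, zero_mul]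

theorem not_isNilpotent_centralYoung [CharZero k] (μ : ∀ i, PartitionOf (d i)) :
    ¬ IsNilpotent (centralYoung k μ) := by
  apply not_isNilpotent_of_apply_one_ne_zero
  have h : (centralYoung k μ).coeff 1 = Fintype.card (SymProd d) := by
    rw [centralYoung, MonoidAlgebra.coeff_sum, Finsupp.finsetSum_apply]
    have h1 : ∀ g : SymProd d, (MonoidAlgebra.of k _ g * young k (fun i => someTableau (μ i)) *
      MonoidAlgebra.of k _ g⁻¹).coeff 1 = 1 := fun g => by
        have := coeff_young_one (k := k) (fun i => someTableau (μ i))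
        simpa using this
    rw [Finset.sum_congr rfl fun g _ => h1 g, Finset.sum_const, nsmul_one, Finset.card_univ]
  rw [h]
  exact Nat.cast_ne_zero.mpr Fintype.card_ne_zero

/-- The elements are pairwise orthogonal and none has square zero, so multiplying a relation by one
of them isolates its coefficient. -/
theorem linearIndependent_centralYoung [CharZero k] :
    LinearIndependent k fun μ : ∀ i, PartitionOf (d i) => centralYoung k μ := by
  classical
  rw [linearIndependent_iff']
  intro s a ha μ hμ
  have h1 : (∑ ν ∈ s, a ν • centralYoung k ν) * centralYoung k μ =
      a μ • (centralYoung k μ * centralYoung k μ) := by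
    rw [Finset.sum_mul, Finset.sum_eq_single μ]
    · rw [smul_mul_assoc]
    · intro ν _ hν
      rw [smul_mul_assoc, centralYoung_mul_centralYoung hν, smul_zero]
    · exact fun h => absurd hμ h
  rw [ha, zero_mul] at h1
  refine (smul_eq_zero.mp h1.symm).resolve_right fun h2 => ?_
  exact not_isNilpotent_centralYoung (k := k) μ ⟨2, by rw [pow_two, h2]⟩

/-- Dimension count: central elements come from functions on lists of cycle types, and the central
Young elements provide that many independent ones. As 1 is central, it lies in their span. -/
theorem one_mem_span_centralYoung [CharZero k] : (1 : MonoidAlgebra k (SymProd d)) ∈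
    Submodule.span k (Set.range fun μ : ∀ i, PartitionOf (d i) => centralYoung k μ) := by
  classical
  let P := ∀ i, Nat.Partition (Fintype.card (Fin (d i)))
  have hφ : ∀ p : P, ∃ φ, classSum k φ =
      centralYoung k fun i => ofPartition (Fintype.card_fin (d i) ▸ p i) := fun p =>
    mem_range_classSum (of_mul_centralYoung _)
  choose φ hφ using hφ
  obtain ⟨φ₁, hφ₁⟩ := mem_range_classSum (k := k) (d := d) (x := 1) (by simp)
  have hinj : Function.Injective fun (p : P) i =>
      ofPartition (n := d i) (Fintype.card_fin (d i) ▸ p i) := by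
    intro p q hpq
    funext i
    have := ofPartition_injective (congrFun hpq i)
    revert this
    generalize_proofs h
    generalize p i = a
    generalize q i = b
    revert h a b
    generalize Fintype.card (Fin (d i)) = N
    rintro rfl a b h
    exact h
  have hli : LinearIndependent k φ := by
    apply LinearIndependent.of_comp (classSum k)
    have : (classSum k ∘ φ) = fun p : P => centralYoung k fun i =>
        ofPartition (n := d i) (Fintype.card_fin (d i) ▸ p i) := funext hφ
    rw [this]
    exact linearIndependent_centralYoung.comp _ hinj
  -- The family is indexed by the lists of cycle types themselves, so its size is the dimension of
  -- the function space.
  have hspan := hli.span_eq_top_of_card_eq_finrank' (Module.finrank_fintype_fun_eq_card k).symm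
  have h1 : φ₁ ∈ Submodule.span k (Set.range φ) := hspan ▸ Submodule.mem_top
  have h2 := Submodule.mem_map_of_mem (f := classSum k) h1
  rw [hφ₁, Submodule.map_span] at h2
  refine Submodule.span_mono ?_ h2
  rintro _ ⟨_, ⟨p, rfl⟩, rfl⟩
  exact ⟨_, (hφ p).symm⟩

/-- If all symmetrizers killed `W`, so would their conjugates, the central elements and finally 1.
-/
theorem exists_young_smul_ne_zero [CharZero k] {W : Type*} [AddCommGroup W]
    [Module (MonoidAlgebra k (SymProd d)) W] [Nontrivial W] :
    ∃ (μ : ∀ i, PartitionOf (d i)) (w : W), young k (fun i => someTableau (μ i)) • w ≠ 0 := by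
  by_contra! hcon
  obtain ⟨w, hw⟩ := exists_ne (0 : W)
  apply hw
  suffices h : ∀ x ∈ Submodule.span k
      (Set.range fun μ : ∀ i, PartitionOf (d i) => centralYoung k μ), x • w = 0 by
    rw [← one_smul (MonoidAlgebra k (SymProd d)) w, h _ one_mem_span_centralYoung]
  intro x hx
  induction hx using Submodule.span_induction with
  | mem x hx =>
    obtain ⟨μ, rfl⟩ := hx
    simp only [centralYoung, Finset.sum_smul]
    refine Finset.sum_eq_zero fun g _ => ?_
    rw [mul_smul, mul_smul, hcon, smul_zero]
  | zero => rw [zero_smul]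
  | add x y _ _ hx hy => rw [add_smul, hx, hy, add_zero]
  | smul a x _ hx => rw [Algebra.smul_def, mul_smul, hx, smul_zero]

end ClassFunctions

/-! ### The left ideals of Young symmetrizers are the simple modules -/

section Simple

variable {m : ℕ} {d : Fin m → ℕ} {k : Type u} [Field k]

variable (k) in
/-- The left ideal generated by a Young symmetrizer. -/
def youngIdeal {μ : ∀ i, PartitionOf (d i)} (t : ∀ i, Tableau (μ i)) :
    Submodule (MonoidAlgebra k (SymProd d)) (MonoidAlgebra k (SymProd d)) :=
  Submodule.span _ {young k t}

theorem young_mem_youngIdeal {μ : ∀ i, PartitionOf (d i)} (t : ∀ i, Tableau (μ i)) :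
    young k t ∈ youngIdeal k t := Submodule.mem_span_singleton_self _

theorem young_ne_zero {μ : ∀ i, PartitionOf (d i)} (t : ∀ i, Tableau (μ i)) : young k t ≠ 0 := by
  intro h
  have := coeff_young_one (k := k) t
  simp [h] at this

variable [CharZero k]

/-- A proper subideal N of A e has e N = 0, since e a e is a multiple of e and a nonzero multiple
would put e into N. Hence N N = 0, which semisimplicity of the regular module excludes unless N = 0.
-/
instance {μ : ∀ i, PartitionOf (d i)} (t : ∀ i, Tableau (μ i)) :
    IsSimpleModule (MonoidAlgebra k (SymProd d)) (youngIdeal k t) := by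
  rw [isSimpleModule_iff_isAtom]
  refine ⟨fun h => young_ne_zero (k := k) t ?_, fun N hN => ?_⟩
  · rw [← Submodule.mem_bot (MonoidAlgebra k (SymProd d)), ← h]
    exact young_mem_youngIdeal t
  have h1 : ∀ x ∈ N, young k t * x = 0 := by
    intro x hx
    obtain ⟨a, rfl⟩ := Submodule.mem_span_singleton.mp (hN.le hx)
    obtain ⟨c, hc⟩ := exists_young_mul_mul_young (k := k) t a
    rw [smul_eq_mul, ← mul_assoc, hc]
    by_contra hne
    have hc0 : c ≠ 0 := by rintro rfl; simp at hne
    apply hN.not_ge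
    rw [youngIdeal, Submodule.span_singleton_le_iff_mem]
    have h2 : young k t = algebraMap k _ c⁻¹ * (young k t * (a * young k t)) := by
      rw [← mul_assoc (young k t), hc, ← Algebra.smul_def, smul_smul, inv_mul_cancel₀ hc0, one_smul]
    rw [h2]
    exact N.smul_mem _ (N.smul_mem (young k t) hx)
  have h2 : ∀ x ∈ N, ∀ y ∈ N, x * y = 0 := by
    intro x hx y hy
    obtain ⟨a, rfl⟩ := Submodule.mem_span_singleton.mp (hN.le hx)
    rw [smul_eq_mul, mul_assoc, h1 y hy, mul_zero]
  -- Writing 1 = n + n' along a complement, x = x n + x n' = x n' for x in N, so x lies in both N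
  -- and N'.
  obtain ⟨N', hN'⟩ := exists_isCompl N
  obtain ⟨n, hn, n', hn', hnn'⟩ := Submodule.mem_sup.mp
    (hN'.sup_eq_top ▸ Submodule.mem_top : (1 : MonoidAlgebra k (SymProd d)) ∈ N ⊔ N')
  rw [eq_bot_iff]
  intro x hx
  have h3 : x = x * n' := by
    conv_lhs => rw [← mul_one x, ← hnn', mul_add, h2 x hx n hn, zero_add]
  rw [← hN'.inf_eq_bot]
  exact ⟨hx, h3 ▸ N'.smul_mem x hn'⟩

/-- Schur's lemma for the map sending a to a • w, which is nonzero at the symmetrizer. -/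
theorem nonempty_youngIdeal_equiv {W : Type*} [AddCommGroup W]
    [Module (MonoidAlgebra k (SymProd d)) W] [IsSimpleModule (MonoidAlgebra k (SymProd d)) W]
    {μ : ∀ i, PartitionOf (d i)} (t : ∀ i, Tableau (μ i)) {w : W} (hw : young k t • w ≠ 0) :
    Nonempty (youngIdeal k t ≃ₗ[MonoidAlgebra k (SymProd d)] W) := by
  let f : youngIdeal k t →ₗ[MonoidAlgebra k (SymProd d)] W :=
    (LinearMap.toSpanSingleton _ W w).domRestrict (youngIdeal k t)
  have hf : f ≠ 0 := fun h => hw (LinearMap.congr_fun h ⟨_, young_mem_youngIdeal t⟩)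
  exact ⟨LinearEquiv.ofBijective f (LinearMap.bijective_of_ne_zero hf)⟩

end Simple


/-! ## Multiplicities -/

section Rank

variable {k : Type u} [Field k] {A : Type*} [Ring A] [Algebra k A]
  {V : Type*} [AddCommGroup V] [Module k V] [Module A V] [IsScalarTower k A V]
  {W : Type*} [AddCommGroup W] [Module k W] [Module A W] [IsScalarTower k A W]

variable (k) in
/-- The rank of the action of an element of an algebra on a module. -/
def rankOf (a : A) (V : Type*) [AddCommGroup V] [Module k V] [Module A V]
    [IsScalarTower k A V] : ℕ :=
  Module.finrank k (LinearMap.range (Algebra.lsmul k k V a))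

theorem mem_range_lsmul {a : A} {x : V} :
    x ∈ LinearMap.range (Algebra.lsmul k k V a) ↔ ∃ y, a • y = x := Iff.rfl

theorem rankOf_congr (a : A) (e : V ≃ₗ[A] W) : rankOf k a V = rankOf k a W := by
  let e' : V ≃ₗ[k] W := e.restrictScalars k
  have h : (LinearMap.range (Algebra.lsmul k k V a)).map (e' : V →ₗ[k] W) =
      LinearMap.range (Algebra.lsmul k k W a) := by
    ext x
    rw [Submodule.mem_map, mem_range_lsmul]
    constructor
    · rintro ⟨_, ⟨y, rfl⟩, rfl⟩
      exact ⟨e y, (e.map_smul a y).symm⟩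
    · rintro ⟨y, rfl⟩
      exact ⟨a • e.symm y, ⟨_, rfl⟩, by
        change e (a • e.symm y) = _
        rw [e.map_smul, e.apply_symm_apply]⟩
  rw [rankOf, rankOf, ← h]
  exact (e'.submoduleMap _).finrank_eq

theorem rankOf_pi {ι : Type*} [Fintype ι] (a : A) (V : ι → Type*) [∀ i, AddCommGroup (V i)]
    [∀ i, Module k (V i)] [∀ i, Module A (V i)] [∀ i, IsScalarTower k A (V i)]
    [∀ i, Module.Finite k (V i)] :
    rankOf k a (∀ i, V i) = ∑ i, rankOf k a (V i) := by
  unfold rankOf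
  rw [← Module.finrank_pi_fintype k]
  refine LinearEquiv.finrank_eq ⟨⟨⟨fun x i => ⟨x.1 i, ?_⟩, ?_⟩, ?_⟩,
    fun x => ⟨fun i => (x i).1, ?_⟩, ?_, ?_⟩
  · obtain ⟨y, hy⟩ := mem_range_lsmul.mp x.2
    exact mem_range_lsmul.mpr ⟨y i, congrFun hy i⟩
  · intro x y; rfl
  · intro c x; rfl
  · choose y hy using fun i => mem_range_lsmul.mp (x i).2
    exact mem_range_lsmul.mpr ⟨y, funext hy⟩
  · intro x; rfl
  · intro x; rfl

theorem finrank_range_le_of_injective_on {V : Type*} [AddCommGroup V] [Module k V]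
    [Module.Finite k V] {f g b : V →ₗ[k] V} (h1 : ∀ x, b (f x) ∈ LinearMap.range g)
    (h2 : ∀ x, b (f x) = 0 → f x = 0) :
    Module.finrank k (LinearMap.range f) ≤ Module.finrank k (LinearMap.range g) := by
  let φ : LinearMap.range f →ₗ[k] LinearMap.range g :=
    (b.domRestrict _).codRestrict _ (by rintro ⟨_, ⟨x, rfl⟩⟩; exact h1 x)
  refine LinearMap.finrank_le_finrank_of_injective (f := φ) ?_
  rw [injective_iff_map_eq_zero]
  rintro ⟨_, ⟨x, rfl⟩⟩ hx
  exact Subtype.ext (h2 x (congrArg Subtype.val hx))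

/-- Multiplication by `b` carries the image of ab into that of ba, and injectively: applying `a`
afterwards returns `c` times the vector. -/
theorem rankOf_mul_le {a b : A} {c : k} [Module.Finite k V] (hc : c ≠ 0)
    (h : a * b * (a * b) = c • (a * b)) : rankOf k (a * b) V ≤ rankOf k (b * a) V := by
  refine finrank_range_le_of_injective_on (b := Algebra.lsmul k k V b) ?_ ?_
  · intro x
    have h1 : b * (a * b) = (b * a) * (c⁻¹ • (b * (a * b))) := by
      rw [mul_smul_comm, ← mul_assoc b a, mul_assoc, mul_assoc, ← mul_assoc a b, h, mul_smul_comm,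
        smul_smul, inv_mul_cancel₀ hc, one_smul]
    refine mem_range_lsmul.mpr ⟨(c⁻¹ • (b * (a * b))) • x, ?_⟩
    rw [← mul_smul, ← h1, mul_smul]
    rfl
  · intro x hx
    have hx' : (b * (a * b)) • x = 0 := by rw [mul_smul]; exact hx
    have h2 : (c • (a * b)) • x = 0 := by
      rw [← h, mul_assoc, mul_smul, hx', smul_zero]
    rw [smul_assoc] at h2
    exact (smul_eq_zero.mp h2).resolve_left hc

theorem rankOf_conj [Module.Finite k V] (a : A) (g : Aˣ) :
    rankOf k (g * a * (g⁻¹ : Aˣ) : A) V = rankOf k a V := by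
  have hle : ∀ (a : A) (g : Aˣ), rankOf k (g * a * (g⁻¹ : Aˣ) : A) V ≤ rankOf k a V := by
    intro a g
    refine finrank_range_le_of_injective_on
      (b := Algebra.lsmul k k V ((g⁻¹ : Aˣ) : A)) ?_ ?_
    · intro x
      refine mem_range_lsmul.mpr ⟨((g⁻¹ : Aˣ) : A) • x, ?_⟩
      change _ = ((g⁻¹ : Aˣ) : A) • ((g * a * (g⁻¹ : Aˣ) : A) • x)
      rw [← mul_smul, ← mul_smul, mul_assoc (g : A), Units.inv_mul_cancel_left]
    · intro x hx
      have h := congrArg (fun y => (g : A) • y) hx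
      change (g : A) • ((g⁻¹ : Aˣ) : A) • _ = (g : A) • (0 : V) at h
      rwa [← mul_smul, Units.mul_inv, one_smul, smul_zero] at h
  refine le_antisymm (hle a g) ?_
  have h := hle (g * a * (g⁻¹ : Aˣ) : A) g⁻¹
  have h2 : ((g⁻¹ : Aˣ) : A) * (g * a * (g⁻¹ : Aˣ)) * ((g⁻¹)⁻¹ : Aˣ) = a := by
    simp [mul_assoc]
  rwa [h2] at h

end Rank

/-! ### Multiplicities of simple modules as ranks of Young symmetrizers -/

section Multiplicity

variable {m : ℕ} {d : Fin m → ℕ} {k : Type u} [Field k]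

/-- The relabelling that turns one tableau into the other conjugates the symmetrizers. This frees
the choice of tableau when multiplicities for different `d` are compared. -/
theorem rankOf_young_eq {V : Type*} [AddCommGroup V] [Module k V]
    [Module (MonoidAlgebra k (SymProd d)) V] [IsScalarTower k (MonoidAlgebra k (SymProd d)) V]
    [Module.Finite k V] {μ : ∀ i, PartitionOf (d i)} (t s : ∀ i, Tableau (μ i)) :
    rankOf k (young k t) V = rankOf k (young k s) V := by
  let g : SymProd d := fun i => (t i).trans (s i).symm
  have hr : translate g (rows t) = rows s := by
    funext i x
    simp [translate, rows, g]
  have hc : translate g (cols t) = cols s := by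
    funext i x
    simp [translate, cols, g]
  let u : (MonoidAlgebra k (SymProd d))ˣ := Units.map (MonoidAlgebra.of k _) (toUnits g)
  have h : young k s = u * young k t * (u⁻¹ : (MonoidAlgebra k (SymProd d))ˣ) := by
    rw [Units.eq_mul_inv_iff_mul_eq]
    change _ * MonoidAlgebra.of k _ g = MonoidAlgebra.of k _ g * _
    rw [young, young, ← mul_assoc, of_mul_colSum_eq, mul_assoc, mul_assoc, of_mul_rowSum_eq, hr, hc]
  rw [h, rankOf_conj]

variable [CharZero k]

/-- In this order the column sum acts first, which suits both the vanishing result and the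
comparison between different `d`. -/
theorem rankOf_rowSum_mul_colSum {V : Type*} [AddCommGroup V] [Module k V]
    [Module (MonoidAlgebra k (SymProd d)) V] [IsScalarTower k (MonoidAlgebra k (SymProd d)) V]
    [Module.Finite k V] {μ : ∀ i, PartitionOf (d i)} (t : ∀ i, Tableau (μ i)) :
    rankOf k (rowSum k (rows t) * colSum k (cols t)) V = rankOf k (young k t) V := by
  obtain ⟨c, hc0, hc, hc'⟩ := exists_young_mul_young_rev (k := k) t
  exact le_antisymm (rankOf_mul_le hc0 hc') (rankOf_mul_le hc0 hc)

theorem rankOf_youngIdeal_self {μ : ∀ i, PartitionOf (d i)} (t : ∀ i, Tableau (μ i)) :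
    rankOf k (young k t) (youngIdeal k t) = 1 := by
  let v : youngIdeal k t := ⟨young k t, young_mem_youngIdeal t⟩
  have hv : v ∈ LinearMap.range (Algebra.lsmul k k (youngIdeal k t) (young k t)) := by
    obtain ⟨c, hc0, hc⟩ := exists_young_mul_young (k := k) t
    refine mem_range_lsmul.mpr ⟨c⁻¹ • v, Subtype.ext ?_⟩
    change young k t * (c⁻¹ • young k t) = young k t
    rw [mul_smul_comm, hc, smul_smul, inv_mul_cancel₀ hc0, one_smul]
  refine finrank_eq_one (⟨v, hv⟩ : LinearMap.range _) ?_ ?_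
  · intro h
    exact young_ne_zero t (congrArg (fun x => x.1.1) h)
  · rintro ⟨x, hx⟩
    obtain ⟨⟨y, hy⟩, rfl⟩ := mem_range_lsmul.mp hx
    obtain ⟨a, rfl⟩ := Submodule.mem_span_singleton.mp hy
    obtain ⟨c, hc⟩ := exists_young_mul_mul_young (k := k) t a
    refine ⟨c, Subtype.ext (Subtype.ext ?_)⟩
    change c • young k t = young k t * (a * young k t)
    rw [← hc, mul_assoc]

theorem rankOf_youngIdeal_of_ne {μ ν : ∀ i, PartitionOf (d i)} (h : μ ≠ ν)
    (t : ∀ i, Tableau (μ i)) (s : ∀ i, Tableau (ν i)) :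
    rankOf k (young k t) (youngIdeal k s) = 0 := by
  have h0 : Algebra.lsmul k k (youngIdeal k s) (young k t) = 0 := by
    ext1 x
    obtain ⟨x, hx⟩ := x
    obtain ⟨a, rfl⟩ := Submodule.mem_span_singleton.mp hx
    apply Subtype.ext
    change young k t * (a * young k s) = 0
    rw [← mul_assoc, young_mul_mul_young_eq_zero h]
  rw [rankOf, h0, LinearMap.range_zero, finrank_bot]

variable (k) in
/-- The simple module attached to a list of partitions. -/
abbrev simpleModule (μ : ∀ i, PartitionOf (d i)) :
    Submodule (MonoidAlgebra k (SymProd d)) (MonoidAlgebra k (SymProd d)) :=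
  youngIdeal k fun i => someTableau (μ i)

variable (k) in
/-- The multiplicity of the simple module attached to `μ`. -/
def multiplicity (μ : ∀ i, PartitionOf (d i)) (V : Type*) [AddCommGroup V] [Module k V]
    [Module (MonoidAlgebra k (SymProd d)) V] [IsScalarTower k (MonoidAlgebra k (SymProd d)) V] :
    ℕ :=
  rankOf k (young k fun i => someTableau (μ i)) V

open Classical in
theorem multiplicity_simpleModule (μ ν : ∀ i, PartitionOf (d i)) :
    multiplicity k μ (simpleModule k ν) = if ν = μ then 1 else 0 := by
  split_ifs with h
  · subst h; exact rankOf_youngIdeal_self _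
  · exact rankOf_youngIdeal_of_ne (fun h' => h h'.symm) _ _

open Classical in
-- Semisimplicity gives a finite sum of simple modules, and some symmetrizer acts nontrivially on
-- each, which identifies it. Ranks are additive, and the symmetrizer of `μ` has rank 1 or 0 on a
-- simple module according to its label.
theorem exists_equiv_pi_simpleModule (V : Type*) [AddCommGroup V] [Module k V]
    [Module (MonoidAlgebra k (SymProd d)) V] [IsScalarTower k (MonoidAlgebra k (SymProd d)) V]
    [Module.Finite k V] :
    ∃ (n : ℕ) (ν : Fin n → ∀ i, PartitionOf (d i)),
      Nonempty (V ≃ₗ[MonoidAlgebra k (SymProd d)] ∀ j, simpleModule k (ν j)) ∧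
      ∀ μ, multiplicity k μ V = (Finset.univ.filter fun j => ν j = μ).card := by
  have : Module.Finite (MonoidAlgebra k (SymProd d)) V := Module.Finite.of_restrictScalars_finite k _ _
  have : IsSemisimpleModule (MonoidAlgebra k (SymProd d)) V := inferInstance
  obtain ⟨n, S, e, hS⟩ :=
    IsSemisimpleModule.exists_linearEquiv_fin_dfinsupp (MonoidAlgebra k (SymProd d)) V
  have h : ∀ j, ∃ ν : ∀ i, PartitionOf (d i),
      Nonempty (simpleModule k ν ≃ₗ[MonoidAlgebra k (SymProd d)] S j) := by
    intro j
    have := hS j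
    have : Nontrivial (S j) := IsSimpleModule.nontrivial (MonoidAlgebra k (SymProd d)) _
    obtain ⟨μ, w, hw⟩ := exists_young_smul_ne_zero (k := k) (d := d) (W := S j)
    exact ⟨μ, nonempty_youngIdeal_equiv _ hw⟩
  choose ν f using h
  let E : V ≃ₗ[MonoidAlgebra k (SymProd d)] ∀ j, simpleModule k (ν j) :=
    e.trans ((DFinsupp.linearEquivFunOnFintype).trans
      (LinearEquiv.piCongrRight fun j => (f j).some.symm))
  refine ⟨n, ν, ⟨E⟩, fun μ => ?_⟩
  rw [multiplicity, rankOf_congr _ E, rankOf_pi]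
  rw [Finset.card_filter]
  exact Finset.sum_congr rfl fun j _ => multiplicity_simpleModule μ (ν j)

end Multiplicity


/-! ## The representations `Irr(μ)` -/

section Tensor

theorem injective_of_isSimpleModule {R M N : Type*} [Ring R] [AddCommGroup M] [AddCommMonoid N]
    [Module R M] [Module R N] [IsSimpleModule R M] (f : M →ₗ[R] N) (h : ∃ x, f x ≠ 0) :
    Function.Injective f := by
  have hker : LinearMap.ker f = ⊥ := (eq_bot_or_eq_top (LinearMap.ker f)).resolve_right fun h0 => by
    obtain ⟨x, hx⟩ := h
    exact hx (LinearMap.mem_ker.mp (h0 ▸ Submodule.mem_top))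
  intro x y hxy
  have h1 : x - y ∈ LinearMap.ker f := by
    rw [LinearMap.mem_ker, sub_eq_add_neg, map_add, hxy, ← map_add, add_neg_cancel, map_zero]
  rw [hker, Submodule.mem_bot, sub_eq_zero] at h1
  exact h1

theorem tprod_mem_of_span_eq_top {ι R : Type*} [Finite ι] [CommSemiring R] {M : ι → Type*}
    [∀ i, AddCommMonoid (M i)] [∀ i, Module R (M i)] {s : ∀ i, Set (M i)}
    (hs : ∀ i, Submodule.span R (s i) = ⊤) {S : Submodule R (⨂[R] i, M i)}
    (h : ∀ x : ∀ i, M i, (∀ i, x i ∈ s i) → PiTensorProduct.tprod R x ∈ S) : S = ⊤ := by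
  classical
  have := Fintype.ofFinite ι
  -- `T` collects the coordinates freed from the spanning sets; multilinearity frees them one at a
  -- time.
  have key : ∀ T : Finset ι, ∀ x : ∀ i, M i, (∀ i ∉ T, x i ∈ s i) →
      PiTensorProduct.tprod R x ∈ S := by
    intro T
    induction T using Finset.induction_on with
    | empty => exact fun x hx => h x fun i => hx i (Finset.notMem_empty i)
    | insert i T _ ih =>
      intro x hx
      have h1 : Submodule.span R (s i) ≤
          S.comap ((PiTensorProduct.tprod R).toLinearMap x i) := by
        rw [Submodule.span_le]
        intro y hy
        refine ih _ fun j hj => ?_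
        by_cases hji : j = i
        · subst hji; simpa using hy
        · rw [Function.update_of_ne hji]
          exact hx j (by simp [hji, hj])
      have h2 : x i ∈ S.comap ((PiTensorProduct.tprod R).toLinearMap x i) :=
        h1 (hs i ▸ Submodule.mem_top)
      simpa using h2
  rw [eq_top_iff, ← PiTensorProduct.span_tprod_eq_top, Submodule.span_le]
  rintro _ ⟨x, rfl⟩
  exact key Finset.univ x (by simp)

theorem mapIncl_injective {ι k : Type*} [Field k] {M : ι → Type*} [∀ i, AddCommGroup (M i)]
    [∀ i, Module k (M i)] (p : ∀ i, Submodule k (M i)) :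
    Function.Injective (PiTensorProduct.mapIncl p) := by
  choose q hq using fun i => (p i).subtype.exists_leftInverse_of_injective (p i).ker_subtype
  have h : PiTensorProduct.map q ∘ₗ PiTensorProduct.mapIncl p = LinearMap.id := by
    rw [PiTensorProduct.mapIncl, ← PiTensorProduct.map_comp]
    simp only [hq]
    exact PiTensorProduct.map_id
  exact Function.LeftInverse.injective (g := PiTensorProduct.map q) (LinearMap.congr_fun h)

end Tensor

/-! ### Identification of Irr(μ) with the left ideal of a Young symmetrizer -/

section Irr

variable {m : ℕ} {d : Fin m → ℕ} (k : Type u) [Field k]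

/-- The exterior tensor product of the representations `rowRep`. -/
def tensorRowRep (d : Fin m → ℕ) :
    Representation k (SymProd d) (⨂[k] i, ((Fin (d i) → ℕ) →₀ k)) where
  toFun σ := PiTensorProduct.map fun i => rowRep k (d i) (σ i)
  map_one' := by
    simp only [Pi.one_apply, map_one]
    exact PiTensorProduct.map_one
  map_mul' σ τ := by
    simp only [Pi.mul_apply, map_mul]
    exact PiTensorProduct.map_mul _ _

variable {k}

theorem rowRep_single {n : ℕ} (σ : Equiv.Perm (Fin n)) (r : Fin n → ℕ) (a : k) :
    rowRep k n σ (Finsupp.single r a) = Finsupp.single (r ∘ σ.symm) a :=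
  Finsupp.mapDomain_single

variable (k) in
/-- The tensor product of the tabloids of `t`. -/
def tabloid {μ : ∀ i, PartitionOf (d i)} (t : ∀ i, Tableau (μ i)) :
    ⨂[k] i, ((Fin (d i) → ℕ) →₀ k) :=
  PiTensorProduct.tprod k fun i => Finsupp.single (rows t i) 1

theorem tensorRowRep_tabloid {μ : ∀ i, PartitionOf (d i)} (t : ∀ i, Tableau (μ i))
    (g : SymProd d) : tensorRowRep k d g (tabloid k t) =
      PiTensorProduct.tprod k fun i => Finsupp.single (translate g (rows t) i) 1 := by
  change PiTensorProduct.map _ (PiTensorProduct.tprod k _) = _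
  rw [PiTensorProduct.map_tprod]
  simp only [rowRep_single]
  rfl

theorem rowSum_tabloid {μ : ∀ i, PartitionOf (d i)} (t : ∀ i, Tableau (μ i)) :
    (tensorRowRep k d).asAlgebraHom (rowSum k (rows t)) (tabloid k t) =
      ((stab (rows t)).card : k) • tabloid k t := by
  rw [rowSum, map_sum, LinearMap.sum_apply, Nat.cast_smul_eq_nsmul, ← Finset.sum_const]
  refine Finset.sum_congr rfl fun g hg => ?_
  rw [Representation.asAlgebraHom_of, tensorRowRep_tabloid, tabloid]
  congr 1
  funext i
  congr 1
  funext x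
  have := mem_stab.mp (inv_mem_stab hg) i x
  exact this

theorem colSum_tabloid {μ : ∀ i, PartitionOf (d i)} (t : ∀ i, Tableau (μ i)) :
    (tensorRowRep k d).asAlgebraHom (colSum k (cols t)) (tabloid k t) =
      PiTensorProduct.tprod k fun i => polytabloid k (t i) := by
  simp only [polytabloid]
  rw [MultilinearMap.map_sum_finset, colSum, map_sum, LinearMap.sum_apply]
  refine Finset.sum_congr ?_ fun g hg => ?_
  · ext g
    rw [mem_stab, Fintype.mem_piFinset]
    simp only [Finset.mem_filter, Finset.mem_univ, true_and]
    rfl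
  · rw [map_smul, LinearMap.smul_apply, Representation.asAlgebraHom_of, tensorRowRep_tabloid]
    have h : ((sgn g : ℤ) : k) = ∏ i, (((Equiv.Perm.sign (g i) : ℤˣ) : ℤ) : k) := by
      simp [sgn]
    rw [h, ← MultilinearMap.map_smul_univ]
    congr 1
    funext i
    rw [Finsupp.smul_single, smul_eq_mul, mul_one]
    rfl

/-- Only the trivial column permutation preserves the rows, so the tabloid of `t` appears exactly
once. -/
theorem polytabloid_apply_row {n : ℕ} {μ : PartitionOf n} (t : Tableau μ) :
    polytabloid k t (fun x => (t x).1.1) = 1 := by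
  rw [polytabloid, Finsupp.finsetSum_apply, Finset.sum_eq_single 1]
  · rw [show (fun x => (t ((1 : Equiv.Perm (Fin n)).symm x)).1.1) = fun x => (t x).1.1 from rfl,
      Finsupp.single_eq_same]
    simp
  · intro q hq hq1
    simp only [Finset.mem_filter, Finset.mem_univ, true_and] at hq
    rw [Finsupp.single_apply, if_neg]
    intro h
    apply hq1
    ext x : 1
    refine t.injective (Subtype.ext (Prod.ext ?_ (hq x)))
    have := congrFun h (q x)
    simpa using this.symm
  · simp

theorem tprod_polytabloid_ne_zero {μ : ∀ i, PartitionOf (d i)} (t : ∀ i, Tableau (μ i)) :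
    PiTensorProduct.tprod k (fun i => polytabloid k (t i)) ≠ 0 := by
  intro h
  have h1 := congrArg (PiTensorProduct.lift ((MultilinearMap.mkPiAlgebra k (Fin m) k).compLinearMap
    fun i => Finsupp.lapply (rows t i))) h
  rw [PiTensorProduct.lift.tprod, map_zero] at h1
  simp only [MultilinearMap.compLinearMap_apply, MultilinearMap.mkPiAlgebra_apply,
    Finsupp.lapply_apply] at h1
  have h2 : ∀ i, polytabloid k (t i) (rows t i) = 1 := fun i => polytabloid_apply_row (t i)
  simp [h2] at h1

/-- The inclusion of `Irr(μ)` into the exterior tensor product of the `rowRep`. -/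
def irrIncl (μ : ∀ i, PartitionOf (d i)) :
    (irr k μ).asModule →ₗ[MonoidAlgebra k (SymProd d)] (tensorRowRep k d).asModule :=
  Representation.IntertwiningMap.equivLinearMapAsModule (irr k μ) (tensorRowRep k d)
    ⟨PiTensorProduct.mapIncl fun i => spechtModule k (μ i), fun g => by
      change PiTensorProduct.map _ ∘ₗ PiTensorProduct.map _ =
        PiTensorProduct.map _ ∘ₗ PiTensorProduct.map _
      rw [← PiTensorProduct.map_comp, ← PiTensorProduct.map_comp]
      rfl⟩

theorem irrIncl_injective (μ : ∀ i, PartitionOf (d i)) :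
    Function.Injective (irrIncl (k := k) μ) :=
  mapIncl_injective fun i => spechtModule k (μ i)

theorem polytabloid_mem {n : ℕ} {μ : PartitionOf n} (t : Tableau μ) :
    polytabloid k t ∈ spechtModule k μ := Submodule.subset_span ⟨t, rfl⟩

theorem span_polytabloid_eq_top {n : ℕ} (μ : PartitionOf n) :
    Submodule.span k (Set.range fun t : Tableau μ =>
      (⟨polytabloid k t, polytabloid_mem t⟩ : spechtModule k μ)) = ⊤ := by
  rw [eq_top_iff]
  rintro ⟨x, hx⟩ -
  induction hx using Submodule.span_induction with
  | mem x h =>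
    obtain ⟨t, rfl⟩ := h
    exact Submodule.subset_span ⟨t, rfl⟩
  | zero => exact Submodule.zero_mem _
  | add x y hx hy h1 h2 => exact Submodule.add_mem _ h1 h2
  | smul a x hx h => exact Submodule.smul_mem _ a h

variable (k) in
/-- The tensor product of polytabloids, as an element of `Irr(μ)`. -/
def irrGenerator {μ : ∀ i, PartitionOf (d i)} (t : ∀ i, Tableau (μ i)) : IrrSpace k μ :=
  PiTensorProduct.tprod k fun i => ⟨polytabloid k (t i), polytabloid_mem (t i)⟩

theorem irr_irrGenerator {μ : ∀ i, PartitionOf (d i)} (t s : ∀ i, Tableau (μ i)) :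
    irr k μ (fun i => (t i).trans (s i).symm) (irrGenerator k t) = irrGenerator k s := by
  change PiTensorProduct.map _ (PiTensorProduct.tprod k _) = _
  rw [PiTensorProduct.map_tprod, irrGenerator]
  congr 1
  funext i
  apply Subtype.ext
  change rowRep k _ _ (polytabloid k (t i)) = _
  rw [rowRep_polytabloid]
  congr 1
  ext x : 1
  simp

/-- `S_d` acts transitively on lists of tableaux of given shapes, so one tensor of polytabloids
generates all of them, and these span. -/
theorem eq_top_of_irrGenerator_mem {μ : ∀ i, PartitionOf (d i)} (t : ∀ i, Tableau (μ i))
    (S : Submodule (MonoidAlgebra k (SymProd d)) (irr k μ).asModule)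
    (h : (irr k μ).asModuleEquiv.symm (irrGenerator k t) ∈ S) : S = ⊤ := by
  let S' : Submodule k (IrrSpace k μ) :=
    (S.restrictScalars k).map ((irr k μ).asModuleEquiv : _ →ₗ[k] IrrSpace k μ)
  have h1 : S' = ⊤ := by
    refine tprod_mem_of_span_eq_top (fun i => span_polytabloid_eq_top (μ i)) fun x hx => ?_
    choose s hs using hx
    refine ⟨MonoidAlgebra.of k _ (fun i => (t i).trans (s i).symm) •
      (irr k μ).asModuleEquiv.symm (irrGenerator k t), S.smul_mem _ h, ?_⟩
    rw [← Representation.asModuleEquiv_symm_map_rho, irr_irrGenerator]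
    change irrGenerator k s = _
    rw [irrGenerator]
    congr 1
    funext i
    exact hs i
  rw [eq_top_iff]
  intro x _
  have h2 : (irr k μ).asModuleEquiv x ∈ S' := h1 ▸ Submodule.mem_top
  obtain ⟨y, hy, hyx⟩ := h2
  rwa [← (irr k μ).asModuleEquiv.injective hyx]

variable [CharZero k]

/-- The symmetrizer sends the tabloid of `t` to a nonzero multiple of its tensor of polytabloids. So
acting on the tabloid embeds the simple left ideal into the permutation module, with the same image
as Irr(μ): both are generated by that tensor. -/
theorem nonempty_youngIdeal_equiv_irr {μ : ∀ i, PartitionOf (d i)} (t : ∀ i, Tableau (μ i)) :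
    Nonempty (youngIdeal k t ≃ₗ[MonoidAlgebra k (SymProd d)] (irr k μ).asModule) := by
  let v : (tensorRowRep k d).asModule := (tensorRowRep k d).asModuleEquiv.symm (tabloid k t)
  let u : (irr k μ).asModule := (irr k μ).asModuleEquiv.symm (irrGenerator k t)
  let f : youngIdeal k t →ₗ[MonoidAlgebra k (SymProd d)] (tensorRowRep k d).asModule :=
    (LinearMap.toSpanSingleton _ _ v).domRestrict (youngIdeal k t)
  have hc : ((stab (rows t)).card : k) ≠ 0 :=
    Nat.cast_ne_zero.mpr (Finset.card_ne_zero.mpr ⟨1, one_mem_stab _⟩)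
  have hu : irrIncl μ u = (tensorRowRep k d).asModuleEquiv.symm
      (PiTensorProduct.tprod k fun i => polytabloid k (t i)) := by
    change PiTensorProduct.map _ (PiTensorProduct.tprod k _) = _
    rw [PiTensorProduct.map_tprod]
    rfl
  have hv : young k t • v = ((stab (rows t)).card : k) • irrIncl μ u := by
    apply (tensorRowRep k d).asModuleEquiv.injective
    rw [hu, Representation.asModuleEquiv_map_smul, LinearEquiv.map_smul,
      LinearEquiv.apply_symm_apply, LinearEquiv.apply_symm_apply, young, map_mul, Module.End.mul_apply, rowSum_tabloid, map_smul,
      colSum_tabloid]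
  have hu0 : irrIncl μ u ≠ 0 := by
    rw [hu]
    intro h
    exact tprod_polytabloid_ne_zero (k := k) t h
  have hf : Function.Injective f := by
    refine injective_of_isSimpleModule (R := MonoidAlgebra k (SymProd d)) (M := youngIdeal k t)
      (N := (tensorRowRep k d).asModule) f ⟨⟨_, young_mem_youngIdeal t⟩, ?_⟩
    change young k t • v ≠ 0
    rw [hv]
    exact smul_ne_zero hc hu0
  have hrange : LinearMap.range f = LinearMap.range (irrIncl (k := k) μ) := by
    apply le_antisymm
    · rintro _ ⟨⟨x, hx⟩, rfl⟩
      obtain ⟨a, rfl⟩ := Submodule.mem_span_singleton.mp hx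
      change (a * young k t) • v ∈ _
      rw [mul_smul, hv]
      refine Submodule.smul_mem _ _ ?_
      rw [algebra_compatible_smul (MonoidAlgebra k (SymProd d))]
      exact Submodule.smul_mem _ _ ⟨u, rfl⟩
    · rw [LinearMap.range_le_iff_comap]
      refine eq_top_of_irrGenerator_mem t _ ?_
      change irrIncl μ u ∈ LinearMap.range f
      have h1 : irrIncl μ u = ((stab (rows t)).card : k)⁻¹ • (young k t • v) := by
        rw [hv, smul_smul, inv_mul_cancel₀ hc, one_smul]
      rw [h1, algebra_compatible_smul (MonoidAlgebra k (SymProd d))]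
      exact Submodule.smul_mem _ _ ⟨⟨_, young_mem_youngIdeal t⟩, rfl⟩
  exact ⟨(LinearEquiv.ofInjective f hf).trans ((LinearEquiv.ofEq _ _ hrange).trans
    (LinearEquiv.ofInjective _ (irrIncl_injective μ)).symm)⟩

end Irr


/-! ## Decomposition of representations of `S_d` -/

section Decomposition

theorem trace_pi {k ι : Type*} [Field k] [Fintype ι] (V : ι → Type*)
    [∀ i, AddCommGroup (V i)] [∀ i, Module k (V i)] [∀ i, Module.Finite k (V i)]
    (f : (∀ i, V i) →ₗ[k] ∀ i, V i) (g : ∀ i, V i →ₗ[k] V i) (h : ∀ x i, f x i = g i (x i)) :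
    LinearMap.trace k _ f = ∑ i, LinearMap.trace k _ (g i) := by
  classical
  let b := fun i => Module.finBasis k (V i)
  rw [LinearMap.trace_eq_matrix_trace k (Pi.basis b), Matrix.trace, Fintype.sum_sigma]
  refine Finset.sum_congr rfl fun i _ => ?_
  rw [LinearMap.trace_eq_matrix_trace k (b i), Matrix.trace]
  refine Finset.sum_congr rfl fun j _ => ?_
  rw [Matrix.diag_apply, Matrix.diag_apply, LinearMap.toMatrix_apply, LinearMap.toMatrix_apply,
    Pi.basis_repr, h, Pi.basis_apply, Pi.single_eq_same]

variable {m : ℕ} {d : Fin m → ℕ} {k : Type u} [Field k]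

variable (k) in
/-- The character of the simple module attached to `μ`. -/
def simpleCharacter (μ : ∀ i, PartitionOf (d i)) (g : SymProd d) : k :=
  LinearMap.trace k _ (Algebra.lsmul k k (simpleModule k μ) (MonoidAlgebra.of k _ g))

variable [CharZero k]

/-- Regrouping of a finite family of labels by their values. -/
theorem exists_sigma_equiv {n : ℕ} {L T : Type*} [DecidableEq T] {ν : L → T}
    (hν : Function.Injective ν) {c : L → ℕ} {τ : Fin n → T}
    (hc : ∀ l, (Finset.univ.filter fun j => τ j = ν l).card = c l)
    (hτ : ∀ j, τ j ∈ Set.range ν) :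
    ∃ e : (Σ l, Fin (c l)) ≃ Fin n, ∀ p, τ (e p) = ν p.1 := by
  let e₁ : (Σ l, Fin (c l)) ≃ Σ l, {j // τ j = ν l} := Equiv.sigmaCongrRight fun l =>
    (Fintype.equivFinOfCardEq (by rw [Fintype.card_subtype, hc])).symm
  let e₂ : (Σ l, {j // τ j = ν l}) ≃ Fin n := Equiv.ofBijective (fun p => p.2.1) <| by
    constructor
    · rintro ⟨l, j, hj⟩ ⟨l', j', hj'⟩ h
      obtain rfl : j = j' := h
      obtain rfl : l = l' := hν (hj.symm.trans hj')
      rfl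
    · intro j
      obtain ⟨l, hl⟩ := hτ j
      exact ⟨⟨l, j, hl.symm⟩, rfl⟩
  exact ⟨e₁.trans e₂, fun p => (e₁ p).2.2⟩

variable {V : Type*} [AddCommGroup V] [Module k V] [Module.Finite k V]
  (ρ : Representation k (SymProd d) V) {L : Type*} {ν : L → ∀ i, PartitionOf (d i)}
  (hν : Function.Injective ν) {c : L → ℕ} (hc : ∀ l, multiplicity k (ν l) ρ.asModule = c l)
  (h0 : ∀ μ ∉ Set.range ν, multiplicity k μ ρ.asModule = 0)

include hν hc h0

/-- `L` may be infinite; finiteness of the family with multiplicities is part of the conclusion. -/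
theorem exists_equiv_pi_sigma :
    (∃ n, Nonempty ((Σ l, Fin (c l)) ≃ Fin n)) ∧ Nonempty (ρ.asModule
      ≃ₗ[MonoidAlgebra k (SymProd d)] ∀ p : (Σ l, Fin (c l)), simpleModule k (ν p.1)) := by
  classical
  obtain ⟨n, τ, ⟨E⟩, hmult⟩ := exists_equiv_pi_simpleModule (k := k) (d := d) ρ.asModule
  have hτ : ∀ j, τ j ∈ Set.range ν := by
    intro j
    by_contra hj
    have h1 := hmult (τ j)
    rw [h0 _ hj] at h1
    exact Finset.card_ne_zero.mpr ⟨j, by simp⟩ h1.symm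
  obtain ⟨e, he⟩ := exists_sigma_equiv hν (c := c) (τ := τ)
    (fun l => by rw [← hc, hmult]) hτ
  refine ⟨⟨n, ⟨e⟩⟩, ⟨?_⟩⟩
  have h1 : ∀ p : (Σ l, Fin (c l)), simpleModule k (τ (e p)) = simpleModule k (ν p.1) :=
    fun p => by rw [he]
  exact E.trans ((LinearEquiv.piCongrLeft _ (fun j => simpleModule k (τ j)) e).symm.trans
    (LinearEquiv.piCongrRight fun p => LinearEquiv.ofEq _ _ (h1 p)))

theorem nonempty_equiv_directSum : Nonempty (ρ.Equiv
    (Representation.directSum fun p : (Σ l, Fin (c l)) => irr k (ν p.1))) := by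
  classical
  obtain ⟨⟨n, ⟨e⟩⟩, ⟨E⟩⟩ := exists_equiv_pi_sigma ρ hν hc h0
  have : Fintype (Σ l, Fin (c l)) := Fintype.ofEquiv _ e.symm
  let F : ∀ p : (Σ l, Fin (c l)), simpleModule k (ν p.1)
      ≃ₗ[MonoidAlgebra k (SymProd d)] (irr k (ν p.1)).asModule :=
    fun p => (nonempty_youngIdeal_equiv_irr _).some
  let E' : ρ.asModule ≃ₗ[MonoidAlgebra k (SymProd d)]
      ∀ p : (Σ l, Fin (c l)), (irr k (ν p.1)).asModule := E.trans (LinearEquiv.piCongrRight F)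
  let E'' : V ≃ₗ[k] ∀ p : (Σ l, Fin (c l)), IrrSpace k (ν p.1) :=
    ρ.asModuleEquiv.symm.trans ((E'.restrictScalars k).trans
      (LinearEquiv.piCongrRight fun p => (irr k (ν p.1)).asModuleEquiv))
  have hE : ∀ g x p, E'' (ρ g x) p = irr k (ν p.1) g (E'' x p) := by
    intro g x p
    change (irr k (ν p.1)).asModuleEquiv (E' (ρ.asModuleEquiv.symm (ρ g x)) p) = _
    rw [Representation.asModuleEquiv_symm_map_rho, E'.map_smul, Pi.smul_apply,
      Representation.asModuleEquiv_map_smul, Representation.asAlgebraHom_of]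
    rfl
  refine ⟨Representation.Equiv.mk
    (E''.trans (DirectSum.linearEquivFunOnFintype k _ _).symm) fun g => ?_⟩
  ext x : 1
  apply (DirectSum.linearEquivFunOnFintype k (Σ l, Fin (c l))
    fun p => IrrSpace k (ν p.1)).injective
  funext p
  change E'' (ρ g x) p = irr k (ν p.1) g (E'' x p)
  exact hE g x p

theorem character_eq_sum [Fintype L] (g : SymProd d) :
    ρ.character g = ∑ l, (c l : k) * simpleCharacter k (ν l) g := by
  classical
  obtain ⟨-, ⟨E⟩⟩ := exists_equiv_pi_sigma ρ hν hc h0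
  have h1 : ρ.character g =
      LinearMap.trace k _ (Algebra.lsmul k k ρ.asModule (MonoidAlgebra.of k _ g)) := by
    have h2 : Algebra.lsmul k k ρ.asModule (MonoidAlgebra.of k _ g) = ρ g := by
      ext x
      exact LinearMap.congr_fun (Representation.asAlgebraHom_of ρ g) x
    rw [h2]
    rfl
  have h3 := trace_pi (k := k) (fun p : (Σ l, Fin (c l)) => simpleModule k (ν p.1))
    ((E.restrictScalars k).conj (Algebra.lsmul k k ρ.asModule (MonoidAlgebra.of k _ g)))
    (fun p => Algebra.lsmul k k (simpleModule k (ν p.1)) (MonoidAlgebra.of k _ g)) ?_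
  · rw [h1, ← LinearMap.trace_conj' _ (E.restrictScalars k), h3, Fintype.sum_sigma]
    refine Finset.sum_congr rfl fun l _ => ?_
    change ∑ _y : Fin (c l), simpleCharacter k (ν l) g = _
    rw [Finset.sum_const, Finset.card_univ, Fintype.card_fin, nsmul_eq_mul]
  · intro x p
    rw [LinearEquiv.conj_apply_apply]
    change E (MonoidAlgebra.of k _ g • E.symm x) p = _
    rw [E.map_smul, E.apply_symm_apply]
    rfl

end Decomposition


/-! ## Finitely generated modules -/

section FinitelyGenerated

/-- The injection given by the `i`-th component of a morphism of `FI^m`. -/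
def FIm.app {m : ℕ} {S T : FIm m} (f : S ⟶ T) (i : Fin m) : (S i).carrier ↪ (T i).carrier := f i

theorem FIm.hom_ext {m : ℕ} {S T : FIm m} {f g : S ⟶ T}
    (h : ∀ i s, FIm.app f i s = FIm.app g i s) : f = g :=
  funext fun i => Function.Embedding.ext (h i)

variable {k : Type u} [Field k] {m : ℕ} {V : FImModule.{u, v} k m}
  {G : Set (Σ S : FIm m, V.obj S)}

variable (V G) in
/-- The elements of `V_S` obtained from elements of `G` by the morphisms of `FI^m`. -/
def translates (S : FIm m) : Set (V.obj S) :=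
  {y | ∃ x ∈ G, ∃ f : x.1 ⟶ S, (V.map f).hom x.2 = y}

/-- The spans of the translates form a submodule containing `G`. Identities about V_d may then be
checked on images of generators under injections. -/
theorem span_translates_eq_top
    (hG : ∀ W : ∀ S : FIm m, Submodule k (V.obj S), IsSubmodule V W →
      (∀ x ∈ G, x.2 ∈ W x.1) → ∀ S, W S = ⊤) (S : FIm m) :
    Submodule.span k (translates V G S) = ⊤ := by
  refine hG (fun S => Submodule.span k (translates V G S)) ?_ ?_ S
  · intro S T f
    suffices h : Submodule.span k (translates V G S) ≤
        (Submodule.span k (translates V G T)).comap (V.map f).hom from fun x hx => h hx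
    rw [Submodule.span_le]
    rintro _ ⟨x, hx, g, rfl⟩
    exact Submodule.subset_span ⟨x, hx, g ≫ f, by rw [V.map_comp]; rfl⟩
  · intro x hx
    exact Submodule.subset_span ⟨x, hx, 𝟙 _, by rw [V.map_id]; rfl⟩

instance (S T : FIm m) : Finite (S ⟶ T) := by
  have := fun i => (S i).finite
  have := fun i => (T i).finite
  exact inferInstanceAs (Finite (∀ i, (S i).carrier ↪ (T i).carrier))

theorem translates_finite (hG : G.Finite) (S : FIm m) : (translates V G S).Finite := by
  have h : translates V G S ⊆ ⋃ x ∈ G, Set.range fun f : x.1 ⟶ S => (V.map f).hom x.2 := by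
    rintro _ ⟨x, hx, f, rfl⟩
    simp only [Set.mem_iUnion]
    exact ⟨x, hx, f, rfl⟩
  exact (hG.biUnion fun x _ => Set.finite_range _).subset h

theorem finite_obj (hV : IsFinitelyGenerated V) (S : FIm m) : Module.Finite k (V.obj S) := by
  obtain ⟨G, hG, h⟩ := hV
  exact ⟨⟨(translates_finite hG S).toFinset, by
    rw [Set.Finite.coe_toFinset, span_translates_eq_top h]⟩⟩

theorem exists_card_bound (hG : G.Finite) :
    ∃ a : ℕ, ∀ x ∈ G, ∀ i, Nat.card (x.1 i).carrier ≤ a := by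
  obtain ⟨a, ha⟩ := (hG.image fun x => ∑ i, Nat.card (x.1 i).carrier).bddAbove
  refine ⟨a, fun x hx i => le_trans ?_ (ha ⟨x, hx, rfl⟩)⟩
  exact Finset.single_le_sum (f := fun i => Nat.card (x.1 i).carrier) (fun _ _ => Nat.zero_le _)
    (Finset.mem_univ i)

theorem degRep_map {d : Fin m → ℕ} (g : SymProd d) {S : FIm m} (f : S ⟶ FIm.std d) (x : V.obj S) :
    degRep V d g ((V.map f).hom x) = (V.map (f ≫ g.toHom)).hom x := by
  rw [V.map_comp]; rfl

theorem inComponent_apply_of_ne {d : Fin m → ℕ} {i j : Fin m} (h : j ≠ i)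
    (τ : Equiv.Perm (Fin (d i))) : inComponent i τ j = 1 :=
  Function.update_of_ne h _ _

theorem inComponent_apply_self {d : Fin m → ℕ} {i : Fin m} (τ : Equiv.Perm (Fin (d i))) :
    inComponent i τ i = τ :=
  Function.update_self _ _ _

variable [CharZero k]

/-- A column sum kills the elements coming from small sets, if there are few columns. -/
theorem colSum_map_eq_zero {d : Fin m → ℕ} {f : ∀ i, Fin (d i) → ℕ} {i : Fin m} {r : ℕ}
    (hf : ∀ x, f i x < r) {S : FIm m} (hS : Nat.card (S i).carrier + r < d i)
    (φ : S ⟶ FIm.std d) (x : V.obj S) :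
    (degRep V d).asAlgebraHom (colSum k f) ((V.map φ).hom x) = 0 := by
  classical
  have := (S i).finite
  have := Fintype.ofFinite (S i).carrier
  let φi : (S i).carrier ↪ Fin (d i) := FIm.app φ i
  let im : Finset (Fin (d i)) := Finset.univ.map φi
  have him : im.card = Nat.card (S i).carrier := by
    rw [Finset.card_map φi, Finset.card_univ, Nat.card_eq_fintype_card]
  -- More points lie outside the image of `φ` than `f` has values, so two of them share a value.
  have h1 : (Finset.range r).card < imᶜ.card := by
    rw [Finset.card_range, Finset.card_compl, Fintype.card_fin, him]; omega
  obtain ⟨y, hy, z, hz, hyz, hfyz⟩ := Finset.exists_ne_map_eq_of_card_lt_of_maps_to h1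
    (f := f i) (fun x _ => by simpa using hf x)
  have h2 : φ ≫ SymProd.toHom (inComponent i (Equiv.swap y z)) = φ := by
    refine FIm.hom_ext fun j s => ?_
    change inComponent i (Equiv.swap y z) j (FIm.app φ j s) = FIm.app φ j s
    by_cases hj : j = i
    · subst hj
      rw [inComponent_apply_self]
      have hs : FIm.app φ j s ∈ im := Finset.mem_map_of_mem φi (Finset.mem_univ s)
      refine Equiv.swap_apply_of_ne_of_ne ?_ ?_
      · intro h; exact Finset.mem_compl.mp hy (h ▸ hs)
      · intro h; exact Finset.mem_compl.mp hz (h ▸ hs)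
    · rw [inComponent_apply_of_ne hj]; rfl
  set w := (V.map φ).hom x with hw
  have h3 : degRep V d (inComponent i (Equiv.swap y z)) w = w := by
    rw [hw, degRep_map, h2]
  -- The transposition fixes `w` but multiplies the column sum by -1.
  have h4 : (degRep V d).asAlgebraHom (colSum k f) w =
      -(degRep V d).asAlgebraHom (colSum k f) w := by
    conv_lhs => rw [← h3, ← Representation.asAlgebraHom_of, ← Module.End.mul_apply, ← map_mul,
      colSum_mul_of (swap_mem_stab hfyz), sgn_inComponent, Equiv.Perm.sign_swap hyz]
    simp
  have h5 : (2 : k) • (degRep V d).asAlgebraHom (colSum k f) w = 0 := by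
    rw [two_smul]; nth_rewrite 1 [h4]; simp
  exact (smul_eq_zero.mp h5).resolve_left two_ne_zero

theorem multiplicity_eq_rank {d : Fin m → ℕ} {W : Type*} [AddCommGroup W] [Module k W]
    [Module.Finite k W] (ρ : Representation k (SymProd d) W) {μ : ∀ i, PartitionOf (d i)}
    (t : ∀ i, Tableau (μ i)) : multiplicity k μ ρ.asModule = Module.finrank k
      (LinearMap.range (ρ.asAlgebraHom (rowSum k (rows t) * colSum k (cols t)))) := by
  rw [multiplicity, rankOf_young_eq _ t, ← rankOf_rowSum_mul_colSum]
  rfl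

theorem col_lt_rowLen_zero {n : ℕ} {μ : PartitionOf n} (t : Tableau μ) (x : Fin n) :
    (t x).1.2 < μ.1.rowLen 0 :=
  (YoungDiagram.mem_iff_lt_rowLen.mp (t x).2).trans_le (μ.1.rowLen_anti 0 _ (Nat.zero_le _))

/-- A tableau has as many columns as its first row has cells; if these are fewer than d_i - a, the
column sum kills all translates. Equivalently, a constituent has at most `a` cells below its first
row. -/
theorem le_of_multiplicity_ne_zero
    (hG : ∀ W : ∀ S : FIm m, Submodule k (V.obj S), IsSubmodule V W →
      (∀ x ∈ G, x.2 ∈ W x.1) → ∀ S, W S = ⊤)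
    {a : ℕ} (ha : ∀ x ∈ G, ∀ i, Nat.card (x.1 i).carrier ≤ a) {d : Fin m → ℕ}
    [Module.Finite k (deg V d)] {μ : ∀ i, PartitionOf (d i)}
    (hμ : multiplicity k μ (degRep V d).asModule ≠ 0) (i : Fin m) :
    d i ≤ a + (μ i).1.rowLen 0 := by
  by_contra! hlt
  apply hμ
  let t := fun i => someTableau (μ i)
  rw [multiplicity_eq_rank _ t]
  suffices h : (degRep V d).asAlgebraHom (colSum k (cols t)) = 0 by
    rw [map_mul, h, mul_zero, LinearMap.range_zero, finrank_bot]
  refine LinearMap.ext_on (span_translates_eq_top hG (FIm.std d)) ?_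
  rintro _ ⟨x, hx, f, rfl⟩
  rw [LinearMap.zero_apply]
  exact colSum_map_eq_zero (r := (μ i).1.rowLen 0) (fun y => col_lt_rowLen_zero (t i) y)
    (by have := ha x hx i; omega) f x.2

end FinitelyGenerated


/-! ## Padded partitions -/

section Pad

theorem mem_pad {μ : YoungDiagram} {n : ℕ} {h : μ.card + μ.rowLen 0 ≤ n} {c : ℕ × ℕ} :
    c ∈ (pad μ n h).1 ↔ (c.1 = 0 ∧ c.2 < n - μ.card) ∨ ∃ i, c.1 = i + 1 ∧ (i, c.2) ∈ μ :=
  mem_addRowCells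

theorem rowLen_eq_of_mem_iff {μ : YoungDiagram} {i r : ℕ} (h : ∀ j, (i, j) ∈ μ ↔ j < r) :
    μ.rowLen i = r := by
  refine eq_of_forall_lt_iff fun j => ?_
  rw [← YoungDiagram.mem_iff_lt_rowLen, h]

theorem rowLen_pad_zero {μ : YoungDiagram} {n : ℕ} (h : μ.card + μ.rowLen 0 ≤ n) :
    (pad μ n h).1.rowLen 0 = n - μ.card :=
  rowLen_eq_of_mem_iff fun j => by simp [mem_pad]

theorem rowLen_pad_succ {μ : YoungDiagram} {n : ℕ} (h : μ.card + μ.rowLen 0 ≤ n) (i : ℕ) :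
    (pad μ n h).1.rowLen (i + 1) = μ.rowLen i :=
  rowLen_eq_of_mem_iff fun j => by rw [mem_pad]; simp [YoungDiagram.mem_iff_lt_rowLen]

theorem pad_injective {μ ν : YoungDiagram} {n : ℕ} {h : μ.card + μ.rowLen 0 ≤ n}
    {h' : ν.card + ν.rowLen 0 ≤ n} (heq : pad μ n h = pad ν n h') : μ = ν :=
  eq_of_rowLen_eq fun i => by rw [← rowLen_pad_succ h, heq, rowLen_pad_succ]

/-- The cells of a diagram below the first row, moved up by one. -/
def tailCells (μ : YoungDiagram) : Finset (ℕ × ℕ) :=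
  μ.cells.preimage (fun c => (c.1 + 1, c.2)) (Function.Injective.injOn (by
    rintro ⟨a, b⟩ ⟨c, d⟩ h
    simpa using h))

theorem mem_tailCells {μ : YoungDiagram} {c : ℕ × ℕ} :
    c ∈ tailCells μ ↔ (c.1 + 1, c.2) ∈ μ := by
  rw [tailCells, Finset.mem_preimage, YoungDiagram.mem_cells]

/-- The diagram obtained by removing the first row. -/
def tail (μ : YoungDiagram) : YoungDiagram where
  cells := tailCells μ
  isLowerSet := by
    rintro ⟨a, b⟩ ⟨a', b'⟩ ⟨ha, hb⟩ hc
    rw [Finset.mem_coe, mem_tailCells] at hc ⊢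
    exact μ.up_left_mem (Nat.succ_le_succ ha) hb hc

theorem mem_tail {μ : YoungDiagram} {i j : ℕ} : (i, j) ∈ tail μ ↔ (i + 1, j) ∈ μ :=
  mem_tailCells

theorem rowLen_tail (μ : YoungDiagram) (i : ℕ) : (tail μ).rowLen i = μ.rowLen (i + 1) :=
  rowLen_eq_of_mem_iff fun j => by rw [mem_tail, YoungDiagram.mem_iff_lt_rowLen]

theorem card_tail_add (μ : YoungDiagram) : (tail μ).card + μ.rowLen 0 = μ.card := by
  have h : μ.cells = addRowCells (tail μ) (μ.rowLen 0) := by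
    ext ⟨a, b⟩
    rw [mem_addRowCells, YoungDiagram.mem_cells, YoungDiagram.mem_iff_lt_rowLen]
    rcases a with _ | a
    · simp
    · rw [← YoungDiagram.mem_iff_lt_rowLen, ← mem_tail]; simp
  rw [add_comm, ← card_addRowCells, ← h]

theorem canPad_tail {n : ℕ} (μ : PartitionOf n) : (tail μ.1).card + (tail μ.1).rowLen 0 ≤ n := by
  have h := card_tail_add μ.1
  have h1 := μ.1.rowLen_anti 0 1 zero_le_one
  rw [rowLen_tail, zero_add]
  have h2 : μ.1.card = n := μ.2
  omega

/-- Every partition of `n` is a padded one, so the padded lists exhaust the irreducible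
representations. -/
theorem pad_tail {n : ℕ} (μ : PartitionOf n) : pad (tail μ.1) n (canPad_tail μ) = μ := by
  refine Subtype.ext (eq_of_rowLen_eq fun i => ?_)
  rcases i with _ | i
  · rw [rowLen_pad_zero]
    have h := card_tail_add μ.1
    have h2 : μ.1.card = n := μ.2
    omega
  · rw [rowLen_pad_succ, rowLen_tail]

theorem finite_card_le (a : ℕ) : {μ : YoungDiagram | μ.card ≤ a}.Finite := by
  have h : ∀ μ ∈ {μ : YoungDiagram | μ.card ≤ a},
      μ.cells ∈ (Finset.range a ×ˢ Finset.range a).powerset := by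
    intro μ (hμ : μ.card ≤ a)
    rw [Finset.mem_powerset]
    rintro ⟨i, j⟩ hij
    have h1 : j < μ.rowLen 0 := YoungDiagram.mem_iff_lt_rowLen.mp
      (μ.up_left_mem (Nat.zero_le i) le_rfl hij)
    have h2 : i < μ.colLen 0 := YoungDiagram.mem_iff_lt_colLen.mp
      (μ.up_left_mem le_rfl (Nat.zero_le j) hij)
    rw [YoungDiagram.rowLen_eq_card] at h1
    rw [YoungDiagram.colLen_eq_card] at h2
    have h3 : (μ.row 0).card ≤ μ.card := Finset.card_le_card (Finset.filter_subset _ _)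
    have h4 : (μ.col 0).card ≤ μ.card := Finset.card_le_card (Finset.filter_subset _ _)
    simp only [Finset.mem_product, Finset.mem_range]
    omega
  refine Set.Finite.of_finite_image (f := YoungDiagram.cells) ?_ ?_
  · refine (Finset.finite_toSet (Finset.range a ×ˢ Finset.range a).powerset).subset ?_
    rintro _ ⟨μ, hμ, rfl⟩
    exact h μ hμ
  · intro μ _ ν _ h
    exact YoungDiagram.ext h

variable {m : ℕ}

theorem finite_list_card_le (a : ℕ) : {lam : Fin m → YoungDiagram | ∀ i, (lam i).card ≤ a}.Finite := by
  have := Set.Finite.pi' (fun _ : Fin m => finite_card_le a)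
  exact this

theorem padList_injective {lam lam' : Fin m → YoungDiagram} {d : Fin m → ℕ} {h : CanPad lam d}
    {h' : CanPad lam' d} (heq : padList lam d h = padList lam' d h') : lam = lam' :=
  funext fun i => pad_injective (congrFun heq i)

theorem canPad_tails {d : Fin m → ℕ} (μ : ∀ i, PartitionOf (d i)) :
    CanPad (fun i => tail (μ i).1) d := fun i => canPad_tail (μ i)

theorem padList_tails {d : Fin m → ℕ} (μ : ∀ i, PartitionOf (d i)) :
    padList (fun i => tail (μ i).1) d (canPad_tails μ) = μ :=
  funext fun i => pad_tail (μ i)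

end Pad

/-! ## Coherent tableaux of padded shape -/

section PadTableau

/-- The least size to which `μ` can be padded. -/
abbrev minPad (μ : YoungDiagram) : ℕ := μ.card + μ.rowLen 0

/-- The cell of `x` in the standard tableau of shape `μ[n]`; it does not depend on `n`. -/
def padCell (μ : YoungDiagram) (x : ℕ) : ℕ × ℕ :=
  -- The smallest padded shape has two equal top rows, of length `μ.rowLen 0`, and is filled
  -- arbitrarily. Every later entry extends the top row by a column with a single cell.
  if h : x < minPad μ then (someTableau (pad μ (minPad μ) le_rfl) ⟨x, h⟩).1
  else (0, μ.rowLen 0 + (x - minPad μ))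

theorem padCell_of_le {μ : YoungDiagram} {x : ℕ} (h : minPad μ ≤ x) :
    padCell μ x = (0, μ.rowLen 0 + (x - minPad μ)) := dif_neg h.not_gt

theorem padCell_snd_lt {μ : YoungDiagram} {x : ℕ} (h : x < minPad μ) :
    (padCell μ x).2 < μ.rowLen 0 := by
  rw [padCell, dif_pos h]
  refine (col_lt_rowLen_zero _ _).trans_eq ?_
  rw [rowLen_pad_zero]
  exact Nat.add_sub_cancel_left _ _

theorem padCell_injective (μ : YoungDiagram) : Function.Injective (padCell μ) := by
  intro x y hxy
  rcases lt_or_ge x (minPad μ) with hx | hx <;> rcases lt_or_ge y (minPad μ) with hy | hy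
  · rw [padCell, padCell, dif_pos hx, dif_pos hy] at hxy
    have := (someTableau (pad μ (minPad μ) le_rfl)).injective (Subtype.ext hxy)
    exact Fin.mk.inj this
  · have h1 := padCell_snd_lt hx
    rw [hxy, padCell_of_le hy] at h1
    simp at h1
  · have h1 := padCell_snd_lt hy
    rw [← hxy, padCell_of_le hx] at h1
    simp at h1
  · rw [padCell_of_le hx, padCell_of_le hy] at hxy
    have := (Prod.mk.inj hxy).2
    omega

theorem padCell_mem {μ : YoungDiagram} {n : ℕ} (h : μ.card + μ.rowLen 0 ≤ n) {x : ℕ}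
    (hx : x < n) : padCell μ x ∈ (pad μ n h).1.cells := by
  rw [YoungDiagram.mem_cells, mem_pad]
  rcases lt_or_ge x (minPad μ) with hx | hx
  · rw [padCell, dif_pos hx]
    rcases mem_pad.mp (someTableau (pad μ (minPad μ) le_rfl) ⟨x, hx⟩).2 with h1 | h1
    · exact Or.inl ⟨h1.1, h1.2.trans_le (Nat.sub_le_sub_right h _)⟩
    · exact Or.inr h1
  · rw [padCell_of_le hx]
    left
    simp only [minPad] at hx ⊢
    exact ⟨trivial, by omega⟩

/-- The standard tableau of shape `μ[n]`. -/
def padTableau (μ : YoungDiagram) (n : ℕ) (h : μ.card + μ.rowLen 0 ≤ n) : Tableau (pad μ n h) :=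
  Equiv.ofBijective (fun x => ⟨padCell μ x, padCell_mem h x.2⟩) <| by
    rw [Fintype.bijective_iff_injective_and_card]
    refine ⟨fun x y hxy => Fin.ext (padCell_injective μ (congrArg Subtype.val hxy)), ?_⟩
    rw [Fintype.card_fin, Fintype.card_coe]
    exact (pad μ n h).2.symm

/-- An entry beyond `minPad μ` is alone in its column. This keeps the column group independent of
the padding. -/
theorem padCell_snd_eq_of_le {μ : YoungDiagram} {x y : ℕ} (hx : minPad μ ≤ x)
    (h : (padCell μ y).2 = (padCell μ x).2) : y = x := by
  rw [padCell_of_le hx] at h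
  rcases lt_or_ge y (minPad μ) with hy | hy
  · have := padCell_snd_lt hy
    simp only at h
    omega
  · rw [padCell_of_le hy] at h
    simp only at h
    omega

end PadTableau


/-! ## Stability of multiplicities -/

section Stability

variable {m : ℕ} {d d' : Fin m → ℕ}

/-- The row function of the standard tableaux of padded shape. -/
def padRow (lam : Fin m → YoungDiagram) (d : Fin m → ℕ) : ∀ i, Fin (d i) → ℕ :=
  fun i x => (padCell (lam i) x).1

/-- The column function of the standard tableaux of padded shape. -/
def padCol (lam : Fin m → YoungDiagram) (d : Fin m → ℕ) : ∀ i, Fin (d i) → ℕ :=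
  fun i x => (padCell (lam i) x).2

/-- The standard tableaux of shape `lam[d]`. -/
def padTableaux (lam : Fin m → YoungDiagram) (d : Fin m → ℕ) (h : CanPad lam d) :
    ∀ i, Tableau (padList lam d h i) := fun i => padTableau (lam i) (d i) (h i)

theorem rows_padTableaux (lam : Fin m → YoungDiagram) (d : Fin m → ℕ) (h : CanPad lam d) :
    rows (padTableaux lam d h) = padRow lam d := rfl

theorem cols_padTableaux (lam : Fin m → YoungDiagram) (d : Fin m → ℕ) (h : CanPad lam d) :
    cols (padTableaux lam d h) = padCol lam d := rfl

/-- The inclusion `[d] ⟶ [d']` in `FI^m`. -/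
def FIm.incl (h : ∀ i, d i ≤ d' i) : FIm.std d ⟶ FIm.std d' :=
  fun i => (Fin.castLEEmb (h i) : Fin (d i) ↪ Fin (d' i))

/-- Extension of permutations by the identity. -/
def extend (h : ∀ i, d i ≤ d' i) (g : SymProd d) : SymProd d' :=
  fun i => (g i).viaEmbedding (Fin.castLEEmb (h i))

theorem extend_castLE (h : ∀ i, d i ≤ d' i) (g : SymProd d) (i : Fin m) (x : Fin (d i)) :
    extend h g i (Fin.castLE (h i) x) = Fin.castLE (h i) (g i x) :=
  Equiv.Perm.viaEmbedding_apply _ _ _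

theorem extend_of_le (h : ∀ i, d i ≤ d' i) (g : SymProd d) (i : Fin m) {x : Fin (d' i)}
    (hx : d i ≤ x) : extend h g i x = x := by
  refine Equiv.Perm.viaEmbedding_apply_of_notMem _ _ _ ?_
  rintro ⟨y, rfl⟩
  have h1 : d i ≤ (y : ℕ) := hx
  exact absurd y.2 (by omega)

theorem sgn_extend (h : ∀ i, d i ≤ d' i) (g : SymProd d) : sgn (extend h g) = sgn g := by
  refine Finset.prod_congr rfl fun i _ => ?_
  refine Eq.trans (congrArg Equiv.Perm.sign ?_) (Equiv.Perm.sign_extendDomain (g i)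
    (Equiv.ofInjective _ (Fin.castLEEmb (h i)).injective))
  rw [extend, Equiv.Perm.viaEmbedding]
  congr!

theorem extend_injective (h : ∀ i, d i ≤ d' i) : Function.Injective (extend h) := by
  intro g g' hg
  funext i
  ext x
  have h1 := extend_castLE h g i x
  rw [hg, extend_castLE] at h1
  exact (congrArg (fun y : Fin (d' i) => (y : ℕ)) h1).symm

theorem toHom_comp_incl (h : ∀ i, d i ≤ d' i) (g : SymProd d) :
    g.toHom ≫ FIm.incl h = FIm.incl h ≫ (extend h g).toHom :=
  FIm.hom_ext fun i x => (extend_castLE h g i x).symm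

theorem extend_mem_stab_of_eq (h : ∀ i, d i ≤ d' i) {f : ∀ i, Fin (d i) → ℕ}
    {f' : ∀ i, Fin (d' i) → ℕ} (hf : ∀ i x, f' i (Fin.castLE (h i) x) = f i x) {g : SymProd d}
    (hg : g ∈ stab f) : extend h g ∈ stab f' := by
  rw [mem_stab] at hg ⊢
  intro i x
  rcases lt_or_ge (x : ℕ) (d i) with hx | hx
  · obtain ⟨y, rfl⟩ : ∃ y : Fin (d i), Fin.castLE (h i) y = x := ⟨⟨x, hx⟩, rfl⟩
    rw [extend_castLE, hf, hf, hg]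
  · rw [extend_of_le h g i hx]

theorem apply_eq_of_mem_stab_padCol {lam : Fin m → YoungDiagram} {q : SymProd d}
    (hq : q ∈ stab (padCol lam d)) {i : Fin m} {x : Fin (d i)} (hx : minPad (lam i) ≤ x) :
    q i x = x :=
  Fin.ext (padCell_snd_eq_of_le hx (mem_stab.mp hq i x))

/-- Column permutations for `d'` fix every point beyond `minPad`, hence restrict to [d]: the column
group does not grow. -/
theorem exists_extend_eq {lam : Fin m → YoungDiagram} (hd : CanPad lam d) (h : ∀ i, d i ≤ d' i)
    {q : SymProd d'} (hq : q ∈ stab (padCol lam d')) :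
    ∃ p ∈ stab (padCol lam d), extend h p = q := by
  have hlt : ∀ i (x : Fin (d' i)), (x : ℕ) < d i → (q i x : ℕ) < d i := by
    intro i x hx
    by_contra! hge
    have h1 := apply_eq_of_mem_stab_padCol hq (x := q i x) ((hd i).trans hge)
    have h2 := (q i).injective h1
    rw [h2] at hge
    omega
  let p : ∀ i, Fin (d i) → Fin (d i) := fun i x => ⟨q i (Fin.castLE (h i) x), hlt i _ x.2⟩
  have hp : ∀ i, Function.Injective (p i) := by
    intro i x y hxy
    have h1 : q i (Fin.castLE (h i) x) = q i (Fin.castLE (h i) y) := Fin.ext (Fin.mk.inj hxy)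
    exact Fin.castLE_injective (h i) ((q i).injective h1)
  have hbij : ∀ i, Function.Bijective (p i) := fun i =>
    ⟨hp i, Finite.surjective_of_injective (hp i)⟩
  refine ⟨fun i => Equiv.ofBijective (p i) (hbij i), ?_, ?_⟩
  · rw [mem_stab]
    intro i x
    exact mem_stab.mp hq i (Fin.castLE (h i) x)
  · funext i
    ext x : 1
    rcases lt_or_ge (x : ℕ) (d i) with hx | hx
    · obtain ⟨y, rfl⟩ : ∃ y : Fin (d i), Fin.castLE (h i) y = x := ⟨⟨x, hx⟩, rfl⟩
      rw [extend_castLE]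
      rfl
    · rw [extend_of_le h _ i hx, apply_eq_of_mem_stab_padCol hq ((hd i).trans hx)]

/-- Small subsets can be moved into small intervals by permutations fixing the initial points. -/
theorem exists_perm_lt {S : Type*} [Finite S] {n₀ n n' a : ℕ} (hS : Nat.card S ≤ a)
    (hn : n₀ + a ≤ n) (hn' : n ≤ n') (f : S → Fin n') :
    ∃ τ : Equiv.Perm (Fin n'), (∀ x : Fin n', (x : ℕ) < n₀ → τ x = x) ∧
      ∀ s, (τ (f s) : ℕ) < n := by
  classical
  have := Fintype.ofFinite S
  -- Only points from `n₀` on may move. At most `a` of them are values of `f`, and the interval from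
  -- `n₀` to `n` has room for `a` points.
  let α := {x : Fin n' // n₀ ≤ (x : ℕ)}
  let B : Finset α := Finset.univ.filter fun x => ∃ s, f s = x.1
  let C : Finset α := Finset.univ.filter fun x => (x.1 : ℕ) < n
  have hB : B.card ≤ a := by
    refine le_trans ?_ hS
    rw [Nat.card_eq_fintype_card, ← Finset.card_univ, ← Finset.card_map (Function.Embedding.subtype _)]
    refine le_trans (Finset.card_le_card (t := Finset.univ.image f) ?_) Finset.card_image_le
    intro x hx
    obtain ⟨y, hy, rfl⟩ := Finset.mem_map.mp hx
    obtain ⟨s, hs⟩ := (Finset.mem_filter.mp hy).2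
    exact Finset.mem_image.mpr ⟨s, Finset.mem_univ s, hs⟩
  have hC : a ≤ C.card := by
    have h1 : (Finset.univ : Finset (Fin a)).card ≤ C.card := by
      refine Finset.card_le_card_of_injOn
        (fun j => (⟨⟨n₀ + j, by omega⟩, Nat.le_add_right _ _⟩ : α)) ?_ ?_
      · intro j _
        rw [Finset.mem_coe, Finset.mem_filter]
        refine ⟨Finset.mem_univ _, ?_⟩
        change n₀ + (j : ℕ) < n
        omega
      · intro j _ j' _ hjj
        have := Fin.mk.inj (Subtype.mk.inj hjj)
        exact Fin.ext (by omega)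
    simpa using h1
  obtain ⟨C', hC', hcard⟩ := Finset.exists_subset_card_eq (hB.trans hC)
  let e : {x // x ∈ B} ≃ {x // x ∈ C'} := Finset.equivOfCardEq hcard.symm
  let σ : Equiv.Perm α := e.extendSubtype
  refine ⟨Equiv.Perm.ofSubtype σ, fun x hx => ?_, fun s => ?_⟩
  · exact Equiv.Perm.ofSubtype_apply_of_not_mem _ (by omega)
  · rcases lt_or_ge (f s : ℕ) n₀ with hs | hs
    · rw [Equiv.Perm.ofSubtype_apply_of_not_mem _ (by omega)]
      omega
    · have h0 : Equiv.Perm.ofSubtype σ (f s) = σ ⟨f s, hs⟩ :=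
        Equiv.Perm.ofSubtype_apply_of_mem (p := fun x : Fin n' => n₀ ≤ (x : ℕ)) σ hs
      rw [h0]
      have h1 : σ ⟨f s, hs⟩ ∈ C' := e.extendSubtype_mem _ (Finset.mem_filter.mpr
        ⟨Finset.mem_univ _, s, rfl⟩)
      exact (Finset.mem_filter.mp (hC' h1)).2

variable {k : Type u} [Field k] {V : FImModule.{u, v} k m}

theorem map_incl_degRep (h : ∀ i, d i ≤ d' i) (g : SymProd d) (y : deg V d) :
    (V.map (FIm.incl h)).hom (degRep V d g y) =
      degRep V d' (extend h g) ((V.map (FIm.incl h)).hom y) := by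
  rw [degRep_map, ← toHom_comp_incl, V.map_comp]
  rfl

theorem map_incl_colSum {lam : Fin m → YoungDiagram} (hd : CanPad lam d) (h : ∀ i, d i ≤ d' i)
    (y : deg V d) :
    (V.map (FIm.incl h)).hom ((degRep V d).asAlgebraHom (colSum k (padCol lam d)) y) =
      (degRep V d').asAlgebraHom (colSum k (padCol lam d')) ((V.map (FIm.incl h)).hom y) := by
  rw [colSum, colSum, map_sum, map_sum, LinearMap.sum_apply, LinearMap.sum_apply, map_sum]
  refine Finset.sum_bij (fun g _ => extend h g) ?_ ?_ ?_ ?_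
  · exact fun g hg => extend_mem_stab_of_eq h (fun _ _ => rfl) hg
  · exact fun g _ g' _ hgg => extend_injective h hgg
  · intro q hq
    obtain ⟨p, hp, hpq⟩ := exists_extend_eq hd h hq
    exact ⟨p, hp, hpq⟩
  · intro g _
    rw [sgn_extend, map_smul, map_smul, LinearMap.smul_apply, LinearMap.smul_apply, map_smul,
      Representation.asAlgebraHom_of, Representation.asAlgebraHom_of, map_incl_degRep]

/-- The row group of `d` extends into that of `d'`, so the larger row sum absorbs each term of the
smaller one. -/
theorem rowSum_map_incl {lam : Fin m → YoungDiagram} (h : ∀ i, d i ≤ d' i) (y : deg V d) :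
    (degRep V d').asAlgebraHom (rowSum k (padRow lam d')) ((V.map (FIm.incl h)).hom
      ((degRep V d).asAlgebraHom (rowSum k (padRow lam d)) y)) =
    ((stab (padRow lam d)).card : k) • (degRep V d').asAlgebraHom (rowSum k (padRow lam d'))
      ((V.map (FIm.incl h)).hom y) := by
  conv_lhs => enter [2, 2]; rw [rowSum]
  rw [map_sum, LinearMap.sum_apply, map_sum, map_sum, Nat.cast_smul_eq_nsmul, ← Finset.sum_const]
  refine Finset.sum_congr rfl fun g hg => ?_
  have hg' : extend h g ∈ stab (padRow lam d') := extend_mem_stab_of_eq h (fun _ _ => rfl) hg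
  rw [Representation.asAlgebraHom_of, map_incl_degRep, ← Representation.asAlgebraHom_of,
    ← Module.End.mul_apply, ← map_mul, rowSum_mul_of hg']

/-- Column permutations move only points below `minPad`, and `τ` moves only points above; the
supports are disjoint. -/
theorem of_mul_colSum_of_fixes {lam : Fin m → YoungDiagram} {τ : SymProd d}
    (hτ : ∀ i (x : Fin (d i)), (x : ℕ) < minPad (lam i) → τ i x = x) :
    MonoidAlgebra.of k _ τ * colSum k (padCol lam d) =
      colSum k (padCol lam d) * MonoidAlgebra.of k _ τ := by
  rw [colSum, Finset.mul_sum, Finset.sum_mul]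
  refine Finset.sum_congr rfl fun q hq => ?_
  rw [mul_smul_comm, smul_mul_assoc, ← map_mul, ← map_mul]
  congr 2
  funext i
  ext x : 1
  change τ i (q i x) = q i (τ i x)
  rcases lt_or_ge (x : ℕ) (minPad (lam i)) with hx | hx
  · rw [hτ i x hx]
    apply hτ
    by_contra! hge
    have h1 := apply_eq_of_mem_stab_padCol hq hge
    have h2 := (q i).injective h1
    rw [h2] at hge
    omega
  · have h1 : minPad (lam i) ≤ (τ i x : ℕ) := by
      by_contra! hlt
      have h2 := (τ i).injective (hτ i _ hlt)
      rw [h2] at hlt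
      omega
    rw [apply_eq_of_mem_stab_padCol hq hx, apply_eq_of_mem_stab_padCol hq h1]

theorem mem_stab_padRow_of_fixes {lam : Fin m → YoungDiagram} {τ : SymProd d}
    (hτ : ∀ i (x : Fin (d i)), (x : ℕ) < minPad (lam i) → τ i x = x) :
    τ ∈ stab (padRow lam d) := by
  rw [mem_stab]
  intro i x
  rcases lt_or_ge (x : ℕ) (minPad (lam i)) with hx | hx
  · rw [hτ i x hx]
  · have h1 : minPad (lam i) ≤ (τ i x : ℕ) := by
      by_contra! hlt
      have h2 := (τ i).injective (hτ i _ hlt)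
      rw [h2] at hlt
      omega
    change (padCell (lam i) (τ i x)).1 = (padCell (lam i) x).1
    rw [padCell_of_le hx, padCell_of_le h1]

variable [CharZero k] {G : Set (Σ S : FIm m, V.obj S)}

theorem card_stab_ne_zero (f : ∀ i, Fin (d i) → ℕ) : ((stab f).card : k) ≠ 0 :=
  Nat.cast_ne_zero.mpr (Finset.card_ne_zero.mpr ⟨1, one_mem_stab _⟩)

/-- With R, C and R', C' the row and column sums for `d` and `d'`, and ι the inclusion, each
translate v has a permutation τ of padding entries with τv = ιy, y in V_d. As τ commutes with C' and
is absorbed by R', R'C'v = R'C'ιy = R'ιCy, a scalar multiple of R'ιRCy. So R'ι maps the image of RC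
onto a space containing the image of R'C'. -/
theorem finrank_range_le {lam : Fin m → YoungDiagram} [Module.Finite k (deg V d)]
    (hG : ∀ W : ∀ S : FIm m, Submodule k (V.obj S), IsSubmodule V W →
      (∀ x ∈ G, x.2 ∈ W x.1) → ∀ S, W S = ⊤)
    {a : ℕ} (ha : ∀ x ∈ G, ∀ i, Nat.card (x.1 i).carrier ≤ a)
    (hd : ∀ i, minPad (lam i) + a ≤ d i) (h : ∀ i, d i ≤ d' i) :
    Module.finrank k (LinearMap.range ((degRep V d').asAlgebraHom
        (rowSum k (padRow lam d') * colSum k (padCol lam d')))) ≤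
      Module.finrank k (LinearMap.range ((degRep V d).asAlgebraHom
        (rowSum k (padRow lam d) * colSum k (padCol lam d)))) := by
  have hcan : CanPad lam d := fun i => le_trans (Nat.le_add_right _ _) (hd i)
  let φ : deg V d →ₗ[k] deg V d' :=
    (degRep V d').asAlgebraHom (rowSum k (padRow lam d')) ∘ₗ (V.map (FIm.incl h)).hom
  suffices hle : LinearMap.range ((degRep V d').asAlgebraHom
      (rowSum k (padRow lam d') * colSum k (padCol lam d'))) ≤
      (LinearMap.range ((degRep V d).asAlgebraHom
        (rowSum k (padRow lam d) * colSum k (padCol lam d)))).map φ by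
    exact (Submodule.finrank_mono hle).trans (Submodule.finrank_map_le _ _)
  rw [LinearMap.range_eq_map, ← span_translates_eq_top hG (FIm.std d'), Submodule.map_span,
    Submodule.span_le]
  rintro _ ⟨_, ⟨x, hx, f, rfl⟩, rfl⟩
  -- The `a` spare points in `hd` let the image of `f` be pushed into [d] without touching the
  -- entries below `minPad`.
  have hτ : ∀ i, ∃ τ : Equiv.Perm (Fin (d' i)),
      (∀ x : Fin (d' i), (x : ℕ) < minPad (lam i) → τ x = x) ∧
      ∀ s, (τ (FIm.app f i s) : ℕ) < d i := by
    intro i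
    have := (x.1 i).finite
    exact exists_perm_lt (ha x hx i) (hd i) (h i) (FIm.app f i)
  choose τ hτ1 hτ2 using hτ
  let f' : x.1 ⟶ FIm.std d := fun i => (⟨fun s => ⟨τ i (FIm.app f i s), hτ2 i s⟩, fun s s' hs =>
    (FIm.app f i).injective ((τ i).injective (Fin.ext (Fin.mk.inj hs)))⟩ :
      (x.1 i).carrier ↪ Fin (d i))
  have hf' : f' ≫ FIm.incl h = f ≫ SymProd.toHom τ := FIm.hom_ext fun i s => Fin.ext rfl
  set y := (V.map f').hom x.2 with hy
  have h1 : degRep V d' τ ((V.map f).hom x.2) = (V.map (FIm.incl h)).hom y := by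
    rw [degRep_map, ← hf', V.map_comp]
    rfl
  have h2 : (degRep V d').asAlgebraHom
      (rowSum k (padRow lam d') * colSum k (padCol lam d')) ((V.map f).hom x.2) =
      φ ((degRep V d).asAlgebraHom (colSum k (padCol lam d)) y) := by
    change _ = (degRep V d').asAlgebraHom (rowSum k (padRow lam d')) ((V.map (FIm.incl h)).hom _)
    rw [map_incl_colSum hcan, ← h1, ← Representation.asAlgebraHom_of, ← Module.End.mul_apply,
      ← Module.End.mul_apply, ← map_mul, ← map_mul, mul_assoc _ (colSum k _) (MonoidAlgebra.of k _ _),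
      ← of_mul_colSum_of_fixes hτ1, ← mul_assoc,
      rowSum_mul_of (mem_stab_padRow_of_fixes hτ1)]
  have h3 : φ ((degRep V d).asAlgebraHom (colSum k (padCol lam d)) y) =
      φ ((((stab (padRow lam d)).card : k))⁻¹ • (degRep V d).asAlgebraHom
        (rowSum k (padRow lam d) * colSum k (padCol lam d)) y) := by
    rw [map_smul, map_mul, Module.End.mul_apply]
    change _ = _ • (degRep V d').asAlgebraHom (rowSum k (padRow lam d'))
      ((V.map (FIm.incl h)).hom _)
    rw [rowSum_map_incl, smul_smul, inv_mul_cancel₀ (card_stab_ne_zero _), one_smul]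
    rfl
  rw [SetLike.mem_coe, h2, h3]
  exact Submodule.mem_map_of_mem (Submodule.smul_mem _ _ ⟨y, rfl⟩)

/-- The minimum over the indices above `D` is attained, and kept from there on. -/
theorem eventually_eq_of_antitone {ι : Type*} [Preorder ι] [IsDirectedOrder ι] {f : ι → ℕ} {D : ι}
    (hf : ∀ d d', D ≤ d → d ≤ d' → f d' ≤ f d) : ∃ c, ∀ᶠ d in atTop, f d = c := by
  obtain ⟨d₀, hd₀, h⟩ := Nat.sInf_mem (s := f '' Set.Ici D) ⟨f D, D, le_rfl, rfl⟩
  have : Nonempty ι := ⟨D⟩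
  refine ⟨sInf (f '' Set.Ici D), ?_⟩
  filter_upwards [eventually_ge_atTop d₀] with d hd
  refine le_antisymm ?_ (Nat.sInf_le ⟨d, le_trans hd₀ hd, rfl⟩)
  rw [← h]
  exact hf d₀ d hd₀ hd

/-- The multiplicities of the padded partitions stabilize. -/
theorem exists_stable_multiplicity (hV : IsFinitelyGenerated V) :
    ∃ c : (Fin m → YoungDiagram) →₀ ℕ, ∀ᶠ d : Fin m → ℕ in atTop,
      (∀ lam ∈ c.support, CanPad lam d) ∧
        ∀ lam (h : CanPad lam d), multiplicity k (padList lam d h) (degRep V d).asModule = c lam := by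
  classical
  have hfin := finite_obj hV
  obtain ⟨G, hGf, hG⟩ := hV
  obtain ⟨a, ha⟩ := exists_card_bound hGf
  have hstab : ∀ lam : Fin m → YoungDiagram, ∃ c : ℕ, ∀ᶠ d : Fin m → ℕ in atTop,
      Module.finrank k (LinearMap.range ((degRep V d).asAlgebraHom
        (rowSum k (padRow lam d) * colSum k (padCol lam d)))) = c := by
    intro lam
    refine eventually_eq_of_antitone (D := fun i => minPad (lam i) + a) fun d d' hd hdd => ?_
    have := hfin (FIm.std d)
    exact finrank_range_le hG ha hd hdd
  choose c hc using hstab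
  let F := (finite_list_card_le (m := m) a).toFinset
  -- Thresholds depend on `lam`, so a common one is taken only over the finite set `F`. Outside `F`
  -- some |lam_i| exceeds `a`, and the multiplicity vanishes for every `d` at which the padding is
  -- defined.
  refine ⟨Finsupp.onFinset F (fun lam => if lam ∈ F then c lam else 0) ?_, ?_⟩
  · intro lam h
    by_contra hF
    exact h (if_neg hF)
  · have h1 : ∀ᶠ d : Fin m → ℕ in atTop, ∀ lam ∈ F,
        Module.finrank k (LinearMap.range ((degRep V d).asAlgebraHom
          (rowSum k (padRow lam d) * colSum k (padCol lam d)))) = c lam :=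
      (Finset.eventually_all F).mpr fun lam _ => hc lam
    have h2 : ∀ᶠ d : Fin m → ℕ in atTop, ∀ lam ∈ F, CanPad lam d :=
      (Finset.eventually_all F).mpr fun lam _ => eventually_ge_atTop fun i => minPad (lam i)
    filter_upwards [h1, h2] with d hd1 hd2
    refine ⟨fun lam hlam => hd2 lam (Finsupp.support_onFinset_subset hlam), fun lam h => ?_⟩
    have := hfin (FIm.std d)
    rw [Finsupp.onFinset_apply]
    split_ifs with hF
    · rw [multiplicity_eq_rank _ (padTableaux lam d h), rows_padTableaux, cols_padTableaux,
        hd1 lam hF]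
    · by_contra hne
      refine hF ((Set.Finite.mem_toFinset _).mpr fun i => ?_)
      have h3 := le_of_multiplicity_ne_zero hG ha hne i
      have h4 : (padList lam d h i).1.rowLen 0 = d i - (lam i).card := rowLen_pad_zero (h i)
      have h5 := h i
      omega

theorem nonempty_equiv_stableSum {d : Fin m → ℕ} [Module.Finite k (deg V d)]
    {c : (Fin m → YoungDiagram) →₀ ℕ} (h : ∀ lam ∈ c.support, CanPad lam d)
    (hc : ∀ lam (h : CanPad lam d),
      multiplicity k (padList lam d h) (degRep V d).asModule = c lam) :
    Nonempty ((degRep V d).Equiv (stableSum k c d h)) := by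
  refine nonempty_equiv_directSum (degRep V d)
    (ν := fun lam : {lam // lam ∈ c.support} => padList lam.1 d (h lam.1 lam.2))
    (fun lam lam' h => Subtype.ext (padList_injective h)) (fun lam => hc _ _) fun μ hμ => ?_
  rw [← padList_tails μ, hc]
  by_contra hne
  exact hμ ⟨⟨_, Finsupp.mem_support_iff.mpr hne⟩, padList_tails μ⟩

theorem character_eq_sum_padList {d : Fin m → ℕ} [Module.Finite k (deg V d)]
    {c : (Fin m → YoungDiagram) →₀ ℕ} (h : ∀ lam ∈ c.support, CanPad lam d)
    (hc : ∀ lam (h : CanPad lam d),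
      multiplicity k (padList lam d h) (degRep V d).asModule = c lam) (g : SymProd d) :
    (degRep V d).character g = ∑ lam : {lam // lam ∈ c.support},
      (c lam.1 : k) * simpleCharacter k (padList lam.1 d (h lam.1 lam.2)) g := by
  refine character_eq_sum (degRep V d)
    (ν := fun lam : {lam // lam ∈ c.support} => padList lam.1 d (h lam.1 lam.2))
    (fun lam lam' h => Subtype.ext (padList_injective h)) (fun lam => hc _ _) (fun μ hμ => ?_) g
  rw [← padList_tails μ, hc]
  by_contra hne
  exact hμ ⟨⟨_, Finsupp.mem_support_iff.mpr hne⟩, padList_tails μ⟩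

end Stability


/-! ## Modules of padded tabloids -/

section TabloidModule

theorem rowLen_eq_zero_of_card_le {ν : YoungDiagram} {j : ℕ} (h : ν.card ≤ j) :
    ν.rowLen j = 0 := by
  by_contra hne
  have h3 : (j, 0) ∈ ν := YoungDiagram.mem_iff_lt_rowLen.mpr (Nat.pos_of_ne_zero hne)
  rw [YoungDiagram.mem_iff_lt_colLen, YoungDiagram.colLen_eq_card] at h3
  have h4 : (ν.col 0).card ≤ ν.card := Finset.card_le_card (Finset.filter_subset _ _)
  omega

variable {m : ℕ}

theorem extend_eq_succ_iff {X Y : Type*} (f : X ↪ Y) (r : X → ℕ) (y : Y) (j : ℕ) :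
    Function.extend f r 0 y = j + 1 ↔ ∃ x, f x = y ∧ r x = j + 1 := by
  by_cases h : ∃ x, f x = y
  · obtain ⟨x, rfl⟩ := h
    rw [f.injective.extend_apply]
    exact ⟨fun h => ⟨x, rfl, h⟩, fun ⟨x', h1, h2⟩ => f.injective h1 ▸ h2⟩
  · rw [Function.extend_apply' _ _ _ h]
    exact ⟨fun h => absurd h.symm (Nat.succ_ne_zero j), fun ⟨x, h1, _⟩ => absurd ⟨x, h1⟩ h⟩

/-- The `lam[·]`-tabloids on `S`: the elements of the `j`-th row of `lam_i` have
label `j + 1`, the elements of the padding row have label `0`. -/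
def Filling (lam : Fin m → YoungDiagram) (S : FIm m) : Type :=
  {r : ∀ i, (S i).carrier → ℕ // ∀ i j, {x | r i x = j + 1}.ncard = (lam i).rowLen j}

variable {lam : Fin m → YoungDiagram}

/-- Tabloids are extended along injections by zero. -/
def Filling.map {S T : FIm m} (f : S ⟶ T) (r : Filling lam S) : Filling lam T :=
  ⟨fun i => Function.extend (FIm.app f i) (r.1 i) 0, fun i j => by
    have h : {y | Function.extend (FIm.app f i) (r.1 i) 0 y = j + 1} =
        FIm.app f i '' {x | r.1 i x = j + 1} := by
      ext y
      rw [Set.mem_ofPred_eq, extend_eq_succ_iff]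
      exact ⟨fun ⟨x, h1, h2⟩ => ⟨x, h2, h1⟩, fun ⟨x, h1, h2⟩ => ⟨x, h2, h1⟩⟩
    rw [h, Set.ncard_image_of_injective _ (FIm.app f i).injective, r.2]⟩

theorem Filling.map_apply {S T : FIm m} (f : S ⟶ T) (r : Filling lam S) (i : Fin m)
    (x : (S i).carrier) : (r.map f).1 i (FIm.app f i x) = r.1 i x :=
  (FIm.app f i).injective.extend_apply _ _ _

theorem Filling.map_eq_iff {S T : FIm m} (f : S ⟶ T) (r : Filling lam S) (r' : Filling lam T) :
    r.map f = r' ↔ (∀ i x, r'.1 i (FIm.app f i x) = r.1 i x) ∧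
      ∀ i y, y ∉ Set.range (FIm.app f i) → r'.1 i y = 0 := by
  constructor
  · rintro rfl
    exact ⟨fun i x => map_apply f r i x, fun i y hy => Function.extend_apply' _ _ _ hy⟩
  · rintro ⟨h1, h2⟩
    refine Subtype.ext (funext fun i => funext fun y => ?_)
    by_cases hy : y ∈ Set.range (FIm.app f i)
    · obtain ⟨x, rfl⟩ := hy
      rw [map_apply, h1]
    · rw [h2 i y hy]
      exact Function.extend_apply' _ _ _ hy

theorem Filling.map_id (S : FIm m) (r : Filling lam S) : r.map (𝟙 S) = r :=
  (map_eq_iff _ _ _).mpr ⟨fun _ _ => rfl, fun _ y hy => absurd ⟨y, rfl⟩ hy⟩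

theorem Filling.map_comp {S T U : FIm m} (f : S ⟶ T) (g : T ⟶ U) (r : Filling lam S) :
    r.map (f ≫ g) = (r.map f).map g := by
  refine (map_eq_iff _ _ _).mpr ⟨fun i x => ?_, fun i y hy => ?_⟩
  · exact (map_apply g (r.map f) i (FIm.app f i x)).trans (map_apply f r i x)
  · by_cases h : y ∈ Set.range (FIm.app g i)
    · obtain ⟨z, rfl⟩ := h
      rw [map_apply]
      exact ((map_eq_iff f r _).mp rfl).2 i z fun ⟨x, hx⟩ => hy ⟨x, congrArg (FIm.app g i) hx⟩
    · exact ((map_eq_iff g _ _).mp rfl).2 i y h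

instance (S : FIm m) : Finite (Filling lam S) := by
  have := fun i => (S i).finite
  let F : Filling lam S → ∀ i, (S i).carrier → Fin ((lam i).card + 1) := fun r i x =>
    ⟨r.1 i x, by
      by_contra! hlt
      obtain ⟨j, hj⟩ := Nat.exists_eq_add_of_le' hlt
      have h1 := r.2 i ((lam i).card + j)
      rw [rowLen_eq_zero_of_card_le (Nat.le_add_right _ _), Set.ncard_eq_zero] at h1
      exact Set.eq_empty_iff_forall_notMem.mp h1 x (by rw [Set.mem_ofPred_eq]; omega)⟩
  refine Finite.of_injective F fun r r' h => Subtype.ext (funext fun i => funext fun x => ?_)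
  exact Fin.mk.inj (congrFun (congrFun h i) x)

variable (k : Type u) [Field k]

variable (lam) in
/-- The `FI^m`-module with basis the `lam[·]`-tabloids. -/
def tabloidModule : FImModule.{u, u} k m where
  obj S := ModuleCat.of k (Filling lam S →₀ k)
  map f := ModuleCat.ofHom (Finsupp.lmapDomain k k (Filling.map f))
  map_id S := by
    ext r : 3
    simp [Finsupp.lmapDomain_apply, Filling.map_id]
  map_comp f g := by
    ext r : 3
    simp [Finsupp.lmapDomain_apply, Filling.map_comp]

theorem tabloidModule_map_single {S T : FIm m} (f : S ⟶ T) (r : Filling lam S) (c : k) :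
    ((tabloidModule lam k).map f).hom (Finsupp.single r c : Filling lam S →₀ k) =
      (Finsupp.single (r.map f) c : Filling lam T →₀ k) :=
  Finsupp.mapDomain_single

/-- Two functions with fibers of the same size differ by a bijection. -/
theorem exists_equiv_of_ncard_eq {X Y : Type*} [Finite X] [Finite Y] {p : X → ℕ} {q : Y → ℕ}
    (h : ∀ j, {x | p x = j}.ncard = {y | q y = j}.ncard) : ∃ e : X ≃ Y, ∀ x, q (e x) = p x := by
  have e : ∀ j, Nonempty ({x // p x = j} ≃ {y // q y = j}) := fun j =>
    ⟨(Finite.card_eq.mp (h j)).some⟩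
  refine ⟨(Equiv.sigmaFiberEquiv p).symm.trans ((Equiv.sigmaCongrRight fun j => (e j).some).trans
    (Equiv.sigmaFiberEquiv q)), fun x => ?_⟩
  exact ((e (p x)).some ⟨x, rfl⟩).2

theorem ncard_ne_zero_eq_zero {Z : Type*} (r : Z → ℕ) :
    {z : {z // r z ≠ 0} | r z.1 = 0}.ncard = 0 := by
  convert Set.ncard_empty {z // r z ≠ 0}
  exact Set.eq_empty_of_forall_notMem fun z => z.2

theorem ncard_ne_zero_eq_succ {Z : Type*} (r : Z → ℕ) (j : ℕ) :
    {z : {z // r z ≠ 0} | r z.1 = j + 1}.ncard = {z | r z = j + 1}.ncard := by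
  rw [← Set.ncard_image_of_injective _ Subtype.val_injective]
  congr 1
  ext z
  constructor
  · rintro ⟨z, hz, rfl⟩
    exact hz
  · intro hz
    have hz' : r z = j + 1 := hz
    exact ⟨⟨z, by rw [hz']; exact Nat.succ_ne_zero j⟩, hz, rfl⟩

theorem exists_equiv_ne_zero_of_ncard_eq {X Y : Type*} [Finite X] [Finite Y] {p : X → ℕ}
    {q : Y → ℕ} (h : ∀ j, {x | p x = j + 1}.ncard = {y | q y = j + 1}.ncard) :
    ∃ e : {x // p x ≠ 0} ≃ {y // q y ≠ 0}, ∀ x, q (e x).1 = p x.1 := by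
  refine exists_equiv_of_ncard_eq (p := fun x : {x // p x ≠ 0} => p x.1)
    (q := fun y : {y // q y ≠ 0} => q y.1) fun j => ?_
  rcases j with _ | j
  · exact (ncard_ne_zero_eq_zero p).trans (ncard_ne_zero_eq_zero q).symm
  · exact (ncard_ne_zero_eq_succ p j).trans ((h j).trans (ncard_ne_zero_eq_succ q j).symm)

theorem exists_equiv_of_card_eq {X Y : Type*} [Finite X] [Finite Y] {p : X → ℕ}
    {q : Y → ℕ} (hXY : Nat.card X = Nat.card Y)
    (h : ∀ j, {x | p x = j + 1}.ncard = {y | q y = j + 1}.ncard) :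
    ∃ e : X ≃ Y, ∀ x, q (e x) = p x := by
  refine exists_equiv_of_ncard_eq fun j => ?_
  rcases j with _ | j
  · obtain ⟨e, -⟩ := exists_equiv_ne_zero_of_ncard_eq h
    have h1 : {x | p x = 0}ᶜ.ncard = {y | q y = 0}ᶜ.ncard := Nat.card_congr e
    have h2 := Set.ncard_add_ncard_compl {x | p x = 0}
    have h3 := Set.ncard_add_ncard_compl {y | q y = 0}
    omega
  · exact h j

theorem ncard_row (μ : YoungDiagram) (j : ℕ) :
    {c : {c // c ∈ μ.cells} | c.1.1 = j}.ncard = μ.rowLen j := by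
  rw [YoungDiagram.rowLen_eq_card, ← Set.ncard_coe_finset,
    ← Set.ncard_image_of_injective _ Subtype.val_injective]
  congr 1
  ext c
  rw [Finset.mem_coe, YoungDiagram.mem_row_iff]
  constructor
  · rintro ⟨c, hc, rfl⟩
    exact ⟨c.2, hc⟩
  · rintro ⟨h1, h2⟩
    exact ⟨⟨c, h1⟩, h2, rfl⟩

variable (lam) in
/-- The object of `FI^m` formed by the cells of `lam`. -/
def cellsObj : FIm m := fun i => ⟨{c // c ∈ (lam i).cells}⟩

variable (lam) in
/-- The tabloid on the cells of `lam` without padding. -/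
def cellsFilling : Filling lam (cellsObj lam) :=
  ⟨fun _ c => c.1.1 + 1, fun i j => by
    rw [← ncard_row]
    congr 1
    ext c
    exact Nat.succ_inj⟩

/-- Points with label 0 are invisible: a tabloid is determined by where its labelled cells sit.
Hence one generator suffices for the tabloid module. -/
theorem exists_map_cellsFilling {S : FIm m} (r : Filling lam S) :
    ∃ f : cellsObj lam ⟶ S, (cellsFilling lam).map f = r := by
  have h : ∀ i, ∃ e : {c : {c // c ∈ (lam i).cells} // c.1.1 + 1 ≠ 0} ≃
      {y : (S i).carrier // r.1 i y ≠ 0}, ∀ c, r.1 i (e c).1 = c.1.1.1 + 1 := by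
    intro i
    have := (S i).finite
    refine exists_equiv_ne_zero_of_ncard_eq
      (p := fun c : {c // c ∈ (lam i).cells} => c.1.1 + 1) fun j => ?_
    rw [r.2]
    exact (cellsFilling lam).2 i j
  choose e he using h
  let f : cellsObj lam ⟶ S := fun i =>
    (⟨fun c => (e i ⟨c, Nat.succ_ne_zero _⟩).1, fun c c' hcc =>
      congrArg Subtype.val ((e i).injective (Subtype.ext hcc))⟩ :
        {c // c ∈ (lam i).cells} ↪ (S i).carrier)
  refine ⟨f, (Filling.map_eq_iff _ _ _).mpr ⟨fun i c => he i _, fun i y hy => ?_⟩⟩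
  by_contra hne
  exact hy ⟨((e i).symm ⟨y, hne⟩).1, congrArg Subtype.val ((e i).apply_symm_apply ⟨y, hne⟩)⟩

theorem isFinitelyGenerated_tabloidModule : IsFinitelyGenerated (tabloidModule lam k) := by
  refine ⟨{⟨cellsObj lam, (Finsupp.single (cellsFilling lam) 1 : Filling lam _ →₀ k)⟩},
    Set.finite_singleton _, fun W hW hG S => ?_⟩
  have h0 := hG _ rfl
  rw [eq_top_iff]
  rintro x -
  change Filling lam S →₀ k at x
  induction x using Finsupp.induction_linear with
  | zero => exact (W S).zero_mem
  | add x y hx hy => exact (W S).add_mem hx hy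
  | single r c =>
    obtain ⟨f, rfl⟩ := exists_map_cellsFilling r
    have h1 := (W S).smul_mem c (hW _ _ f _ h0)
    have h2 : (c • (Finsupp.single ((cellsFilling lam).map f) 1 : Filling lam S →₀ k)) =
        Finsupp.single ((cellsFilling lam).map f) c := by
      rw [Finsupp.smul_single, smul_eq_mul, mul_one]
    rw [← h2]
    rw [tabloidModule_map_single] at h1
    exact h1

variable {d : Fin m → ℕ}

/-- The labels of a tabloid on `[d]`. -/
def Filling.labels (r : Filling lam (FIm.std d)) : ∀ i, Fin (d i) → ℕ := r.1

theorem Filling.ncard_labels (r : Filling lam (FIm.std d)) (i : Fin m) (j : ℕ) :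
    {x | r.labels i x = j + 1}.ncard = (lam i).rowLen j := r.2 i j

theorem exists_rows_eq (h : CanPad lam d) (r : Filling lam (FIm.std d)) :
    ∃ s : ∀ i, Tableau (padList lam d h i), rows s = r.labels := by
  have h1 : ∀ i, ∃ s : Tableau (padList lam d h i), ∀ x, (s x).1.1 = r.labels i x := by
    intro i
    refine exists_equiv_of_card_eq (p := r.labels i)
      (q := fun c : {c // c ∈ (padList lam d h i).1.cells} => c.1.1) ?_ fun j => ?_
    · rw [Nat.card_eq_fintype_card, Nat.card_eq_fintype_card, Fintype.card_coe]
      exact (Fintype.card_fin _).trans (padList lam d h i).2.symm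
    · rw [ncard_row, r.ncard_labels]
      exact (rowLen_pad_succ (h i) j).symm
  choose s hs using h1
  exact ⟨s, funext fun i => funext fun x => hs i x⟩

theorem ncard_padRow (h : CanPad lam d) (i : Fin m) (j : ℕ) :
    {x | padRow lam d i x = j + 1}.ncard = (lam i).rowLen j := by
  rw [← rowLen_pad_succ (h i) j, ← ncard_row, ← Set.ncard_image_of_injective _
    (padTableau (lam i) (d i) (h i)).injective]
  congr 1
  ext c
  constructor
  · rintro ⟨x, hx, rfl⟩
    exact hx
  · intro hc
    refine ⟨(padTableau (lam i) (d i) (h i)).symm c, ?_, Equiv.apply_symm_apply _ _⟩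
    rw [Set.mem_ofPred_eq] at hc ⊢
    rw [← hc]
    exact congrArg (fun c => c.1.1) (Equiv.apply_symm_apply (padTableau (lam i) (d i) (h i)) c)

variable (lam d) in
/-- The standard tabloid on `[d]`. -/
def padFilling (h : CanPad lam d) : Filling lam (FIm.std d) := ⟨padRow lam d, ncard_padRow h⟩

theorem labels_padFilling (h : CanPad lam d) : (padFilling lam d h).labels = padRow lam d := rfl

theorem map_toHom_eq_iff {r : Filling lam (FIm.std d)} {g : SymProd d} :
    r.map g.toHom = r ↔ g ∈ stab r.labels := by
  refine (Filling.map_eq_iff _ _ _).trans (Iff.trans ?_ mem_stab.symm)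
  exact ⟨fun h => h.1, fun h => ⟨h, fun i y hy => absurd ((g i).surjective y) hy⟩⟩

variable (lam d) in
/-- The basis of tabloids. -/
def tabloidBasis : Module.Basis (Filling lam (FIm.std d)) k (deg (tabloidModule lam k) d) :=
  Finsupp.basisSingleOne

theorem degRep_tabloidBasis (g : SymProd d) (r : Filling lam (FIm.std d)) :
    degRep (tabloidModule lam k) d g (tabloidBasis lam k d r) =
      tabloidBasis lam k d (r.map g.toHom) :=
  tabloidModule_map_single k g.toHom r 1

/-- The trace of a permutation representation counts fixed basis elements. -/
theorem character_tabloidModule (g : SymProd d) :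
    (degRep (tabloidModule lam k) d).character g =
      (Nat.card {r : Filling lam (FIm.std d) // g ∈ stab r.labels} : k) := by
  classical
  have := Fintype.ofFinite (Filling lam (FIm.std d))
  rw [Representation.character, LinearMap.trace_eq_matrix_trace k (tabloidBasis lam k d),
    Matrix.trace, Nat.card_eq_fintype_card, Fintype.card_subtype, ← Finset.sum_boole]
  refine Finset.sum_congr rfl fun r _ => ?_
  rw [Matrix.diag_apply, LinearMap.toMatrix_apply, degRep_tabloidBasis, Module.Basis.repr_self,
    Finsupp.single_apply]
  exact if_congr map_toHom_eq_iff rfl rfl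

theorem asAlgebraHom_rowSum_tabloidBasis (r : Filling lam (FIm.std d)) :
    (degRep (tabloidModule lam k) d).asAlgebraHom (rowSum k r.labels) (tabloidBasis lam k d r) =
      ((stab r.labels).card : k) • tabloidBasis lam k d r := by
  rw [rowSum, map_sum, LinearMap.sum_apply, Nat.cast_smul_eq_nsmul, ← Finset.sum_const]
  refine Finset.sum_congr rfl fun g hg => ?_
  rw [Representation.asAlgebraHom_of, degRep_tabloidBasis, map_toHom_eq_iff.mpr hg]

theorem asAlgebraHom_colSum_tabloidBasis_ne_zero (h : CanPad lam d) :
    (degRep (tabloidModule lam k) d).asAlgebraHom (colSum k (padCol lam d))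
      (tabloidBasis lam k d (padFilling lam d h)) ≠ 0 := by
  classical
  intro h0
  have h1 := congrArg ((tabloidBasis lam k d).coord (padFilling lam d h)) h0
  rw [colSum, map_sum, LinearMap.sum_apply, map_sum, map_zero, Finset.sum_eq_single 1] at h1
  · rw [map_smul, LinearMap.smul_apply, Representation.asAlgebraHom_of, map_one, sgn_one,
      Module.End.one_apply, map_smul, Module.Basis.coord_apply, Module.Basis.repr_self,
      Finsupp.single_eq_same] at h1
    simp at h1
  · intro g hg hne
    rw [map_smul, LinearMap.smul_apply, Representation.asAlgebraHom_of, degRep_tabloidBasis,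
      map_smul, Module.Basis.coord_apply, Module.Basis.repr_self, Finsupp.single_apply, if_neg,
      smul_zero]
    intro h2
    rw [map_toHom_eq_iff] at h2
    exact hne (eq_one_of_mem_stab (t := padTableaux lam d h) hg h2)
  · exact fun h2 => absurd (one_mem_stab _) h2

variable [CharZero k]

/-- The row sum only rescales the standard tabloid, and the column sum does not kill it, because its
coefficient at that tabloid remains 1. -/
theorem multiplicity_tabloidModule_ne_zero (h : CanPad lam d) :
    multiplicity k (padList lam d h) (degRep (tabloidModule lam k) d).asModule ≠ 0 := by
  have := finite_obj (isFinitelyGenerated_tabloidModule (lam := lam) k) (FIm.std d)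
  have h1 : multiplicity k (padList lam d h) (degRep (tabloidModule lam k) d).asModule =
      Module.finrank k (LinearMap.range ((degRep (tabloidModule lam k) d).asAlgebraHom
        (young k (padTableaux lam d h)))) :=
    rankOf_young_eq _ _
  rw [h1, Ne, Submodule.finrank_eq_zero, LinearMap.range_eq_bot]
  intro h2
  have h3 := LinearMap.congr_fun h2 (tabloidBasis lam k d (padFilling lam d h))
  rw [young, map_mul, Module.End.mul_apply, rows_padTableaux, ← labels_padFilling h,
    asAlgebraHom_rowSum_tabloidBasis, map_smul] at h3
  exact smul_ne_zero (card_stab_ne_zero _) (asAlgebraHom_colSum_tabloidBasis_ne_zero k h) h3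

/-- A basis tabloid is, up to a nonzero scalar, its own row sum applied to it. A column sum that
does not kill it must therefore have a nonzero product with that row sum. -/
theorem dominated_of_multiplicity_tabloidModule_ne_zero (h : CanPad lam d)
    {μ : ∀ i, PartitionOf (d i)}
    (hμ : multiplicity k μ (degRep (tabloidModule lam k) d).asModule ≠ 0) :
    Dominated (padList lam d h) μ := by
  by_contra hdom
  have := finite_obj (isFinitelyGenerated_tabloidModule (lam := lam) k) (FIm.std d)
  refine hμ ?_
  rw [multiplicity_eq_rank _ fun i => someTableau (μ i), Submodule.finrank_eq_zero,
    LinearMap.range_eq_bot]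
  refine (tabloidBasis lam k d).ext fun r => ?_
  obtain ⟨s, hs⟩ := exists_rows_eq h r
  have h1 : colSum k (cols fun i => someTableau (μ i)) * rowSum k r.labels = 0 := by
    by_contra hne
    rw [← hs, ← mul_one (colSum k _)] at hne
    exact hdom (dominated_of_colSum_mul_rowSum_ne_zero hne)
  have h2 := congrArg (fun a => (degRep (tabloidModule lam k) d).asAlgebraHom a
    (tabloidBasis lam k d r)) h1
  simp only [map_mul, Module.End.mul_apply, asAlgebraHom_rowSum_tabloidBasis, map_smul, map_zero,
    LinearMap.zero_apply] at h2
  rw [map_mul, Module.End.mul_apply, (smul_eq_zero.mp h2).resolve_left (card_stab_ne_zero _),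
    map_zero, LinearMap.zero_apply]

end TabloidModule


/-! ## Depth -/

section Depth

/-- The sum of the row indices of the cells. -/
def depth (μ : YoungDiagram) : ℕ := ∑ c ∈ μ.cells, c.1

/-- A row index counts the rows strictly above the cell, so the depth is the sum over j of the
number of cells outside the first j + 1 rows. Thus dominance reverses depth. -/
theorem depth_add_sum {n : ℕ} (μ : PartitionOf n) {N : ℕ} (hN : n ≤ N) :
    depth μ.1 + ∑ j ∈ Finset.range N, cellsAbove μ.1 (j + 1) = N * n := by
  have h1 : ∀ c ∈ μ.1.cells, (∑ j ∈ Finset.range N, if j < c.1 then 1 else 0) = c.1 := by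
    intro c hc
    have h2 : c.1 < μ.1.card := by
      have h3 : (c.1, 0) ∈ μ.1 := μ.1.up_left_mem le_rfl (Nat.zero_le _) hc
      rw [YoungDiagram.mem_iff_lt_colLen, YoungDiagram.colLen_eq_card] at h3
      exact h3.trans_le (Finset.card_le_card (Finset.filter_subset _ _))
    have h3 : μ.1.card = n := μ.2
    have h4 : (Finset.range N).filter (fun j => j < c.1) = Finset.range c.1 := by
      ext j
      simp only [Finset.mem_filter, Finset.mem_range]
      omega
    rw [← Finset.card_filter, h4, Finset.card_range]
  rw [depth, ← Finset.sum_congr rfl h1, Finset.sum_comm, ← Finset.sum_add_distrib]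
  refine (Finset.sum_const_nat (m := n) fun j _ => ?_).trans (by rw [Finset.card_range])
  rw [← Finset.card_filter, cellsAbove]
  simp only [Nat.lt_succ_iff, ← not_lt]
  exact (Finset.card_filter_add_card_filter_not _).trans μ.2

variable {m : ℕ} {d : Fin m → ℕ}

theorem Dominated.depth_le {μ ν : ∀ i, PartitionOf (d i)} (h : Dominated μ ν) (i : Fin m) :
    depth (ν i).1 ≤ depth (μ i).1 := by
  have h1 := depth_add_sum (μ i) le_rfl
  have h2 := depth_add_sum (ν i) le_rfl
  have h3 := Finset.sum_le_sum fun j (_ : j ∈ Finset.range (d i)) => h i (j + 1)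
  omega

theorem Dominated.eq_of_depth_eq {μ ν : ∀ i, PartitionOf (d i)} (h : Dominated μ ν)
    (heq : ∀ i, depth (ν i).1 = depth (μ i).1) : μ = ν := by
  funext i
  refine Subtype.ext (eq_of_cellsAbove_eq fun j => ?_)
  rcases j with _ | j
  · simp [cellsAbove]
  -- The range is enlarged so that it contains the given `j`; equal sums with termwise inequalities
  -- force equal terms.
  · have h1 := depth_add_sum (μ i) (N := d i + (j + 1)) (by omega)
    have h2 := depth_add_sum (ν i) (N := d i + (j + 1)) (by omega)
    have h3 := heq i
    have h4 : ∀ l ∈ Finset.range (d i + (j + 1)),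
        cellsAbove (μ i).1 (l + 1) ≤ cellsAbove (ν i).1 (l + 1) := fun l _ => h i (l + 1)
    have h5 : ∑ l ∈ Finset.range (d i + (j + 1)), cellsAbove (μ i).1 (l + 1) =
        ∑ l ∈ Finset.range (d i + (j + 1)), cellsAbove (ν i).1 (l + 1) := by omega
    have h6 := (Finset.sum_eq_sum_iff_of_le h4).mp h5
    exact h6 j (Finset.mem_range.mpr (by omega))

theorem depth_pad (μ : YoungDiagram) (n : ℕ) (h : μ.card + μ.rowLen 0 ≤ n) :
    depth (pad μ n h).1 = ∑ c ∈ μ.cells, (c.1 + 1) := by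
  change ∑ c ∈ addRowCells μ (n - μ.card), c.1 = _
  rw [addRowCells, Finset.sum_union, Finset.sum_map, Finset.sum_map]
  · simp
  · rw [Finset.disjoint_left]
    rintro ⟨a, b⟩ h1 h2
    simp only [Finset.mem_map, Prod.exists] at h1 h2
    obtain ⟨j, -, h⟩ := h1
    obtain ⟨i, j', -, h'⟩ := h2
    have e1 : 0 = a := congrArg Prod.fst h
    have e2 : i + 1 = a := congrArg Prod.fst h'
    omega

/-- The depth of the padded partitions attached to `lam`. -/
def padDepth (lam : Fin m → YoungDiagram) : ℕ := ∑ i, ∑ c ∈ (lam i).cells, (c.1 + 1)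

/-- The padding row has index 0, so the depth of `lam[d]` does not involve `d` and can measure an
induction valid for all large `d`. -/
theorem padDepth_lt_or_eq {lam lam' : Fin m → YoungDiagram} {h : CanPad lam d}
    {h' : CanPad lam' d} (hdom : Dominated (padList lam d h) (padList lam' d h')) :
    padDepth lam' < padDepth lam ∨ lam' = lam := by
  have h1 : ∀ i ∈ Finset.univ, ∑ c ∈ (lam' i).cells, (c.1 + 1) ≤ ∑ c ∈ (lam i).cells, (c.1 + 1) := by
    intro i _
    rw [← depth_pad _ _ (h i), ← depth_pad _ _ (h' i)]
    exact hdom.depth_le i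
  rcases (Finset.sum_le_sum h1).lt_or_eq with h2 | h2
  · exact Or.inl h2
  · right
    have h3 := (Finset.sum_eq_sum_iff_of_le h1).mp h2
    refine (padList_injective (hdom.eq_of_depth_eq fun i => ?_)).symm
    exact (depth_pad _ _ (h' i)).trans ((h3 i (Finset.mem_univ i)).trans (depth_pad _ _ (h i)).symm)

end Depth

/-! ## Polynomial functions of the cycle counts -/

section Counting

variable (k : Type u) [Field k]

/-- The functions on the cycle counts which are given by polynomials. -/
def polyFun : Subalgebra k ((ℕ+ → ℕ) → k) :=
  (MvPolynomial.aeval (R := k) fun (j : ℕ+) (X : ℕ+ → ℕ) => (X j : k)).range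

variable {k}

theorem exists_of_mem_polyFun {f : (ℕ+ → ℕ) → k} (hf : f ∈ polyFun k) :
    ∃ P : MvPolynomial ℕ+ k, ∀ X : ℕ+ → ℕ, MvPolynomial.eval (fun j => (X j : k)) P = f X := by
  obtain ⟨P, rfl⟩ := hf
  refine ⟨P, fun X => ?_⟩
  have h : (Pi.evalAlgHom k (fun _ : ℕ+ → ℕ => k) X).comp
      (MvPolynomial.aeval (R := k) fun (j : ℕ+) (X : ℕ+ → ℕ) => (X j : k)) =
      MvPolynomial.aeval fun j => (X j : k) := by
    ext j
    simp
  have h1 := DFunLike.congr_fun h P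
  rw [MvPolynomial.aeval_eq_eval] at h1
  exact h1.symm

theorem coe_mem_polyFun (j : ℕ+) : (fun X : ℕ+ → ℕ => (X j : k)) ∈ polyFun k :=
  ⟨MvPolynomial.X j, MvPolynomial.aeval_X _ _⟩

variable [CharZero k]

theorem choose_mem_polyFun (j : ℕ+) (i : ℕ) :
    (fun X : ℕ+ → ℕ => ((X j).choose i : k)) ∈ polyFun k := by
  have h1 : ∀ i : ℕ, (fun X : ℕ+ → ℕ => (((X j).descFactorial i : ℕ) : k)) ∈ polyFun k := by
    intro i
    have h2 : (fun X : ℕ+ → ℕ => (((X j).descFactorial i : ℕ) : k)) =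
        Polynomial.aeval (fun X : ℕ+ → ℕ => (X j : k)) (descPochhammer k i) := by
      funext X
      have h3 := Polynomial.aeval_algHom_apply (Pi.evalAlgHom k (fun _ : ℕ+ → ℕ => k) X)
        (fun X : ℕ+ → ℕ => (X j : k)) (descPochhammer k i)
      refine Eq.trans ?_ h3
      rw [← descPochhammer_eval_eq_descFactorial, Polynomial.coe_aeval_eq_eval]
      rfl
    rw [h2]
    rw [← Polynomial.aeval_subalgebra_coe _ (polyFun k) ⟨_, coe_mem_polyFun j⟩]
    exact Subtype.property _
  have h2 : (fun X : ℕ+ → ℕ => ((X j).choose i : k)) =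
      ((i.factorial : k)⁻¹) • fun X : ℕ+ → ℕ => (((X j).descFactorial i : ℕ) : k) := by
    funext X
    rw [Pi.smul_apply, smul_eq_mul, Nat.descFactorial_eq_factorial_mul_choose, Nat.cast_mul,
      inv_mul_cancel_left₀ (Nat.cast_ne_zero.mpr i.factorial_ne_zero)]
  rw [h2]
  exact (polyFun k).smul_mem (h1 i) _

/-- In the binomial expansion p^i has degree w·i, so only i up to the degree of `l` matter. This
bound is uniform in X, leaving a fixed combination of binomial coefficients in X_j. -/
theorem coeff_one_add_pow_mem_polyFun {p : MvPolynomial ℕ k} {w : ℕ+} (hp : p.IsHomogeneous w)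
    (j : ℕ+) (l : ℕ →₀ ℕ) :
    (fun X : ℕ+ → ℕ => MvPolynomial.coeff l ((1 + p) ^ X j)) ∈ polyFun k := by
  have h : (fun X : ℕ+ → ℕ => MvPolynomial.coeff l ((1 + p) ^ X j)) =
      ∑ i ∈ Finset.range (l.degree + 1),
        MvPolynomial.coeff l (p ^ i) • fun X : ℕ+ → ℕ => ((X j).choose i : k) := by
    funext X
    rw [add_comm, add_pow, MvPolynomial.coeff_sum, Finset.sum_apply]
    have h1 : ∀ i, MvPolynomial.coeff l (p ^ i * 1 ^ (X j - i) * (((X j).choose i : ℕ) : MvPolynomial ℕ k)) =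
        MvPolynomial.coeff l (p ^ i) * ((X j).choose i : k) := by
      intro i
      rw [one_pow, mul_one, ← map_natCast (MvPolynomial.C (σ := ℕ) (R := k)), mul_comm,
        MvPolynomial.coeff_C_mul, mul_comm]
    simp only [h1, Pi.smul_apply, smul_eq_mul]
    have h2 : ∀ (A B : ℕ) (_ : ∀ i, A ≤ i → i < B →
        MvPolynomial.coeff l (p ^ i) * ((X j).choose i : k) = 0) (_ : A ≤ B),
        ∑ i ∈ Finset.range A, MvPolynomial.coeff l (p ^ i) * ((X j).choose i : k) =
        ∑ i ∈ Finset.range B, MvPolynomial.coeff l (p ^ i) * ((X j).choose i : k) := by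
      intro A B h hAB
      refine Finset.sum_subset (Finset.range_subset_range.mpr hAB) fun i hi hi' => ?_
      rw [Finset.mem_range] at hi hi'
      exact h i (by omega) hi
    -- Extra terms vanish by the binomial coefficient in one case, by degree in the other.
    rcases le_total (X j + 1) (l.degree + 1) with hle | hle
    · exact h2 _ _ (fun i hi _ => by rw [Nat.choose_eq_zero_of_lt hi, Nat.cast_zero, mul_zero]) hle
    · refine (h2 _ _ (fun i hi _ => ?_) hle).symm
      rw [(hp.pow i).coeff_eq_zero, zero_mul]
      have := Nat.le_mul_of_pos_left i w.pos
      omega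
  rw [h]
  exact sum_mem fun i _ => (polyFun k).smul_mem (choose_mem_polyFun j i) _

theorem coeff_prod_mem_polyFun {p : ℕ+ → MvPolynomial ℕ k} (hp : ∀ w, (p w).IsHomogeneous w)
    (W : Finset ℕ+) (l : ℕ →₀ ℕ) :
    (fun X : ℕ+ → ℕ => MvPolynomial.coeff l (∏ w ∈ W, (1 + p w) ^ X w)) ∈ polyFun k := by
  classical
  induction W using Finset.induction_on generalizing l with
  | empty =>
    simp only [Finset.prod_empty]
    exact (polyFun k).algebraMap_mem (MvPolynomial.coeff l 1)
  | insert w W hw ih =>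
    have h : (fun X : ℕ+ → ℕ => MvPolynomial.coeff l (∏ w ∈ insert w W, (1 + p w) ^ X w)) =
        ∑ a ∈ Finset.HasAntidiagonal.antidiagonal l, (fun X : ℕ+ → ℕ => MvPolynomial.coeff a.1 ((1 + p w) ^ X w)) *
          fun X : ℕ+ → ℕ => MvPolynomial.coeff a.2 (∏ w ∈ W, (1 + p w) ^ X w) := by
      funext X
      rw [Finset.prod_insert hw, MvPolynomial.coeff_mul, Finset.sum_apply]
      rfl
    rw [h]
    exact sum_mem fun a _ => mul_mem (coeff_one_add_pow_mem_polyFun (hp w) w a.1) (ih a.2)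

end Counting


/-! ## Counting invariant functions -/

section Cycles

variable {n : ℕ} (σ : Equiv.Perm (Fin n))

/-- The set of cycles of a permutation, including the fixed points. -/
abbrev Cycles : Type := Quotient (Equiv.Perm.SameCycle.setoid σ)

variable {σ}

open scoped Classical in
/-- The points on a cycle. -/
def pointsOn (q : Cycles σ) : Finset (Fin n) :=
  Finset.univ.filter fun x => (Quotient.mk _ x : Cycles σ) = q

theorem mem_pointsOn {q : Cycles σ} {x : Fin n} :
    x ∈ pointsOn q ↔ (Quotient.mk _ x : Cycles σ) = q := by
  simp [pointsOn]

theorem mem_pointsOn_mk {x y : Fin n} :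
    y ∈ pointsOn (Quotient.mk _ x : Cycles σ) ↔ σ.SameCycle x y := by
  rw [mem_pointsOn, Quotient.eq]
  exact Equiv.Perm.sameCycle_comm

theorem pointsOn_mk_of_fixed {x : Fin n} (hx : σ x = x) :
    pointsOn (Quotient.mk _ x : Cycles σ) = {x} := by
  ext y
  rw [mem_pointsOn_mk, Finset.mem_singleton]
  constructor
  · rintro ⟨i, rfl⟩
    exact Equiv.Perm.zpow_apply_eq_self_of_apply_eq_self hx i
  · rintro rfl
    exact Equiv.Perm.SameCycle.rfl

theorem pointsOn_mk_of_not_fixed {x : Fin n} (hx : σ x ≠ x) :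
    pointsOn (Quotient.mk _ x : Cycles σ) = (σ.cycleOf x).support := by
  ext y
  rw [mem_pointsOn_mk, Equiv.Perm.mem_support_cycleOf_iff]
  exact ⟨fun h => ⟨h, Equiv.Perm.mem_support.mpr hx⟩, fun h => h.1⟩

theorem pointsOn_nonempty (q : Cycles σ) : (pointsOn q).Nonempty := by
  induction q using Quotient.ind with
  | _ x => exact ⟨x, mem_pointsOn.mpr rfl⟩

/-- The length of a cycle. -/
def cycleLen (q : Cycles σ) : ℕ+ := ⟨(pointsOn q).card, (pointsOn_nonempty q).card_pos⟩

open scoped Classical in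
-- Length 1 is treated apart: `cycleType` omits the fixed points, which `partition` adds back as
-- parts 1.
theorem card_cycleLen_eq (σ : Equiv.Perm (Fin n)) (w : ℕ+) :
    (Finset.univ.filter fun q : Cycles σ => cycleLen q = w).card = cycleCount σ w := by
  have hmem : ∀ q : Cycles σ, cycleLen q = w ↔ (pointsOn q).card = w := fun q => PNat.coe_inj.symm
  have hcount : cycleCount σ w = σ.cycleType.count (w : ℕ) +
      (Multiset.replicate (Fintype.card (Fin n) - σ.support.card) 1).count (w : ℕ) := by
    rw [cycleCount, Equiv.Perm.parts_partition, Multiset.count_add]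
  rw [hcount]
  by_cases hw : w = 1
  · subst hw
    rw [Multiset.count_eq_zero_of_notMem fun h => absurd
      (Equiv.Perm.two_le_of_mem_cycleType h) (by simp), zero_add, PNat.one_coe,
      Multiset.count_replicate_self, ← Finset.card_compl]
    refine (Finset.card_bij (fun x _ => Quotient.mk _ x) ?_ ?_ ?_).symm
    · intro x hx
      rw [Finset.mem_compl, Equiv.Perm.notMem_support] at hx
      rw [Finset.mem_filter, hmem, pointsOn_mk_of_fixed hx]
      exact ⟨Finset.mem_univ _, rfl⟩
    · intro x hx y _ hxy
      rw [Finset.mem_compl, Equiv.Perm.notMem_support] at hx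
      have h1 := mem_pointsOn.mpr hxy.symm
      rw [pointsOn_mk_of_fixed hx, Finset.mem_singleton] at h1
      exact h1.symm
    · intro q hq
      induction q using Quotient.ind with
      | _ x =>
        refine ⟨x, ?_, rfl⟩
        rw [Finset.mem_compl, Equiv.Perm.notMem_support]
        by_contra hx
        rw [Finset.mem_filter, hmem, pointsOn_mk_of_not_fixed hx] at hq
        have h1 := Equiv.Perm.two_le_card_support_cycleOf_iff.mpr hx
        rw [hq.2] at h1
        simp at h1
  · have hw2 : (w : ℕ) ≠ 1 := fun h => hw (PNat.coe_inj.mp h)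
    rw [Multiset.count_eq_zero_of_notMem (s := Multiset.replicate _ 1)
      fun h => hw2 (Multiset.eq_of_mem_replicate h), add_zero, Equiv.Perm.cycleType_def,
      Multiset.count_map]
    change _ = (σ.cycleFactorsFinset.filter fun c => (w : ℕ) = c.support.card).card
    have hfix : ∀ x, (pointsOn (Quotient.mk _ x : Cycles σ)).card = w → σ x ≠ x := by
      intro x h hx
      rw [pointsOn_mk_of_fixed hx, Finset.card_singleton] at h
      exact hw2 h.symm
    refine Finset.card_bij (fun q _ => σ.cycleOf q.out) ?_ ?_ ?_
    · intro q hq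
      rw [Finset.mem_filter, hmem, ← q.out_eq] at hq
      have h1 := hfix _ hq.2
      rw [Finset.mem_filter, Equiv.Perm.cycleOf_mem_cycleFactorsFinset_iff, Equiv.Perm.mem_support,
        ← pointsOn_mk_of_not_fixed h1]
      exact ⟨h1, hq.2.symm⟩
    · intro q hq q' hq' h
      rw [Finset.mem_filter, hmem, ← q.out_eq] at hq
      rw [Finset.mem_filter, hmem, ← q'.out_eq] at hq'
      have h1 : σ.SameCycle q.out q'.out := (Equiv.Perm.sameCycle_iff_cycleOf_eq_of_mem_support
        (Equiv.Perm.mem_support.mpr (hfix _ hq.2)) 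
        (Equiv.Perm.mem_support.mpr (hfix _ hq'.2))).mpr h
      rw [← q.out_eq, ← q'.out_eq]
      exact Quotient.sound h1
    · intro c hc
      rw [Finset.mem_filter] at hc
      have hcyc := (Equiv.Perm.mem_cycleFactorsFinset_iff.mp hc.1).1
      obtain ⟨x, hx⟩ := hcyc.nonempty_support
      have hcx := Equiv.Perm.cycle_is_cycleOf hx hc.1
      have h2 : σ.SameCycle (Quotient.mk _ x : Cycles σ).out x :=
        Quotient.exact (Quotient.out_eq (Quotient.mk _ x : Cycles σ))
      have hσx : σ x ≠ x := by
        rw [← Equiv.Perm.mem_support]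
        exact Equiv.Perm.mem_cycleFactorsFinset_support_le hc.1 hx
      refine ⟨Quotient.mk _ x, ?_, ?_⟩
      · rw [Finset.mem_filter, hmem, pointsOn_mk_of_not_fixed hσx, ← hcx]
        exact ⟨Finset.mem_univ _, hc.2.symm⟩
      · rw [h2.cycleOf_eq, hcx]

end Cycles


/-! ## Fixed tabloids -/

section FixedTabloids

theorem rowLen_le_card (ν : YoungDiagram) (j : ℕ) : ν.rowLen j ≤ ν.card := by
  rw [YoungDiagram.rowLen_eq_card]
  exact Finset.card_le_card (Finset.filter_subset _ _)

/-- The row lengths, as an exponent vector. -/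
def rowLens (ν : YoungDiagram) : ℕ →₀ ℕ :=
  Finsupp.onFinset (Finset.range ν.card) ν.rowLen fun j hj => by
    rw [Finset.mem_range]
    by_contra! h
    exact hj (rowLen_eq_zero_of_card_le h)

variable (k : Type u) [Field k]

/-- The contribution to the generating function of a `w`-cycle in the row with label `c`.
Cycles with more than `L` points do not contribute. -/
def cycleWeight (L : ℕ) (w : ℕ+) : ℕ → MvPolynomial ℕ k
  | 0 => 1
  | j + 1 => if (w : ℕ) ≤ L then MvPolynomial.monomial (Finsupp.single j (w : ℕ)) 1 else 0

/-- The power sums of the variables. -/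
def powerSum (L : ℕ) (w : ℕ+) : MvPolynomial ℕ k :=
  ∑ j ∈ Finset.range L, cycleWeight k L w (j + 1)

theorem sum_cycleWeight (L : ℕ) (w : ℕ+) :
    ∑ c ∈ Finset.range (L + 1), cycleWeight k L w c = 1 + powerSum k L w := by
  rw [Finset.sum_range_succ', add_comm]
  rfl

theorem powerSum_isHomogeneous (L : ℕ) (w : ℕ+) : (powerSum k L w).IsHomogeneous w := by
  refine MvPolynomial.IsHomogeneous.sum _ _ _ fun j _ => ?_
  rw [cycleWeight]
  split_ifs
  · exact MvPolynomial.isHomogeneous_monomial _ (Finsupp.degree_single _ _)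
  · exact MvPolynomial.isHomogeneous_zero _ _ _

theorem powerSum_of_lt {L : ℕ} {w : ℕ+} (h : L < w) : powerSum k L w = 0 :=
  Finset.sum_eq_zero fun j _ => if_neg (by omega)

variable {n : ℕ} {σ : Equiv.Perm (Fin n)}

open scoped Classical in
-- Cycles are grouped by length. By truncation those longer than `L` give the factor 1, so the range
-- of lengths can be fixed independently of `σ`.
theorem prod_powerSum (σ : Equiv.Perm (Fin n)) (L : ℕ) :
    ∏ w ∈ Finset.Icc 1 L.succPNat, (1 + powerSum k L w) ^ cycleCount σ w =
      ∏ q : Cycles σ, (1 + powerSum k L (cycleLen q)) := by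
  rw [← Finset.prod_fiberwise_of_maps_to (s := Finset.univ)
    (t := Finset.Icc 1 L.succPNat ∪ Finset.univ.image (cycleLen (σ := σ))) (g := cycleLen)
    fun q hq => Finset.mem_union_right _ (Finset.mem_image_of_mem _ hq)]
  have h : ∀ w : ℕ+, ∏ q : Cycles σ with cycleLen q = w, (1 + powerSum k L (cycleLen q)) =
      (1 + powerSum k L w) ^ cycleCount σ w := by
    intro w
    rw [← card_cycleLen_eq, ← Finset.prod_const]
    refine Finset.prod_congr rfl fun q hq => ?_
    rw [(Finset.mem_filter.mp hq).2]
  rw [Finset.prod_congr rfl fun w _ => h w]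
  refine Finset.prod_subset Finset.subset_union_left fun w _ hw => ?_
  rw [powerSum_of_lt, add_zero, one_pow]
  by_contra! hle
  refine hw (Finset.mem_Icc.mpr ⟨one_le, ?_⟩)
  rw [← PNat.coe_le_coe, Nat.succPNat_coe]
  exact hle.trans (Nat.le_succ L)

open scoped Classical in
/-- The number of points in the `j`-th row of the tabloid with labels `s`. -/
def rowSize (s : Cycles σ → ℕ) (j : ℕ) : ℕ :=
  ∑ q : Cycles σ with s q = j + 1, (cycleLen q : ℕ)

theorem le_rowSize {s : Cycles σ → ℕ} {j : ℕ} {q : Cycles σ} (h : s q = j + 1) :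
    (cycleLen q : ℕ) ≤ rowSize s j := by
  classical
  exact Finset.single_le_sum (f := fun q : Cycles σ => (cycleLen q : ℕ)) (fun _ _ => Nat.zero_le _)
    (Finset.mem_filter.mpr ⟨Finset.mem_univ _, h⟩)

open scoped Classical in
-- The product is the monomial whose exponents are the row sizes, unless a cycle with more than |ν|
-- points has a nonzero label; then it is zero, and no row of ν could hold that cycle.
theorem coeff_prod_cycleWeight (ν : YoungDiagram) (s : Cycles σ → ℕ) :
    MvPolynomial.coeff (rowLens ν) (∏ q, cycleWeight k ν.card (cycleLen q) (s q)) =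
      if ∀ j, rowSize s j = ν.rowLen j then 1 else 0 := by
  by_cases hL : ∀ q, s q ≠ 0 → (cycleLen q : ℕ) ≤ ν.card
  · let e : Cycles σ → ℕ →₀ ℕ := fun q =>
      if s q = 0 then 0 else Finsupp.single (s q - 1) (cycleLen q : ℕ)
    have h1 : ∀ q, cycleWeight k ν.card (cycleLen q) (s q) = MvPolynomial.monomial (e q) 1 := by
      intro q
      rcases hs : s q with _ | j
      · simp [e, hs, cycleWeight]
      · simp [e, hs, cycleWeight, hL q (by omega)]
    rw [Finset.prod_congr rfl fun q _ => h1 q, ← MvPolynomial.monomial_sum_one,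
      MvPolynomial.coeff_monomial]
    refine if_congr ?_ rfl rfl
    rw [Finsupp.ext_iff]
    refine forall_congr' fun j => ?_
    have h2 : (∑ q, e q) j = rowSize s j := by
      rw [Finsupp.finsetSum_apply, rowSize, Finset.sum_filter]
      refine Finset.sum_congr rfl fun q _ => ?_
      rcases hs : s q with _ | j'
      · simp [e, hs]
      · simp [e, hs, Finsupp.single_apply]
    rw [h2]
    rfl
  · push Not at hL
    obtain ⟨q, hq, hlt⟩ := hL
    obtain ⟨j, hj⟩ := Nat.exists_eq_succ_of_ne_zero hq
    rw [if_neg fun h => absurd ((le_rowSize hj).trans_eq (h j))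
      (by have := rowLen_le_card ν j; omega), Finset.prod_eq_zero (Finset.mem_univ q),
      MvPolynomial.coeff_zero]
    rw [hj]
    exact if_neg (by omega)

open scoped Classical in
theorem card_rowSize_eq (σ : Equiv.Perm (Fin n)) (ν : YoungDiagram) :
    (Nat.card {s : Cycles σ → ℕ // ∀ j, rowSize s j = ν.rowLen j} : k) =
      MvPolynomial.coeff (rowLens ν)
        (∏ w ∈ Finset.Icc 1 ν.card.succPNat, (1 + powerSum k ν.card w) ^ cycleCount σ w) := by
  rw [prod_powerSum]
  simp only [← sum_cycleWeight]
  rw [Finset.prod_univ_sum, MvPolynomial.coeff_sum]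
  simp only [coeff_prod_cycleWeight]
  rw [Finset.sum_boole]
  congr 1
  refine Nat.subtype_card _ fun s => ?_
  -- The expansion sees only labels up to |ν|; a larger one would put points in an empty row.
  rw [Finset.mem_filter, Fintype.mem_piFinset, and_iff_right_of_imp]
  intro h q
  rw [Finset.mem_range]
  by_contra! hlt
  obtain ⟨j, hj⟩ := Nat.exists_eq_add_of_le' (Nat.succ_le_of_lt hlt)
  have h1 := (le_rowSize (j := ν.card + j) (q := q) (s := s) (by omega)).trans_eq (h _)
  rw [rowLen_eq_zero_of_card_le (Nat.le_add_right _ _)] at h1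
  exact absurd h1 (by have := (cycleLen q).pos; omega)

theorem ncard_eq_rowSize (s : Cycles σ → ℕ) (j : ℕ) :
    {x : Fin n | s (Quotient.mk _ x) = j + 1}.ncard = rowSize s j := by
  classical
  have h : {x : Fin n | s (Quotient.mk _ x) = j + 1} =
      ((Finset.univ.filter fun x : Fin n => s (Quotient.mk _ x) = j + 1 : Finset (Fin n)) :
        Set (Fin n)) := by
    ext x; simp
  rw [h, Set.ncard_coe_finset, rowSize, Finset.card_eq_sum_card_fiberwise
    (f := fun x => (Quotient.mk _ x : Cycles σ))
    (t := Finset.univ.filter fun q : Cycles σ => s q = j + 1)]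
  · refine Finset.sum_congr rfl fun q hq => ?_
    change _ = (pointsOn q).card
    congr 1
    ext x
    rw [Finset.mem_filter, Finset.mem_filter, mem_pointsOn, and_iff_right_of_imp]
    rintro rfl
    exact ⟨Finset.mem_univ _, (Finset.mem_filter.mp hq).2⟩
  · intro x hx
    simpa using hx

/-- Invariant labels are functions on the set of cycles. -/
def invariantEquiv (σ : Equiv.Perm (Fin n)) (ν : YoungDiagram) :
    {r : Fin n → ℕ // (∀ j, {x | r x = j + 1}.ncard = ν.rowLen j) ∧ ∀ x, r (σ x) = r x} ≃
      {s : Cycles σ → ℕ // ∀ j, rowSize s j = ν.rowLen j} where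
  toFun r := ⟨Quotient.lift r.1 (by
    rintro x _ ⟨i, rfl⟩
    have h : ∀ (i : ℕ) (x : Fin n), r.1 ((σ ^ i) x) = r.1 x := by
      intro i
      induction i with
      | zero => exact fun x => rfl
      | succ i ih => exact fun x => by rw [pow_succ, Equiv.Perm.mul_apply, ih, r.2.2]
    rcases i with i | i
    · exact (h i x).symm
    · rw [← h (i + 1) ((σ ^ Int.negSucc i) x), zpow_negSucc, ← Equiv.Perm.mul_apply,
        mul_inv_cancel, Equiv.Perm.one_apply]),
    fun j => by rw [← ncard_eq_rowSize]; exact r.2.1 j⟩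
  invFun s := ⟨fun x => s.1 (Quotient.mk _ x), fun j => by rw [ncard_eq_rowSize, s.2], fun x =>
    congrArg s.1 (Quotient.sound (Equiv.Perm.sameCycle_apply_left.mpr (.refl σ x)))⟩
  left_inv r := rfl
  right_inv s := Subtype.ext (funext fun q => Quotient.inductionOn q fun _ => rfl)

variable {k} {m : ℕ} [CharZero k]

theorem exists_poly_card_invariant (ν : YoungDiagram) : ∃ P : MvPolynomial ℕ+ k,
    ∀ (n : ℕ) (σ : Equiv.Perm (Fin n)), (Nat.card {r : Fin n → ℕ //
      (∀ j, {x | r x = j + 1}.ncard = ν.rowLen j) ∧ ∀ x, r (σ x) = r x} : k) =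
      MvPolynomial.eval (fun j => (cycleCount σ j : k)) P := by
  obtain ⟨P, hP⟩ := exists_of_mem_polyFun (coeff_prod_mem_polyFun
    (powerSum_isHomogeneous k ν.card) (Finset.Icc 1 ν.card.succPNat) (rowLens ν))
  refine ⟨P, fun n σ => ?_⟩
  rw [Nat.card_congr (invariantEquiv σ ν), card_rowSize_eq, hP]

variable (k) in
/-- The character of a module of tabloids is given by a character polynomial. -/
theorem exists_charPoly_tabloidModule (lam : Fin m → YoungDiagram) : ∃ P : CharPoly k m,
    ∀ (d : Fin m → ℕ) (g : SymProd d),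
      (degRep (tabloidModule lam k) d).character g = P.value g := by
  choose P hP using fun i => exists_poly_card_invariant (k := k) (lam i)
  refine ⟨∏ i, MvPolynomial.rename (Prod.mk i) (P i), fun d g => ?_⟩
  let e : {r : Filling lam (FIm.std d) // g ∈ stab r.labels} ≃ ∀ i, {r : Fin (d i) → ℕ //
      (∀ j, {x | r x = j + 1}.ncard = (lam i).rowLen j) ∧ ∀ x, r (g i x) = r x} :=
    { toFun := fun r i => ⟨r.1.labels i, r.1.ncard_labels i, mem_stab.mp r.2 i⟩
      invFun := fun r => ⟨⟨fun i => (r i).1, fun i => (r i).2.1⟩, mem_stab.mpr fun i => (r i).2.2⟩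
      left_inv := fun r => rfl
      right_inv := fun r => rfl }
  rw [character_tabloidModule, Nat.card_congr e, Nat.card_pi, Nat.cast_prod, CharPoly.value, map_prod]
  refine Finset.prod_congr rfl fun i _ => ?_
  rw [hP, MvPolynomial.eval_rename]
  rfl

end FixedTabloids


/-! ## Character polynomials -/

section CharacterPolynomials

variable {m : ℕ} {k : Type u} [Field k] [CharZero k]

variable (k) in
/-- The characters of the irreducible representations attached to `lam[d]` are eventually given by
a character polynomial. -/
theorem exists_charPoly_padList (lam : Fin m → YoungDiagram) :
    ∃ P : CharPoly k m, ∀ᶠ d : Fin m → ℕ in atTop, ∀ (h : CanPad lam d) (g : SymProd d),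
      simpleCharacter k (padList lam d h) g = P.value g := by
  classical
  induction hN : padDepth lam using Nat.strong_induction_on generalizing lam with
  | _ N ih =>
    subst hN
    have hfg := isFinitelyGenerated_tabloidModule (lam := lam) k
    obtain ⟨c, hc⟩ := exists_stable_multiplicity hfg
    obtain ⟨P₀, hP₀⟩ := exists_charPoly_tabloidModule k lam
    have hpad : ∀ᶠ d : Fin m → ℕ in atTop, CanPad lam d :=
      eventually_ge_atTop fun i => minPad (lam i)
    -- The coefficients `c` do not depend on `d`, so their properties can be read off at a single
    -- `d₀`.
    obtain ⟨d₀, hd₀, hlam₀⟩ := (hc.and hpad).exists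
    have hlam : c lam ≠ 0 := by
      rw [← hd₀.2 lam hlam₀]
      exact multiplicity_tabloidModule_ne_zero k hlam₀
    have hsmall : ∀ lam' ∈ c.support.erase lam, padDepth lam' < padDepth lam := by
      intro lam' h'
      obtain ⟨hne, hmem⟩ := Finset.mem_erase.mp h'
      have h1 : multiplicity k (padList lam' d₀ (hd₀.1 lam' hmem))
          (degRep (tabloidModule lam k) d₀).asModule ≠ 0 := by
        rw [hd₀.2]
        exact Finsupp.mem_support_iff.mp hmem
      exact (padDepth_lt_or_eq
        (dominated_of_multiplicity_tabloidModule_ne_zero k hlam₀ h1)).resolve_right hne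
    have hQ : ∀ lam', ∃ P : CharPoly k m, lam' ∈ c.support.erase lam →
        ∀ᶠ d : Fin m → ℕ in atTop, ∀ (h : CanPad lam' d) (g : SymProd d),
          simpleCharacter k (padList lam' d h) g = P.value g := by
      intro lam'
      by_cases h' : lam' ∈ c.support.erase lam
      · obtain ⟨P, hP⟩ := ih _ (hsmall lam' h') lam' rfl
        exact ⟨P, fun _ => hP⟩
      · exact ⟨0, fun h => absurd h h'⟩
    choose Q hQ using hQ
    have hQ' := (Finset.eventually_all (c.support.erase lam)).mpr hQ
    -- The decomposition of the tabloid character is solved for the term of `lam`; the others are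
    -- known by induction.
    refine ⟨(c lam : k)⁻¹ • (P₀ - ∑ lam' ∈ c.support.erase lam, (c lam' : k) • Q lam'), ?_⟩
    filter_upwards [hc, hQ'] with d hd hdQ h g
    have := finite_obj hfg (FIm.std d)
    have h1 := character_eq_sum_padList hd.1 hd.2 g
    have h2 : ∑ l : {l // l ∈ c.support},
        (c l.1 : k) * simpleCharacter k (padList l.1 d (hd.1 l.1 l.2)) g =
        (c lam : k) * simpleCharacter k (padList lam d h) g +
          ∑ l ∈ c.support.erase lam, (c l : k) * (Q l).value g := by
      have h3 : ∀ l (hl : l ∈ c.support), (c l : k) * simpleCharacter k (padList l d (hd.1 l hl)) g =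
          (if l = lam then (c lam : k) * simpleCharacter k (padList lam d h) g
            else (c l : k) * (Q l).value g) := by
        intro l hl
        split_ifs with heq
        · subst heq; rfl
        · rw [hdQ l (Finset.mem_erase.mpr ⟨heq, hl⟩)]
      rw [Finset.sum_congr rfl fun l _ => h3 l.1 l.2, Finset.sum_coe_sort c.support
        fun l => if l = lam then (c lam : k) * simpleCharacter k (padList lam d h) g
            else (c l : k) * (Q l).value g,
        ← Finset.add_sum_erase _ _ (Finsupp.mem_support_iff.mpr hlam), if_pos rfl]
      congr 1
      exact Finset.sum_congr rfl fun l hl => if_neg (Finset.ne_of_mem_erase hl)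
    rw [hP₀, h2] at h1
    have hc0 : (c lam : k) ≠ 0 := Nat.cast_ne_zero.mpr hlam
    simp only [CharPoly.value, MvPolynomial.smul_eval, map_sub, map_sum] at h1 ⊢
    rw [h1, add_sub_cancel_right, inv_mul_cancel_left₀ hc0]

variable {V : FImModule.{u, v} k m}

theorem exists_charPoly (hV : IsFinitelyGenerated V) :
    ∃ P : CharPoly k m, ∀ᶠ d : Fin m → ℕ in atTop,
      ∀ σ : SymProd d, (degRep V d).character σ = P.value σ := by
  classical
  obtain ⟨c, hc⟩ := exists_stable_multiplicity hV
  choose Q hQ using exists_charPoly_padList (m := m) k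
  have hQ' := (Finset.eventually_all c.support).mpr fun lam _ => hQ lam
  refine ⟨∑ lam ∈ c.support, (c lam : k) • Q lam, ?_⟩
  filter_upwards [hc, hQ'] with d hd hdQ g
  have := finite_obj hV (FIm.std d)
  rw [character_eq_sum_padList hd.1 hd.2 g, CharPoly.value, map_sum, ← Finset.sum_coe_sort c.support]
  refine Finset.sum_congr rfl fun lam _ => ?_
  rw [MvPolynomial.smul_eval, hdQ lam.1 lam.2]
  rfl

theorem cycleCount_one {n : ℕ} (j : ℕ+) :
    cycleCount (1 : Equiv.Perm (Fin n)) j = if j = 1 then n else 0 := by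
  rw [cycleCount, Equiv.Perm.parts_partition, Equiv.Perm.cycleType_one, Equiv.Perm.support_one,
    zero_add, Finset.card_empty, tsub_zero, Fintype.card_fin, Multiset.count_replicate]
  exact if_congr (by rw [eq_comm, PNat.coe_eq_one_iff]) rfl rfl

/-- A polynomial with rational values at tuples of natural numbers can be replaced by a rational
polynomial. -/
theorem exists_rat_poly {ι : Type*} (P : MvPolynomial ι k) : ∃ Q : MvPolynomial ι ℚ,
    ∀ (y : ι → ℕ) (q : ℚ), MvPolynomial.eval (fun i => (y i : k)) P = (q : k) →
      MvPolynomial.eval (fun i => (y i : ℚ)) Q = q := by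
  -- A ℚ-linear retraction of k onto ℚ, applied to the coefficients, commutes with evaluation at
  -- natural numbers and fixes rational values.
  obtain ⟨φ, hφ⟩ := (Algebra.linearMap ℚ k).exists_leftInverse_of_injective
    (LinearMap.ker_eq_bot.mpr (algebraMap ℚ k).injective)
  have hφ' : ∀ q : ℚ, φ (q : k) = q := fun q => by
    have := LinearMap.congr_fun hφ q
    simpa using this
  refine ⟨∑ l ∈ P.support, MvPolynomial.monomial l (φ (P.coeff l)), fun y q h => ?_⟩
  rw [← hφ' q, ← h, map_sum, MvPolynomial.eval_eq _ P, map_sum]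
  refine Finset.sum_congr rfl fun l _ => ?_
  rw [MvPolynomial.eval_monomial]
  have h1 : P.coeff l * ∏ i ∈ l.support, (y i : k) ^ l i =
      (∏ i ∈ l.support, (y i : ℚ) ^ l i) • P.coeff l := by
    rw [Algebra.smul_def, mul_comm]
    simp
  rw [h1, map_smul, smul_eq_mul, mul_comm]
  rfl

/-- The dimension is the character at the identity, where the variable (i, 1) takes the value d_i
and all others vanish. -/
theorem exists_dimPoly (hV : IsFinitelyGenerated V) :
    ∃ Q : MvPolynomial (Fin m) ℚ, ∀ᶠ d : Fin m → ℕ in atTop,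
      (Module.finrank k (deg V d) : ℚ) = MvPolynomial.eval (fun i => (d i : ℚ)) Q := by
  obtain ⟨P, hP⟩ := exists_charPoly hV
  obtain ⟨Q, hQ⟩ := exists_rat_poly (MvPolynomial.aeval (R := k) (fun p : Fin m × ℕ+ =>
    if p.2 = 1 then (MvPolynomial.X p.1 : MvPolynomial (Fin m) k) else 0) P)
  refine ⟨Q, hP.mono fun d hd => (hQ d _ ?_).symm⟩
  have := finite_obj hV (FIm.std d)
  have h1 := hd 1
  rw [Representation.char_one, CharPoly.value] at h1
  rw [Rat.cast_natCast, h1, ← MvPolynomial.coe_aeval_eq_eval, ← MvPolynomial.coe_aeval_eq_eval]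
  change ((MvPolynomial.aeval fun i => (d i : k)).comp (MvPolynomial.aeval _)) P =
    MvPolynomial.aeval (fun p : Fin m × ℕ+ => (cycleCount ((1 : SymProd d) p.1) p.2 : k)) P
  rw [MvPolynomial.comp_aeval]
  congr 2
  funext p
  rw [Pi.one_apply, cycleCount_one]
  split_ifs <;> simp

end CharacterPolynomials

end RepStab
end

theorem theorem2p6 {k : Type u} [Field k] [CharZero k] (m : ℕ)
    (V : RepStab.FImModule.{u, v} k m) (hV : RepStab.IsFinitelyGenerated V) :
    (∃ P : RepStab.CharPoly k m, ∀ᶠ d : Fin m → ℕ in atTop,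
      Module.Finite k (RepStab.deg V d) ∧
        ∀ σ : RepStab.SymProd d, (RepStab.degRep V d).character σ = P.value σ) ∧
    (∃ Q : MvPolynomial (Fin m) ℚ, ∀ᶠ d : Fin m → ℕ in atTop,
      (Module.finrank k (RepStab.deg V d) : ℚ) = MvPolynomial.eval (fun i => (d i : ℚ)) Q) ∧
    (∃ c : (Fin m → YoungDiagram) →₀ ℕ, ∀ᶠ d : Fin m → ℕ in atTop,
      ∃ h : ∀ lam ∈ c.support, RepStab.CanPad lam d,
        Nonempty ((RepStab.degRep V d).Equiv (RepStab.stableSum k c d h))) := by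
  have hfin := RepStab.finite_obj hV
  refine ⟨?_, RepStab.exists_dimPoly hV, ?_⟩
  · obtain ⟨P, hP⟩ := RepStab.exists_charPoly hV
    exact ⟨P, hP.mono fun d hd => ⟨hfin (RepStab.FIm.std d), hd⟩⟩
  · obtain ⟨c, hc⟩ := RepStab.exists_stable_multiplicity hV
    refine ⟨c, hc.mono fun d hd => ⟨hd.1, ?_⟩⟩
    have := hfin (RepStab.FIm.std d)
    exact RepStab.nonempty_equiv_stableSum hd.1 hd.2
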